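/- **Logic.** Let LOG be a propositional variant of Linear Logic: its formulas are generated from countably many atoms (named by binary words) by some subset of the connectives $\mathbf 1,\bot,\top,\mathbf 0,\sim,\otimes,\parr,\multimap,\&,\oplus$, a sequent $\Gamma\vdash\Delta$ consists of two finite multisets of formulas, and provability is given by an arbitrary sequent calculus on these formulas. Assume that LOG is *affine*, i.e. admits weakening: if $\Gamma\vdash\Delta$ is provable then so is $\Gamma,A\vdash\Delta$ for every formula $A$ of LOG. **Games.** An individual resource game $G^\epsilon$ has players $N=\{1,\dots,n\}$, a goal $\gamma_i$ (a formula) and an endowment $\epsilon(i)$ (a finite multiset of formulas) for each $i\in N$. A profile $P$ is a choice of sub-multisets $P_i\subseteq\epsilon(i)$, and $\mathsf{out}(P)=\biguplus_i P_i$. Player $i$ *dichotomously* strongly prefers $P$ over $Q$ (written $Q\prec_i P$) if $\mathsf{out}(P)\vdash\gamma_i$ and $\mathsf{out}(Q)\not\vdash\gamma_i$. Player $i$ *parsimoniously* strongly prefers $P$ over $Q$ if this holds, or if $\mathsf{out}(P)\vdash\gamma_i$ and $\mathsf{out}(Q)\vdash\gamma_i$ are both provable or both not provable, and $P_i\subsetneq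 Q_i$. A profile is a Nash equilibrium if no player $i$ strongly prefers to it a profile obtained by changing only $P_i$ to another sub-multiset of $\epsilon(i)$. A redistribution of $\epsilon$ is an $\epsilon'$ with $\biguplus_i\epsilon'(i)=\biguplus_i\epsilon(i)$. RATIONAL ELIMINATION: given a game $G^\epsilon$ of LOG and a profile $P$ of it, is there a redistribution $\epsilon'$ of $\epsilon$ such that no profile $P'$ of $G^{\epsilon'}$ with $\mathsf{out}(P')=\mathsf{out}(P)$ is a Nash equilibrium of $G^{\epsilon'}$? **Statement.** For dichotomous and also for parsimonious preferences: 1. If the problem of sequent validity in LOG is in $\mathsf{NP}$, then RATIONAL ELIMINATION is in $\mathsf{P^{NP||}}$ (deterministic polynomial time with non-adaptive queries to an oracle in $\mathsf{NP}$). 2. If the problem of sequent validity in LOG is in $\mathsf{PSPACE}$, then RATIONAL ELIMINATION is in $\mathsf{PSPACE}$. 3. For each player $i$ let $[\epsilon\vartriangleright i]$ be the redistribution that gives the full pool $E=\biguplus_k\epsilon(k)$ to $i$ and nothing to the others, and write $(C)$ for the profile of $G^{[\epsilon\vartriangleright i]}$ in which $i$ contributes $C\subseteq E$. A profile $P$ of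 $G^\epsilon$ is rationally eliminable if and only if for some player $i$ one has $(\mathsf{out}(P))\prec_i(E)$ in $G^{[\epsilon\vartriangleright i]}$ or, in the parsimonious case, $(\mathsf{out}(P))\prec_i(\mathsf{out}(P)\setminus\{A\})$ for some $A\in\mathsf{out}(P)$. 4. RATIONAL ELIMINATION is decided in deterministic polynomial time with non-adaptive queries to an oracle for sequent validity in LOG, in such a way that on every input $(G^\epsilon,P)$, with $P$ a profile of the game $G^\epsilon$ of LOG, all queries are of the form $X\vdash\gamma_i$ with $i\in N$ and $X$ equal to $\mathsf{out}(P)$, to $E$ or, in the parsimonious case, to $\mathsf{out}(P)\setminus\{A\}$ for some $A\in\mathsf{out}(P)$. -/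

import Mathlib

namespace RG

/-! ### Complexity classes

Machines are the finite multi-stack Turing machines `Turing.FinTM2` of Mathlib, time is the number
of machine steps, and a decision problem is a language, that is, a set of words over a finite
alphabet (a machine `Turing.FinTM2` always has a finite input alphabet). -/

/-- `f` is computed by a deterministic machine in polynomial time. -/
def PolyTime {α β : Type} (f : List α → List β) : Prop :=
  Nonempty (Turing.TM2ComputableInPolyTime (id : List α → List α) (id : List β → List β) f)

/-- The class `P`. -/
def InP {α : Type} (L : Language α) : Prop :=
  ∃ f : List α → Bool, (∀ w, f w = true ↔ w ∈ L) ∧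
    Nonempty (Turing.TM2ComputableInPolyTime (id : List α → List α) (fun b : Bool => [b]) f)

/-- A word together with a word of bits, as one word over the disjoint union of the alphabets. -/
def pair {α : Type} (w : List α) (c : List Bool) : List (α ⊕ Bool) :=
  w.map Sum.inl ++ c.map Sum.inr

/-- The class `NP`: polynomial-time verification of certificates of polynomial length. -/
def InNP {α : Type} (L : Language α) : Prop :=
  ∃ (V : Language (α ⊕ Bool)) (p : Polynomial ℕ), InP V ∧
    ∀ w, w ∈ L ↔ ∃ c : List Bool, c.length ≤ p.eval w.length ∧ pair w c ∈ V

/-- The class `PSPACE`: some machine decides `L` (in particular it halts on every word), and in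
each configuration of its run each of its finitely many stacks has polynomial height. -/
def InPSPACE {α : Type} (L : Language α) : Prop :=
  ∃ f : List α → Bool, (∀ w, f w = true ↔ w ∈ L) ∧
    ∃ (M : Turing.TM2ComputableAux α Bool) (p : Polynomial ℕ), ∀ w : List α,
      Nonempty (Turing.TM2Outputs M.tm (w.map M.inputAlphabet.invFun)
        (some ([f w].map M.outputAlphabet.invFun))) ∧
      ∀ c : M.tm.Cfg,
        StateTransition.Reaches M.tm.step
          (Turing.initList M.tm (w.map M.inputAlphabet.invFun)) c →
        ∀ k, (Turing.TM2.Cfg.stk c k).length ≤ p.eval w.length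

/-- A finite list of words as one word: each word of the list is followed by the letter `none`. -/
def joinWords {β : Type} (qs : List (List β)) : List (Option β) :=
  qs.flatMap fun q => q.map some ++ [none]

open Classical in
/-- The answers of the oracle `A` to a list of queries. -/
noncomputable def answers {β : Type} (A : Language β) (qs : List (List β)) : List Bool :=
  qs.map fun q => decide (q ∈ A)

/-- A deterministic polynomial-time decision procedure for `L` with non-adaptive queries to the
oracle `A`: the whole list `queries w` is computed in polynomial time from the input `w` alone, the
queries are asked in parallel, and the input together with the list of answers is then accepted or
rejected in polynomial time. -/
def IsParallelQueryAlgorithm {α β : Type} (L : Language α) (A : Language β)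
    (queries : List α → List (List β)) : Prop :=
  PolyTime (fun w => joinWords (queries w)) ∧
    ∃ V : Language (α ⊕ Bool), InP V ∧ ∀ w, w ∈ L ↔ pair w (answers A (queries w)) ∈ V

/-- The class `P^{NP||}` (also called `Θ₂ᵖ`). -/
def InPNPParallel {α : Type} (L : Language α) : Prop :=
  ∃ (β : Type) (_ : Fintype β) (A : Language β) (queries : List α → List (List β)),
    InNP A ∧ IsParallelQueryAlgorithm L A queries

/-! ### Propositional Linear Logic -/

/-- Connectives and units of propositional Linear Logic. -/
inductive Connective
  | one | bot | top | zero | neg | tensor | par | lolli | amp | plus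
  deriving DecidableEq

/-- Formulas of propositional Linear Logic; atoms are named by binary words. -/
inductive Formula
  | atom (name : List Bool)
  | one | bot | top | zero
  | neg (A : Formula)
  | tensor (A B : Formula)
  | par (A B : Formula)
  | lolli (A B : Formula)
  | amp (A B : Formula)
  | plus (A B : Formula)
  deriving DecidableEq

/-- The formulas generated by the atoms and the connectives in `C`. -/
def Formula.Over (C : Set Connective) : Formula → Prop
  | .atom _ => True
  | .one => .one ∈ C
  | .bot => .bot ∈ C
  | .top => .top ∈ C
  | .zero => .zero ∈ C
  | .neg A => .neg ∈ C ∧ A.Over C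
  | .tensor A B => .tensor ∈ C ∧ A.Over C ∧ B.Over C
  | .par A B => .par ∈ C ∧ A.Over C ∧ B.Over C
  | .lolli A B => .lolli ∈ C ∧ A.Over C ∧ B.Over C
  | .amp A B => .amp ∈ C ∧ A.Over C ∧ B.Over C
  | .plus A B => .plus ∈ C ∧ A.Over C ∧ B.Over C

/-- A sequent `ante ⊢ succ` between finite multisets of formulas. -/
structure Sequent where
  ante : Multiset Formula
  succ : Multiset Formula

/-- A propositional variant of Linear Logic: a fragment of the language, given by its connectives,
and a sequent calculus, given by the instances (premises and conclusion) of its rules. -/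
structure ResourceLogic where
  connectives : Set Connective
  rule : List Sequent → Sequent → Prop

/-- The formulas of the logic. -/
def ResourceLogic.IsFormula (LOG : ResourceLogic) (A : Formula) : Prop :=
  A.Over LOG.connectives

/-- Provability of sequents: there is a proof tree built with the rules of the logic, all of whose
sequents consist of formulas of the logic. -/
inductive ResourceLogic.Provable (LOG : ResourceLogic) : Sequent → Prop
  | infer (premises : List Sequent) (s : Sequent) (hrule : LOG.rule premises s)
      (hante : ∀ A ∈ s.ante, LOG.IsFormula A) (hsucc : ∀ A ∈ s.succ, LOG.IsFormula A)
      (hpremises : ∀ t ∈ premises, LOG.Provable t) : LOG.Provable s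

/-- `Γ ⊢ A` is provable. -/
def ResourceLogic.Proves (LOG : ResourceLogic) (Γ : Multiset Formula) (A : Formula) : Prop :=
  LOG.Provable ⟨Γ, {A}⟩

/-- The logic is affine: it admits the rule of weakening, from `Γ ⊢ Δ` infer `Γ, A ⊢ Δ`. -/
def ResourceLogic.Affine (LOG : ResourceLogic) : Prop :=
  ∀ (Γ Δ : Multiset Formula) (A : Formula), LOG.IsFormula A →
    LOG.Provable ⟨Γ, Δ⟩ → LOG.Provable ⟨A ::ₘ Γ, Δ⟩

/-! The standard logics that are instances of `ResourceLogic`. -/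

/-- The rules of MALL (exchange is built into multisets). -/
inductive LinearRule : List Sequent → Sequent → Prop
  | ax (A) : LinearRule [] ⟨{A}, {A}⟩
  | cut (Γ Γ' Δ Δ' A) : LinearRule [⟨A ::ₘ Γ, Δ⟩, ⟨Γ', A ::ₘ Δ'⟩] ⟨Γ + Γ', Δ + Δ'⟩
  | negL (Γ Δ) (A : Formula) : LinearRule [⟨Γ, A ::ₘ Δ⟩] ⟨A.neg ::ₘ Γ, Δ⟩
  | negR (Γ Δ) (A : Formula) : LinearRule [⟨A ::ₘ Γ, Δ⟩] ⟨Γ, A.neg ::ₘ Δ⟩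
  | tensorR (Γ Γ' Δ Δ') (A B : Formula) :
      LinearRule [⟨Γ, A ::ₘ Δ⟩, ⟨Γ', B ::ₘ Δ'⟩] ⟨Γ + Γ', A.tensor B ::ₘ (Δ + Δ')⟩
  | tensorL (Γ Δ) (A B : Formula) : LinearRule [⟨A ::ₘ B ::ₘ Γ, Δ⟩] ⟨A.tensor B ::ₘ Γ, Δ⟩
  | parL (Γ Γ' Δ Δ') (A B : Formula) :
      LinearRule [⟨A ::ₘ Γ, Δ⟩, ⟨B ::ₘ Γ', Δ'⟩] ⟨A.par B ::ₘ (Γ + Γ'), Δ + Δ'⟩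
  | parR (Γ Δ) (A B : Formula) : LinearRule [⟨Γ, A ::ₘ B ::ₘ Δ⟩] ⟨Γ, A.par B ::ₘ Δ⟩
  | lolliL (Γ Γ' Δ Δ') (A B : Formula) :
      LinearRule [⟨Γ, A ::ₘ Δ⟩, ⟨B ::ₘ Γ', Δ'⟩] ⟨A.lolli B ::ₘ (Γ + Γ'), Δ + Δ'⟩
  | lolliR (Γ Δ) (A B : Formula) : LinearRule [⟨A ::ₘ Γ, B ::ₘ Δ⟩] ⟨Γ, A.lolli B ::ₘ Δ⟩
  | oneL (Γ Δ) : LinearRule [⟨Γ, Δ⟩] ⟨.one ::ₘ Γ, Δ⟩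
  | oneR : LinearRule [] ⟨0, {.one}⟩
  | botL : LinearRule [] ⟨{.bot}, 0⟩
  | botR (Γ Δ) : LinearRule [⟨Γ, Δ⟩] ⟨Γ, .bot ::ₘ Δ⟩
  | ampR (Γ Δ) (A B : Formula) : LinearRule [⟨Γ, A ::ₘ Δ⟩, ⟨Γ, B ::ₘ Δ⟩] ⟨Γ, A.amp B ::ₘ Δ⟩
  | ampL₀ (Γ Δ) (A B : Formula) : LinearRule [⟨A ::ₘ Γ, Δ⟩] ⟨A.amp B ::ₘ Γ, Δ⟩
  | ampL₁ (Γ Δ) (A B : Formula) : LinearRule [⟨B ::ₘ Γ, Δ⟩] ⟨A.amp B ::ₘ Γ, Δ⟩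
  | plusL (Γ Δ) (A B : Formula) : LinearRule [⟨A ::ₘ Γ, Δ⟩, ⟨B ::ₘ Γ, Δ⟩] ⟨A.plus B ::ₘ Γ, Δ⟩
  | plusR₀ (Γ Δ) (A B : Formula) : LinearRule [⟨Γ, A ::ₘ Δ⟩] ⟨Γ, A.plus B ::ₘ Δ⟩
  | plusR₁ (Γ Δ) (A B : Formula) : LinearRule [⟨Γ, B ::ₘ Δ⟩] ⟨Γ, A.plus B ::ₘ Δ⟩
  | topR (Γ Δ) : LinearRule [] ⟨Γ, .top ::ₘ Δ⟩
  | zeroL (Γ Δ) : LinearRule [] ⟨.zero ::ₘ Γ, Δ⟩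

/-- The structural rules of weakening. -/
inductive WeakeningRule : List Sequent → Sequent → Prop
  | left (Γ Δ A) : WeakeningRule [⟨Γ, Δ⟩] ⟨A ::ₘ Γ, Δ⟩
  | right (Γ Δ A) : WeakeningRule [⟨Γ, Δ⟩] ⟨Γ, A ::ₘ Δ⟩

/-- The connectives of the multiplicative fragment. -/
def multiplicatives : Set Connective := {.one, .bot, .neg, .tensor, .par, .lolli}

/-- The connectives of the intuitionistic language. -/
def intuitionisticConnectives : Set Connective := {.one, .top, .zero, .tensor, .lolli, .amp, .plus}

/-- Linear logic with the connectives in `C`: MALL for `Set.univ`, MLL for `multiplicatives`. -/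
def linearLogic (C : Set Connective) : ResourceLogic := ⟨C, LinearRule⟩

/-- Affine logic with the connectives in `C`. -/
def affineLogic (C : Set Connective) : ResourceLogic :=
  ⟨C, fun ps s => LinearRule ps s ∨ WeakeningRule ps s⟩

/-- The intuitionistic restriction of a logic: one formula on the right of every sequent. -/
def ResourceLogic.intuitionistic (LOG : ResourceLogic) : ResourceLogic :=
  ⟨LOG.connectives ∩ intuitionisticConnectives, fun ps s => LOG.rule ps s ∧ s.succ.card = 1⟩

theorem affineLogic_affine (C : Set Connective) : (affineLogic C).Affine := by
  intro Γ Δ A hA h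
  refine .infer [⟨Γ, Δ⟩] _ (Or.inr (.left Γ Δ A)) ?_ ?_ (by simpa using h)
  · obtain ⟨_, _, _, hante, _, _⟩ := h
    intro B hB
    rcases Multiset.mem_cons.1 hB with rfl | hB
    · exact hA
    · exact hante B hB
  · obtain ⟨_, _, _, _, hsucc, _⟩ := h
    exact hsucc

/-! ### Individual resource games -/

/-- An individual resource game with `n` players: goals and endowments. -/
structure Game (n : ℕ) where
  goal : Fin n → Formula
  endow : Fin n → Multiset Formula

/-- The game is formulated in the language of the logic. -/
def Game.IsOver {n : ℕ} (G : Game n) (LOG : ResourceLogic) : Prop :=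
  ∀ i, LOG.IsFormula (G.goal i) ∧ ∀ A ∈ G.endow i, LOG.IsFormula A

/-- A contribution (a finite multiset of formulas) of each player. -/
abbrev Profile (n : ℕ) := Fin n → Multiset Formula

/-- The profiles of the game: each player contributes a sub-multiset of the endowment
(`≤` on multisets is inclusion with multiplicities). -/
def Game.ch {n : ℕ} (G : Game n) : Set (Profile n) := {P | ∀ i, P i ≤ G.endow i}

/-- The outcome of a profile: the multiset union of the contributions. -/
def out {n : ℕ} (P : Profile n) : Multiset Formula := ∑ i, P i

/-- The two kinds of preferences. -/
inductive Preference
  | dichotomous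
  | parsimonious

/-- `i` strongly prefers `P` over `Q` (with `<` the strict inclusion of multisets). -/
def StronglyPrefers (LOG : ResourceLogic) (pref : Preference) {n : ℕ} (G : Game n) (i : Fin n)
    (P Q : Profile n) : Prop :=
  match pref with
  | .dichotomous => LOG.Proves (out P) (G.goal i) ∧ ¬ LOG.Proves (out Q) (G.goal i)
  | .parsimonious =>
      (¬ LOG.Proves (out P) (G.goal i) ∧ ¬ LOG.Proves (out Q) (G.goal i) ∧ P i < Q i) ∨
      (LOG.Proves (out P) (G.goal i) ∧ ¬ LOG.Proves (out Q) (G.goal i)) ∨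
      (LOG.Proves (out P) (G.goal i) ∧ LOG.Proves (out Q) (G.goal i) ∧ P i < Q i)

/-- The set of Nash equilibria. -/
def NE (LOG : ResourceLogic) (pref : Preference) {n : ℕ} (G : Game n) : Set (Profile n) :=
  {P | P ∈ G.ch ∧ ∀ (i : Fin n) (C : Multiset Formula), C ≤ G.endow i →
    ¬ StronglyPrefers LOG pref G i (Function.update P i C) P}

/-- The redistributions of an endowment function. -/
def redis {n : ℕ} (ε : Fin n → Multiset Formula) : Set (Fin n → Multiset Formula) :=
  {ε' | ∑ i, ε' i = ∑ i, ε i}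

/-- The profile `P` of `G` is rationally eliminable. -/
def RationallyEliminable (LOG : ResourceLogic) (pref : Preference) {n : ℕ} (G : Game n)
    (P : Profile n) : Prop :=
  ∃ ε' ∈ redis G.endow, ∀ P' ∈ Game.ch ⟨G.goal, ε'⟩, out P' = out P →
    P' ∉ NE LOG pref ⟨G.goal, ε'⟩

/-- The full pool of resources of the game. -/
def Game.pool {n : ℕ} (G : Game n) : Multiset Formula := ∑ i, G.endow i

/-- The game in which all resources are given to `i`. -/
def Game.giveAll {n : ℕ} (G : Game n) (i : Fin n) : Game n := ⟨G.goal, Pi.single i G.pool⟩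

/-- The checks of the elimination algorithm: for some player `i`, in the game in which `i` owns all
resources, `i` prefers over the contribution `out P` the full pool or, for parsimonious preferences,
`out P` minus one formula. -/
def EliminationTest (LOG : ResourceLogic) (pref : Preference) {n : ℕ} (G : Game n)
    (P : Profile n) : Prop :=
  ∃ i : Fin n,
    StronglyPrefers LOG pref (G.giveAll i) i (Pi.single i G.pool) (Pi.single i (out P)) ∨
    (pref = .parsimonious ∧ ∃ A ∈ out P,
      StronglyPrefers LOG pref (G.giveAll i) i (Pi.single i ((out P).erase A))
        (Pi.single i (out P)))

/-! ### Decision problems as languages -/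

/-- The alphabet of the encodings. -/
inductive Letter
  | conn (c : Connective)
  | bit (b : Bool)
  | dot | comma | turnstile | semicolon
  deriving DecidableEq

/-- Formulas in prefix notation; the name of an atom is closed by a dot. -/
def encodeFormula : Formula → List Letter
  | .atom w => w.map .bit ++ [.dot]
  | .one => [.conn .one]
  | .bot => [.conn .bot]
  | .top => [.conn .top]
  | .zero => [.conn .zero]
  | .neg A => .conn .neg :: encodeFormula A
  | .tensor A B => .conn .tensor :: (encodeFormula A ++ encodeFormula B)
  | .par A B => .conn .par :: (encodeFormula A ++ encodeFormula B)
  | .lolli A B => .conn .lolli :: (encodeFormula A ++ encodeFormula B)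
  | .amp A B => .conn .amp :: (encodeFormula A ++ encodeFormula B)
  | .plus A B => .conn .plus :: (encodeFormula A ++ encodeFormula B)

/-- A multiset of formulas, listed in some order. -/
def encodeFormulas (Γ : List Formula) : List Letter :=
  Γ.flatMap fun A => encodeFormula A ++ [.comma]

/-- A sequent, with its sides listed in some order. -/
def encodeSequent (Γ Δ : List Formula) : List Letter :=
  encodeFormulas Γ ++ .turnstile :: encodeFormulas Δ

/-- The problem of sequent validity. -/
def SequentValidity (LOG : ResourceLogic) : Language Letter :=
  {w | ∃ Γ Δ : List Formula, w = encodeSequent Γ Δ ∧ LOG.Provable ⟨Γ, Δ⟩}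

/-- The data of one player in an input: goal, endowment and contribution. -/
structure PlayerData where
  goal : Formula
  endowment : List Formula
  contribution : List Formula

/-- A game together with a choice of contributions. -/
abbrev REInput := List PlayerData

def REInput.game (x : REInput) : Game x.length :=
  ⟨fun i => (x.get i).goal, fun i => ((x.get i).endowment : Multiset Formula)⟩

def REInput.profile (x : REInput) : Profile x.length :=
  fun i => ((x.get i).contribution : Multiset Formula)

/-- The input is a game of the logic and a profile of this game. -/
def REInput.Legal (x : REInput) (LOG : ResourceLogic) : Prop :=
  (REInput.game x).IsOver LOG ∧ REInput.profile x ∈ (REInput.game x).ch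

def encodeInput (x : REInput) : List Letter :=
  x.flatMap fun d => encodeFormula d.goal ++ .semicolon ::
    (encodeFormulas d.endowment ++ .semicolon ::
      (encodeFormulas d.contribution ++ [.semicolon]))

/-- The problem RATIONAL ELIMINATION. -/
def RationalElimination (LOG : ResourceLogic) (pref : Preference) : Language Letter :=
  {w | ∃ x : REInput, w = encodeInput x ∧ x.Legal LOG ∧
    RationallyEliminable LOG pref (REInput.game x) (REInput.profile x)}

/-- The word `q` is a sequent that occurs in the checks of the elimination algorithm on `x`: its
right side is the goal of a player, and its left side is the outcome, the full pool or, for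
parsimonious preferences, the outcome minus one formula. -/
def IsEliminationQuery (pref : Preference) (x : REInput) (q : List Letter) : Prop :=
  ∃ (i : Fin x.length) (Γ : List Formula), q = encodeSequent Γ [(REInput.game x).goal i] ∧
    ((Γ : Multiset Formula) = out (REInput.profile x) ∨
      (Γ : Multiset Formula) = (REInput.game x).pool ∨
      (pref = .parsimonious ∧ ∃ A ∈ out (REInput.profile x),
        (Γ : Multiset Formula) = (out (REInput.profile x)).erase A))

end RG

/-! Weakening makes provability monotone in the context, and this reduces all redistributions to
those in which one player owns everything. Let `O` be the outcome of `P` and `E` the pool. In every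
redistribution some profile has the outcome `O` (`exists_contributions`). If the redistribution
eliminates `P`, this profile is no equilibrium, so some player `i` has a profitable deviation. If
the deviation newly proves the goal of `i`, then so does `E`, which contains every outcome. If it
saves resources, then its outcome lies in `O` minus some formula `A`; now either `O` does not prove
the goal, and giving up `A` is an improvement in any case, or `O` without `A` still proves it.
Conversely, if `i` owns everything, then `(O)` is the only profile with outcome `O`, and
contributing `E` or `O` minus `A` is an available deviation. This is `rationallyEliminable_iff`.

Rational elimination is therefore a Boolean combination of polynomially many validity queries that
are known in advance (`isParallelQueryAlgorithm`). With validity in `NP` this is already the claim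
about parallel queries. With validity in `PSPACE` the queries are answered one after the other in
the same space (`InPSPACE.of_parallelQuery`).

Most of the work consists in exhibiting machines. `Prog` is a language of structured programs that
is compiled into `Turing.FinTM2`, with exact step counts (`Run.steps`). `LProg` is a sublanguage
whose loops empty a stack that their bodies leave alone. Its programs always terminate and have a
denotation `den`, and a syntactic condition `wf` on the growth of stacks yields polynomial time
(`size_den_le`, `polyRun`). The program `Writer.main` parses the word, checks that it encodes a
legal input and writes the queries; `outRev_main` computes its denotation. The answers are evaluated
by a finite automaton (`inP_automaton`). -/

namespace RG

/-! ### Structured programs over stacks -/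

section Programs

/-- `Steps f I n a b`: the transition function `f` leads from `a` to `b` in `n` steps, and all
states after `a` satisfy `I`. -/
inductive Steps {C : Type*} (f : C → Option C) (I : C → Prop) : ℕ → C → C → Prop
  | refl (a : C) : Steps f I 0 a a
  | head {n : ℕ} {a b c : C} (h : f a = some b) (hb : I b) (hs : Steps f I n b c) :
      Steps f I (n + 1) a c

namespace Steps

variable {C : Type*} {f : C → Option C} {I J : C → Prop} {m n : ℕ} {a b c : C}

theorem single (h : f a = some b) (hb : I b) : Steps f I 1 a b := .head h hb (.refl b)

theorem trans (h₁ : Steps f I m a b) (h₂ : Steps f I n b c) : Steps f I (m + n) a c := by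
  induction h₁ with
  | refl => simpa using h₂
  | head h hb _ ih => rw [Nat.add_right_comm]; exact .head h hb (ih h₂)

theorem evals (h : Steps f I n a b) : (flip bind f)^[n] (some a) = some b := by
  induction h with
  | refl => rfl
  | head h _ _ ih => rw [Function.iterate_succ_apply]; simpa [flip, h] using ih

/-- Beyond a halting configuration the iteration stays at `none`, so an iterate with a value comes
from a genuine run. -/
theorem of_evals : ∀ (n : ℕ) (a : C), (flip bind f)^[n] (some a) = some b →
    Steps f (fun _ => True) n a b
  | 0, a, h => by obtain rfl : a = b := by simpa using h
                  exact .refl a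
  | n + 1, a, h => by
      rw [Function.iterate_succ_apply] at h
      cases hf : f a with
      | none =>
        have hn : ∀ n, (flip bind f)^[n] none = none := by
          intro n
          induction n with
          | zero => rfl
          | succ n ih => rw [Function.iterate_succ_apply]; simpa [flip] using ih
        have h' : flip bind f (some a) = none := by simp [flip, hf]
        rw [h', hn] at h
        cases h
      | some c => exact .head hf trivial (of_evals n c (by simpa [flip, hf] using h))

/-- All configurations of a run are reachable, so a bound on the reachable ones, as in `InPSPACE`,
becomes an invariant of the run. -/
theorem imp_of_reaches (h : Steps f I n a b)
    (hJ : ∀ c, StateTransition.Reaches f a c → J c) : Steps f J n a b := by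
  induction h with
  | refl => exact .refl _
  | head h _ _ ih =>
    refine .head h (hJ _ (.single h)) (ih fun c hc => hJ c (.head h hc))

/-- The transitions are deterministic, so a run that ends in a halting configuration passes through
every reachable configuration. -/
theorem inv_of_reaches (h : Steps f I n a b) (ha : I a) (hb : f b = none)
    (hc : StateTransition.Reaches f a c) : I c := by
  induction h with
  | refl =>
    rcases Relation.ReflTransGen.cases_head hc with rfl | ⟨d, hd, _⟩
    · exact ha
    · simp [hb] at hd
  | head h hI _ ih =>
    rcases Relation.ReflTransGen.cases_head hc with rfl | ⟨d, hd, hdc⟩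
    · exact ha
    · rw [h] at hd
      obtain rfl := Option.mem_some_iff.1 hd
      exact ih hI hb hdc

end Steps

variable {K : Type} {Γ : K → Type} {σ : Type}

/-- Structured programs that work on a family of stacks and on an internal state. -/
inductive Prog (Γ : K → Type) (σ : Type) : Type
  | load (f : σ → σ)
  | push (k : K) (f : σ → Γ k)
  | peek (k : K) (f : σ → Option (Γ k) → σ)
  | pop (k : K) (f : σ → Option (Γ k) → σ)
  | seq (p q : Prog Γ σ)
  | choose (p : σ → Prog Γ σ)
  | loop (c : σ → Bool) (p : Prog Γ σ)

namespace Prog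

/-- `Run I p v S t v' S'`: from the state `v` and the stacks `S`, the program `p` arrives in `t`
steps at `v'` and `S'`, and all families of stacks after `S` satisfy `I`. -/
inductive Run [DecidableEq K] (I : (∀ k, List (Γ k)) → Prop) :
    Prog Γ σ → σ → (∀ k, List (Γ k)) → ℕ → σ → (∀ k, List (Γ k)) → Prop
  | load (f v S) (h : I S) : Run I (.load f) v S 1 (f v) S
  | push (k f v S) (h : I (Function.update S k (f v :: S k))) :
      Run I (.push k f) v S 1 v (Function.update S k (f v :: S k))
  | peek (k f v S) (h : I S) : Run I (.peek k f) v S 1 (f v (S k).head?) S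
  | pop (k f v S) (h : I (Function.update S k (S k).tail)) :
      Run I (.pop k f) v S 1 (f v (S k).head?) (Function.update S k (S k).tail)
  | seq {p q v S t v' S' t' v'' S''} (hp : Run I p v S t v' S') (hq : Run I q v' S' t' v'' S'') :
      Run I (.seq p q) v S (t + t') v'' S''
  | choose {p v S t v' S'} (h : I S) (hp : Run I (p v) v S t v' S') :
      Run I (.choose p) v S (1 + t) v' S'
  | done {c p v S} (h : I S) (hc : c v = false) : Run I (.loop c p) v S 1 v S
  | next {c p v S t v' S' t' v'' S''} (h : I S) (hc : c v = true) (hp : Run I p v S t v' S')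
      (hq : Run I (.loop c p) v' S' t' v'' S'') : Run I (.loop c p) v S (1 + (t + t')) v'' S''

/-- The labels of the machine for a program. -/
def Lab : Prog Γ σ → Type
  | load _ | push _ _ | peek _ _ | pop _ _ => Unit
  | seq p q => p.Lab ⊕ q.Lab
  | choose p => Option (Σ v, (p v).Lab)
  | loop _ p => Option p.Lab

/-- The branches of `choose` are indexed by the internal states, so it is here that finiteness of
`σ` is needed. -/
theorem finite_lab [Finite σ] : ∀ p : Prog Γ σ, Finite p.Lab
  | load _ | push _ _ | peek _ _ | pop _ _ => inferInstanceAs (Finite Unit)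
  | seq p q => by
      have := finite_lab p
      have := finite_lab q
      exact inferInstanceAs (Finite (p.Lab ⊕ q.Lab))
  | choose p => by
      have := fun v => finite_lab (p v)
      exact inferInstanceAs (Finite (Option (Σ v, (p v).Lab)))
  | loop _ p => by
      have := finite_lab p
      exact inferInstanceAs (Finite (Option p.Lab))

/-- The label at which the execution of a program starts. -/
def entry : (p : Prog Γ σ) → p.Lab
  | load _ | push _ _ | peek _ _ | pop _ _ => ()
  | seq p _ => Sum.inl p.entry
  | choose _ => none
  | loop _ _ => none

open Turing TM2 in
/-- Continue at a label, or halt. -/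
def exitStmt {Λ : Type} : Option Λ → Stmt Γ Λ σ
  | none => .halt
  | some l => .goto fun _ => l

open Turing TM2 in
/-- The statements of the machine for a program whose labels are embedded by `e` and which
continues at `x`. -/
def code {Λ : Type} : (p : Prog Γ σ) → (p.Lab → Λ) → Option Λ → p.Lab → Stmt Γ Λ σ
  | load f, _, x, _ => .load f (exitStmt x)
  | push k f, _, x, _ => .push k f (exitStmt x)
  | peek k f, _, x, _ => .peek k f (exitStmt x)
  | pop k f, _, x, _ => .pop k f (exitStmt x)
  | seq p q, e, _, .inl a => p.code (fun a => e (.inl a)) (some (e (.inr q.entry))) a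
  | seq _ q, e, x, .inr b => q.code (fun b => e (.inr b)) x b
  | choose p, e, _, none => .goto fun v => e (some ⟨v, (p v).entry⟩)
  | choose p, e, x, some ⟨v, a⟩ => (p v).code (fun a => e (some ⟨v, a⟩)) x a
  | loop c p, e, x, none => .branch c (.goto fun _ => e (some p.entry)) (exitStmt x)
  | loop _ p, e, _, some a => p.code (fun a => e (some a)) (some (e none)) a

variable [DecidableEq K]

open Turing in
theorem stepAux_exitStmt {Λ : Type} (x : Option Λ) (v : σ) (S : ∀ k, List (Γ k)) :
    TM2.stepAux (exitStmt x) v S = ⟨x, v, S⟩ := by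
  cases x <;> rfl

open Turing in
-- Inside a larger program the labels of a subprogram are embedded and its exit is the entry of what
-- follows, so the induction requires an arbitrary embedding `e` and an arbitrary exit `x`.
theorem Run.steps {I : (∀ k, List (Γ k)) → Prop} {p : Prog Γ σ} {v : σ} {S : ∀ k, List (Γ k)}
    {t : ℕ} {v' : σ} {S' : ∀ k, List (Γ k)} (h : Run I p v S t v' S') {Λ : Type}
    (m : Λ → TM2.Stmt Γ Λ σ) : ∀ (e : p.Lab → Λ) (x : Option Λ), (∀ a, m (e a) = p.code e x a) →
    Steps (TM2.step m) (fun c => I c.stk) t ⟨some (e p.entry), v, S⟩ ⟨x, v', S'⟩ := by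
  induction h with
  | load f v S h =>
    intro e x hm
    exact .single (by simp [hm, code, stepAux_exitStmt]) h
  | push k f v S h =>
    intro e x hm
    exact .single (by simp [hm, code, stepAux_exitStmt]) h
  | peek k f v S h =>
    intro e x hm
    exact .single (by simp [hm, code, stepAux_exitStmt]) h
  | pop k f v S h =>
    intro e x hm
    exact .single (by simp [hm, code, stepAux_exitStmt]) h
  | @seq p q v S t v' S' t' v'' S'' hp hq ihp ihq =>
    intro e x hm
    exact (ihp _ _ fun a => hm (.inl a)).trans (ihq _ _ fun b => hm (.inr b))
  | @choose p v S t v' S' h hp ih =>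
    intro e x hm
    have hn : m (e none) = .goto fun v => e (some ⟨v, (p v).entry⟩) := hm none
    have hs : TM2.step m ⟨some (e (Prog.choose p).entry), v, S⟩ =
        some ⟨some (e (some ⟨v, (p v).entry⟩)), v, S⟩ :=
      congrArg some (by change TM2.stepAux (m (e none)) v S = _; rw [hn]; rfl)
    exact (Steps.single hs h).trans
      (ih (fun a => e (some ⟨v, a⟩)) x fun a => hm (some ⟨v, a⟩))
  | @done c p v S h hc =>
    intro e x hm
    have hn : m (e none) = .branch c (.goto fun _ => e (some p.entry)) (exitStmt x) := hm none
    have hs : TM2.step m ⟨some (e (Prog.loop c p).entry), v, S⟩ = some ⟨x, v, S⟩ :=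
      congrArg some (by
        change TM2.stepAux (m (e none)) v S = _
        rw [hn, TM2.stepAux, hc, cond_false, stepAux_exitStmt])
    exact .single hs h
  | @next c p v S t v' S' t' v'' S'' h hc hp hq ihp ihq =>
    intro e x hm
    have hn : m (e none) = .branch c (.goto fun _ => e (some p.entry)) (exitStmt x) := hm none
    have hs : TM2.step m ⟨some (e (Prog.loop c p).entry), v, S⟩ = some ⟨some (e (some p.entry)), v, S⟩ :=
      congrArg some (by
        change TM2.stepAux (m (e none)) v S = _
        rw [hn, TM2.stepAux, hc, cond_true, TM2.stepAux])
    exact (Steps.single hs h).trans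
      ((ihp (fun a => e (some a)) _ fun a => hm (some a)).trans (ihq e x hm))

/-- A program does not push more letters than it makes steps. -/
theorem Run.sum_length_le {I : (∀ k, List (Γ k)) → Prop} {p : Prog Γ σ} {v : σ}
    {S : ∀ k, List (Γ k)} {t : ℕ} {v' : σ} {S' : ∀ k, List (Γ k)} (h : Run I p v S t v' S')
    (W : Finset K) : ∑ k ∈ W, (S' k).length ≤ ∑ k ∈ W, (S k).length + t := by
  induction h with
  | load _ _ _ h => omega
  | push k f v S h =>
    have : ∀ j ∈ W, (Function.update S k (f v :: S k) j).length
        ≤ (S j).length + if k = j then 1 else 0 := by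
      intro j _
      rcases eq_or_ne j k with rfl | hj
      · simp
      · simp [hj]
    refine (Finset.sum_le_sum this).trans ?_
    rw [Finset.sum_add_distrib, Finset.sum_ite_eq]
    split <;> simp
  | peek _ _ _ _ h => omega
  | pop k f v S h =>
    refine (Finset.sum_le_sum (g := fun j => (S j).length) fun j _ => ?_).trans (by simp)
    rcases eq_or_ne j k with rfl | hj
    · simp
    · simp [hj]
  | seq _ _ ihp ihq => omega
  | choose h _ ih => omega
  | done h hc => omega
  | next h hc _ _ ihp ihq => omega

open Turing in
/-- The machine for a program. -/
noncomputable def machine [Fintype K] [Fintype σ] (p : Prog Γ σ) (k₀ k₁ : K) (v : σ)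
    [Fintype (Γ k₀)] : FinTM2 :=
  haveI := p.finite_lab
  letI := Fintype.ofFinite p.Lab
  { K := K, k₀ := k₀, k₁ := k₁, Γ := Γ, Λ := p.Lab, main := p.entry, σ := σ, initialState := v
    m := p.code id none }

open Turing in
theorem initList_eq (M : FinTM2) (s : List (M.Γ M.k₀)) :
    initList M s = ⟨some M.main, M.initialState, Function.update (fun _ => []) M.k₀ s⟩ := by
  refine congrArg (TM2.Cfg.mk _ _) (funext fun k => ?_)
  by_cases h : k = M.k₀
  · subst h; simp
  · simp [h]

open Turing in
theorem haltList_eq (M : FinTM2) (s : List (M.Γ M.k₁)) :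
    haltList M s = ⟨none, M.initialState, Function.update (fun _ => []) M.k₁ s⟩ := by
  refine congrArg (TM2.Cfg.mk _ _) (funext fun k => ?_)
  by_cases h : k = M.k₁
  · subst h; simp
  · simp [h]

open Turing in
-- `haltList` demands the initial internal state and empty stacks apart from `k₁`; hence the run has
-- to return to `v`.
theorem Run.machine_steps [Fintype K] [Fintype σ] {p : Prog Γ σ} {k₀ k₁ : K} {v : σ}
    [Fintype (Γ k₀)] {I : (∀ k, List (Γ k)) → Prop} {t : ℕ} {s : List (Γ k₀)} {s' : List (Γ k₁)}
    (h : Run I p v (Function.update (fun _ => []) k₀ s) t v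
      (Function.update (fun _ => []) k₁ s')) :
    Steps (p.machine k₀ k₁ v).step (fun c => I (TM2.Cfg.stk c)) t (initList (p.machine k₀ k₁ v) s)
      (haltList (p.machine k₀ k₁ v) s') := by
  have key := h.steps (p.code id none) id none fun _ => rfl
  have gen : ∀ a b : TM2.Cfg Γ p.Lab σ, a = ⟨some p.entry, v, Function.update (fun _ => []) k₀ s⟩ →
      b = ⟨none, v, Function.update (fun _ => []) k₁ s'⟩ →
      Steps (TM2.step (p.code id none)) (fun c => I c.stk) t a b := by
    rintro _ _ rfl rfl
    exact key
  exact gen _ _ (initList_eq (p.machine k₀ k₁ v) s) (haltList_eq (p.machine k₀ k₁ v) s')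

end Prog

end Programs

end RG

namespace RG

/-! ### Terminating programs with a denotation -/

section Terminating

variable {K : Type} [DecidableEq K] {Γ : K → Type} {σ D : Type}

/-- A presentation `D` of the pairs of an internal state and a family of stacks, together with the
way in which a letter popped from a stack is stored in the internal state. -/
structure Model (Γ : K → Type) (σ D : Type) where
  var : D → σ
  stk : D → ∀ k, List (Γ k)
  setVar : D → σ → D
  set : D → (k : K) → List (Γ k) → D
  rd : (k : K) → σ → Option (Γ k) → σ
  got : σ → Bool
  ext' : ∀ d d', var d = var d' → stk d = stk d' → d = d'
  var_setVar : ∀ d v, var (setVar d v) = v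
  stk_setVar : ∀ d v, stk (setVar d v) = stk d
  var_set : ∀ d k l, var (set d k l) = var d
  stk_set : ∀ d k l, stk (set d k l) = Function.update (stk d) k l
  got_rd : ∀ k v o, got (rd k v o) = o.isSome

/-- Programs whose loops empty a stack. -/
inductive LProg (Γ : K → Type) (σ : Type) : Type
  | load (f : σ → σ)
  | push (k : K) (f : σ → Γ k)
  | pop (k : K)
  | shift (k k' : K) (f : σ → Γ k')
  | seq (p q : LProg Γ σ)
  | ite (c : σ → Bool) (p q : LProg Γ σ)
  | loop (k : K) (p : LProg Γ σ)

namespace Model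

variable (m : Model Γ σ D)

/-- Store a popped letter in the internal state. -/
def read (k : K) (o : Option (Γ k)) (d : D) : D := m.setVar d (m.rd k (m.var d) o)

theorem read_set (k j : K) (o : Option (Γ k)) (d : D) (l : List (Γ j)) :
    m.read k o (m.set d j l) = m.set (m.read k o d) j l :=
  m.ext' _ _ (by simp [read, m.var_set, m.var_setVar])
    (by simp [read, m.stk_set, m.stk_setVar])

theorem stk_read (k : K) (o : Option (Γ k)) (d : D) : m.stk (m.read k o d) = m.stk d :=
  m.stk_setVar _ _

theorem set_comm {k j : K} (h : k ≠ j) (d : D) (l : List (Γ k)) (l' : List (Γ j)) :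
    m.set (m.set d k l) j l' = m.set (m.set d j l') k l :=
  m.ext' _ _ (by simp [m.var_set]) (by simp [m.stk_set, Function.update_comm h])

theorem set_setVar (d : D) (k : K) (l : List (Γ k)) (v : σ) :
    m.setVar (m.set d k l) v = m.set (m.setVar d v) k l :=
  m.ext' _ _ (by simp [m.var_set, m.var_setVar]) (by simp [m.stk_set, m.stk_setVar])

theorem set_set (d : D) (k : K) (l l' : List (Γ k)) : m.set (m.set d k l) k l' = m.set d k l' :=
  m.ext' _ _ (by simp [m.var_set]) (by simp [m.stk_set])

theorem set_stk (d : D) (k : K) : m.set d k (m.stk d k) = d :=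
  m.ext' _ _ (by simp [m.var_set]) (by simp [m.stk_set])

theorem stk_set_ne (d : D) {k j : K} (h : j ≠ k) (l : List (Γ k)) :
    m.stk (m.set d k l) j = m.stk d j := by
  simp [m.stk_set, h]

theorem stk_set_self (d : D) (k : K) (l : List (Γ k)) : m.stk (m.set d k l) k = l := by
  simp [m.stk_set]

/-- The sum of the heights of the stacks in `W`. -/
def size [Fintype K] (W : K → Bool) (d : D) : ℕ := ∑ k with W k, (m.stk d k).length

section size

variable [Fintype K] {W : K → Bool}

theorem size_setVar (d : D) (v : σ) : m.size W (m.setVar d v) = m.size W d := by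
  simp [size, m.stk_setVar]

theorem size_read (k : K) (o : Option (Γ k)) (d : D) : m.size W (m.read k o d) = m.size W d :=
  m.size_setVar _ _

/-- Both sides are sums because subtraction of natural numbers is truncated. -/
theorem size_set_add {k : K} (hk : W k = true) (d : D) (l : List (Γ k)) :
    m.size W (m.set d k l) + (m.stk d k).length = m.size W d + l.length := by
  have hk : k ∈ Finset.univ.filter (fun k => W k = true) := by simpa using hk
  rw [size, size, ← Finset.add_sum_erase _ _ hk,
    ← Finset.add_sum_erase _ (fun k => (m.stk d k).length) hk, m.stk_set_self]
  have : ∑ j ∈ (Finset.univ.filter fun k => W k = true).erase k, (m.stk (m.set d k l) j).length =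
      ∑ j ∈ (Finset.univ.filter fun k => W k = true).erase k, (m.stk d j).length :=
    Finset.sum_congr rfl fun j hj => by rw [m.stk_set_ne _ (Finset.ne_of_mem_erase hj)]
  omega

theorem size_set_of_false {k : K} (hk : W k = false) (d : D) (l : List (Γ k)) :
    m.size W (m.set d k l) = m.size W d := by
  refine Finset.sum_congr rfl fun j hj => ?_
  rw [m.stk_set_ne]
  rintro rfl
  simp [hk] at hj

theorem length_le_size {k : K} (hk : W k = true) (d : D) : (m.stk d k).length ≤ m.size W d :=
  Finset.single_le_sum (f := fun k => (m.stk d k).length) (fun _ _ => Nat.zero_le _) (by simpa)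

theorem size_mono {V : K → Bool} (h : ∀ k, W k = true → V k = true) (d : D) :
    m.size W d ≤ m.size V d :=
  Finset.sum_le_sum_of_subset fun k hk => by simpa using h k (by simpa using hk)

end size

end Model

namespace LProg

/-- The program pops from or pushes on the stack `k`. -/
def touches (k : K) : LProg Γ σ → Bool
  | load _ => false
  | push k' _ | pop k' => k = k'
  | shift k' k'' _ => k = k' || k = k''
  | seq p q | ite _ p q => p.touches k || q.touches k
  | loop k' p => k = k' || p.touches k

/-- A bound for the growth of the stacks in `W` under a tame program. -/
def inc (W : K → Bool) : LProg Γ σ → ℕ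
  | load _ | pop _ | shift _ _ _ | loop _ _ => 0
  | push k _ => if W k then 1 else 0
  | seq p q => p.inc W + q.inc W
  | ite _ p q => max (p.inc W) (q.inc W)

/-- The stacks in `W` grow by at most a constant. -/
def tame (W : K → Bool) : LProg Γ σ → Bool
  | load _ | push _ _ | pop _ => true
  | shift k k' _ => W k && !decide (k = k')
  | seq p q | ite _ p q => p.tame W && q.tame W
  | loop k p => W k && !p.touches k && p.tame W && decide (p.inc W ≤ 1)

/-- The bodies of the loops are tame. -/
def wf (W : K → Bool) : LProg Γ σ → Bool
  | load _ | push _ _ | pop _ => true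
  | shift k k' _ => !decide (k = k')
  | seq p q | ite _ p q => p.wf W && q.wf W
  | loop k p => W k && !p.touches k && p.tame W

theorem wf_of_tame (W : K → Bool) : ∀ p : LProg Γ σ, p.tame W = true → p.wf W = true
  | load _, _ | push _ _, _ | pop _, _ => rfl
  | shift k k' _, h => by simp [tame, wf] at h ⊢; exact h.2
  | seq p q, h | ite _ p q, h => by
      simp only [tame, wf, Bool.and_eq_true] at h ⊢
      exact ⟨wf_of_tame W p h.1, wf_of_tame W q h.2⟩
  | loop k p, h => by simp [tame, wf] at h ⊢; exact h.1

/-- The effect of a program. -/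
def den (m : Model Γ σ D) : LProg Γ σ → D → D
  | load f, d => m.setVar d (f (m.var d))
  | push k f, d => m.set d k (f (m.var d) :: m.stk d k)
  | pop k, d => m.read k (m.stk d k).head? (m.set d k (m.stk d k).tail)
  | shift k k' f, d =>
    match m.stk d k with
    | [] => m.read k none d
    | a :: l => (fun d' => m.set d' k' (f (m.var d') :: m.stk d' k')) (m.read k (some a) (m.set d k l))
  | seq p q, d => q.den m (p.den m d)
  | ite c p q, d => if c (m.var d) then p.den m d else q.den m d
  | loop k p, d =>
    m.read k none (m.set ((m.stk d k).foldl (fun d a => p.den m (m.read k (some a) d)) d) k [])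

/-- The underlying program. -/
def prog (m : Model Γ σ D) : LProg Γ σ → Prog Γ σ
  | load f => .load f
  | push k f => .push k f
  | pop k => .pop k (m.rd k)
  | shift k k' f => .seq (.pop k (m.rd k)) (.choose fun v => if m.got v then .push k' f else .load id)
  | seq p q => .seq (p.prog m) (q.prog m)
  | ite c p q => .choose fun v => if c v then p.prog m else q.prog m
  | loop k p => .seq (.pop k (m.rd k)) (.loop m.got (.seq (p.prog m) (.pop k (m.rd k))))

variable (m : Model Γ σ D)

/-- A frame property: a stack that is not touched is neither read nor written, so replacing it
commutes with the program. In a loop this carries the unread rest of the driving stack past the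
body. -/
theorem den_set {k : K} (l : List (Γ k)) : ∀ (p : LProg Γ σ), p.touches k = false → ∀ d,
    p.den m (m.set d k l) = m.set (p.den m d) k l := by
  intro p
  induction p with
  | load f => intro _ d; simp [den, m.set_setVar, m.var_set]
  | push k' f =>
    intro h d
    have h : k ≠ k' := by simpa [touches] using h
    simp [den, m.var_set, m.stk_set_ne _ h.symm, m.set_comm h]
  | pop k' =>
    intro h d
    have h : k ≠ k' := by simpa [touches] using h
    simp only [den, m.stk_set_ne _ h.symm, m.set_comm h, m.read_set]
  | shift k' k'' f =>
    intro h d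
    obtain ⟨h, h'⟩ : k ≠ k' ∧ k ≠ k'' := by simpa [touches] using h
    simp only [den, m.stk_set_ne _ h.symm]
    split
    · rw [m.read_set]
    · simp only [m.set_comm h, m.read_set, m.stk_set_ne _ h'.symm, m.var_set, m.set_comm h']
  | seq p q ihp ihq =>
    intro h d
    simp only [touches, Bool.or_eq_false_iff] at h
    simp [den, ihp h.1, ihq h.2]
  | ite c p q ihp ihq =>
    intro h d
    simp only [touches, Bool.or_eq_false_iff] at h
    simp only [den, m.var_set, ihp h.1, ihq h.2]
    split <;> rfl
  | loop k' p ih =>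
    intro h d
    simp only [touches, Bool.or_eq_false_iff, decide_eq_false_iff_not] at h
    have : ∀ (s : List (Γ k')) d, s.foldl (fun d a => p.den m (m.read k' (some a) d)) (m.set d k l) =
        m.set (s.foldl (fun d a => p.den m (m.read k' (some a) d)) d) k l := by
      intro s
      induction s with
      | nil => intro d; rfl
      | cons a s ihs => intro d; rw [List.foldl_cons, m.read_set, ih h.2, ihs, List.foldl_cons]
    simp only [den, m.stk_set_ne _ (Ne.symm h.1), this, m.set_comm h.1, m.read_set]

theorem stk_den {k : K} (p : LProg Γ σ) (h : p.touches k = false) (d : D) :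
    m.stk (p.den m d) k = m.stk d k := by
  have := den_set m (m.stk d k) p h d
  rw [m.set_stk] at this
  rw [this, m.stk_set_self]

variable [Fintype K] (W : K → Bool)

theorem foldl_size_le {k : K} (p : LProg Γ σ) (c : ℕ)
    (hp : ∀ d, m.size W (p.den m d) ≤ m.size W d + c) (s : List (Γ k)) :
    ∀ d, m.size W (s.foldl (fun d a => p.den m (m.read k (some a) d)) d) ≤
      m.size W d + s.length * c := by
  induction s with
  | nil => intro d; simp
  | cons a s ih =>
    intro d
    have h := hp (m.read k (some a) d)
    rw [m.size_read] at h
    refine (ih _).trans ?_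
    rw [List.length_cons, Nat.succ_mul, Nat.add_comm (_ * _), ← Nat.add_assoc]
    exact Nat.add_le_add_right h _

omit [Fintype K] in
theorem foldl_stk {k : K} (p : LProg Γ σ) (hp : p.touches k = false) (s : List (Γ k)) :
    ∀ d, m.stk (s.foldl (fun d a => p.den m (m.read k (some a) d)) d) k = m.stk d k := by
  induction s with
  | nil => intro d; rfl
  | cons a s ih => intro d; rw [List.foldl_cons, ih, stk_den m p hp, m.stk_read]

/-- Each pass of a tame loop consumes one letter of the driving stack, which lies in `W`, and its
body adds at most one. Thus the loop as a whole causes no growth; this is why `tame` demands `p.inc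
W ≤ 1` and why `inc` is `0` on loops. -/
theorem size_den_le : ∀ p : LProg Γ σ, p.tame W = true → ∀ d,
    m.size W (p.den m d) ≤ m.size W d + p.inc W := by
  intro p
  induction p with
  | load f => intro _ d; simp [den, m.size_setVar]
  | push k f =>
    intro _ d
    rw [den, inc]
    split
    · next hk =>
      have := m.size_set_add hk d (f (m.var d) :: m.stk d k)
      rw [List.length_cons] at this
      omega
    · next hk => rw [m.size_set_of_false (by simpa using hk)]; omega
  | pop k =>
    intro _ d
    rw [den, m.size_read, inc]
    cases hk : W k
    · rw [m.size_set_of_false hk]; omega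
    · have := m.size_set_add hk d (m.stk d k).tail
      rw [List.length_tail] at this
      omega
  | shift k k' f =>
    intro h d
    simp only [tame, Bool.and_eq_true, Bool.not_eq_true', decide_eq_false_iff_not] at h
    rw [den, inc]
    split
    · rw [m.size_read]; omega
    · next a l hs =>
      have h₁ := m.size_set_add h.1 d l
      rw [hs, List.length_cons] at h₁
      have h₂ := m.size_read (W := W) k (some a) (m.set d k l)
      generalize m.read k (some a) (m.set d k l) = d' at h₂ ⊢
      beta_reduce
      cases hk' : W k'
      · rw [m.size_set_of_false hk']; omega
      · have h₃ := m.size_set_add hk' d' (f (m.var d') :: m.stk d' k')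
        rw [List.length_cons] at h₃
        omega
  | seq p q ihp ihq =>
    intro h d
    simp only [tame, Bool.and_eq_true] at h
    have h₁ := ihp h.1 d
    have h₂ := ihq h.2 (p.den m d)
    rw [den, inc]
    omega
  | ite c p q ihp ihq =>
    intro h d
    simp only [tame, Bool.and_eq_true] at h
    have h₁ := ihp h.1 d
    have h₂ := ihq h.2 d
    rw [den, inc]
    split <;> omega
  | loop k p ih =>
    intro h d
    simp only [tame, Bool.and_eq_true, Bool.not_eq_true', decide_eq_true_eq] at h
    obtain ⟨⟨⟨hk, ht⟩, hp⟩, hi⟩ := h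
    have h₁ := foldl_size_le m W p 1 (fun d => (ih hp d).trans (by omega)) (m.stk d k) d
    have h₂ := foldl_stk m p ht (m.stk d k) d
    rw [den, m.size_read, inc]
    have h₃ := m.size_set_add hk
      ((m.stk d k).foldl (fun d a => p.den m (m.read k (some a) d)) d) []
    rw [h₂, List.length_nil] at h₃
    omega

/-- The effect of the program is computed in time polynomial in the heights of the stacks in `W`. -/
def PolyRun (p : LProg Γ σ) : Prop :=
  ∃ q : Polynomial ℕ, ∀ d, ∃ t ≤ q.eval (m.size W d), Prog.Run (fun _ => True) (p.prog m)
    (m.var d) (m.stk d) t (m.var (p.den m d)) (m.stk (p.den m d))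

theorem eval_mono (q : Polynomial ℕ) {a b : ℕ} (h : a ≤ b) : q.eval a ≤ q.eval b := by
  rw [Polynomial.eval_eq_sum, Polynomial.eval_eq_sum]
  exact Finset.sum_le_sum fun i _ => Nat.mul_le_mul_left _ (Nat.pow_le_pow_left h i)

theorem PolyRun.mono {V : K → Bool} {p : LProg Γ σ} (h : PolyRun m W p)
    (hV : ∀ k, W k = true → V k = true) : PolyRun m V p := by
  obtain ⟨q, hq⟩ := h
  refine ⟨q, fun d => ?_⟩
  obtain ⟨t, ht, h⟩ := hq d
  exact ⟨t, ht.trans (eval_mono q (m.size_mono hV d)), h⟩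

/-- A run pushes at most one letter per step, so the second program starts at a size bounded by the
initial size plus the running time of the first. -/
theorem PolyRun.seq {p q : LProg Γ σ} (hp : PolyRun m W p) (hq : PolyRun m W q) :
    PolyRun m W (p.seq q) := by
  obtain ⟨r, hr⟩ := hp
  obtain ⟨s, hs⟩ := hq
  refine ⟨r + s.comp (.X + r), fun d => ?_⟩
  obtain ⟨t, ht, h⟩ := hr d
  obtain ⟨t', ht', h'⟩ := hs (p.den m d)
  refine ⟨t + t', ?_, .seq h h'⟩
  have := h.sum_length_le (Finset.univ.filter fun k => W k = true)
  simp only [Polynomial.eval_add, Polynomial.eval_comp, Polynomial.eval_X]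
  refine add_le_add ht (ht'.trans (eval_mono s ?_))
  exact this.trans (add_le_add_right ht _)

/-- Here `s` is the unread part of the driving stack, and the bound by `N` reserves `c` for each
pass that is still to come, so that every pass starts below `N`. A letter costs a test and a pop
besides the body, and the final `2` pays for the failing pop and test. The leading pop is kept apart
because the pop that ends one pass is the one that begins the next. -/
theorem run_loop {k : K} {p : LProg Γ σ} (ht : p.touches k = false) (hk : W k = true) (c : ℕ)
    (hc : ∀ d, m.size W (p.den m d) ≤ m.size W d + c) (N T : ℕ)
    (hT : ∀ d, m.size W d ≤ N → ∃ t ≤ T, Prog.Run (fun _ => True) (p.prog m)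
      (m.var d) (m.stk d) t (m.var (p.den m d)) (m.stk (p.den m d))) (s : List (Γ k)) :
    ∀ d, m.size W (m.set d k s) + s.length * c ≤ N → ∃ t ≤ s.length * (T + 2) + 2,
      ∃ v S t', Prog.Run (fun _ => True) (.pop k (m.rd k)) (m.var d) (m.stk (m.set d k s)) 1 v S ∧
        t = 1 + t' ∧ Prog.Run (fun _ => True) (.loop m.got (.seq (p.prog m) (.pop k (m.rd k)))) v S t'
          (m.var (m.read k none
            (m.set (s.foldl (fun d a => p.den m (m.read k (some a) d)) d) k [])))
          (m.stk (m.read k none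
            (m.set (s.foldl (fun d a => p.den m (m.read k (some a) d)) d) k []))) := by
  induction s with
  | nil =>
    intro d _
    refine ⟨2, by simp, _, _, 1, .pop _ _ _ _ trivial, rfl, ?_⟩
    have h := Prog.Run.done (I := fun _ => True) (c := m.got)
      (p := .seq (p.prog m) (.pop k (m.rd k))) (S := m.stk (m.set d k []))
      trivial (show m.got (m.rd k (m.var d) none) = false by simp [m.got_rd])
    simpa [m.stk_set_self, m.stk_read, Model.read, m.var_setVar, m.var_set, m.stk_set,
      m.stk_setVar] using h
  | cons a s ih =>
    intro d hN
    have hsz := m.size_set_add hk (m.set d k (a :: s)) s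
    rw [m.set_set, m.stk_set_self, List.length_cons] at hsz
    rw [List.length_cons, Nat.succ_mul] at hN
    obtain ⟨t₁, ht₁, h₁⟩ := hT (m.read k (some a) (m.set d k s)) (by rw [m.size_read]; omega)
    have hd : p.den m (m.read k (some a) (m.set d k s)) =
        m.set (p.den m (m.read k (some a) d)) k s := by rw [m.read_set, den_set m s p ht]
    have hs := hc (m.read k (some a) (m.set d k s))
    rw [hd, m.size_read] at hs
    rw [hd] at h₁
    obtain ⟨t₂, ht₂, v, S, t', hpop, rfl, hl⟩ := ih (p.den m (m.read k (some a) d)) (by omega)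
    rw [m.var_set] at h₁
    refine ⟨1 + (1 + ((t₁ + 1) + t')), ?_, m.var (m.read k (some a) (m.set d k s)),
      m.stk (m.read k (some a) (m.set d k s)), _, ?_, rfl, ?_⟩
    · rw [List.length_cons, Nat.succ_mul]; omega
    · have h := Prog.Run.pop (I := fun _ => True) k (m.rd k) (m.var d) (m.stk (m.set d k (a :: s)))
        trivial
      simpa [m.stk_set_self, m.stk_read, Model.read, m.var_setVar, m.var_set, m.stk_set,
        m.stk_setVar] using h
    · exact .next trivial (by simp [Model.read, m.var_setVar, m.got_rd]) (.seq h₁ hpop) hl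

theorem polyRun : ∀ p : LProg Γ σ, p.wf W = true → PolyRun m W p := by
  intro p
  induction p with
  | load f =>
    intro _
    refine ⟨1, fun d => ⟨1, by simp, ?_⟩⟩
    simpa only [prog, den, m.var_setVar, m.stk_setVar] using .load _ _ _ trivial
  | push k f =>
    intro _
    refine ⟨1, fun d => ⟨1, by simp, ?_⟩⟩
    simpa only [prog, den, m.var_set, m.stk_set] using .push _ _ _ _ trivial
  | pop k =>
    intro _
    refine ⟨1, fun d => ⟨1, by simp, ?_⟩⟩
    simpa only [prog, den, Model.read, m.var_set, m.stk_set, m.var_setVar, m.stk_setVar] using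
      .pop _ _ _ _ trivial
  | shift k k' f =>
    intro h
    have hk : k ≠ k' := by simpa [wf] using h
    refine ⟨3, fun d => ⟨1 + (1 + 1), by simp, .seq (.pop _ _ _ _ trivial) (.choose trivial ?_)⟩⟩
    simp only [m.got_rd]
    cases hs : m.stk d k with
    | nil =>
      have h := Prog.Run.load (I := fun _ => True) id (m.rd k (m.var d) none)
        (Function.update (m.stk d) k []) trivial
      have hu : Function.update (m.stk d) k [] = m.stk d := by rw [← hs, Function.update_eq_self]
      simpa [den, hs, Model.read, m.var_setVar, m.stk_setVar, hu] using h
    | cons a l =>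
      have h := Prog.Run.push (I := fun _ => True) k' f (m.rd k (m.var d) (some a))
        (Function.update (m.stk d) k l) trivial
      simpa [den, hs, Model.read, m.var_setVar, m.stk_setVar, m.var_set, m.stk_set, hk.symm] using h
  | seq p q ihp ihq =>
    intro h
    simp only [wf, Bool.and_eq_true] at h
    exact (ihp h.1).seq m W (ihq h.2)
  | ite c p q ihp ihq =>
    intro h
    simp only [wf, Bool.and_eq_true] at h
    obtain ⟨r, hr⟩ := ihp h.1
    obtain ⟨s, hs⟩ := ihq h.2
    refine ⟨1 + (r + s), fun d => ?_⟩
    simp only [Polynomial.eval_add, Polynomial.eval_one, den]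
    split
    · next hc =>
      obtain ⟨t, ht, h⟩ := hr d
      exact ⟨1 + t, by omega, .choose trivial (by simpa [hc] using h)⟩
    · next hc =>
      obtain ⟨t, ht, h⟩ := hs d
      exact ⟨1 + t, by omega, .choose trivial (by simpa [hc] using h)⟩
  | loop k p ih =>
    intro h
    simp only [wf, Bool.and_eq_true, Bool.not_eq_true'] at h
    obtain ⟨⟨hk, ht⟩, hp⟩ := h
    obtain ⟨r, hr⟩ := ih (wf_of_tame W p hp)
    -- There are at most as many passes as the size of `d`, and each adds at most `p.inc W`; hence
    -- the argument `X + X * p.inc W` for the time of a single pass.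
    refine ⟨.X * (r.comp (.X + .X * (p.inc W : Polynomial ℕ)) + 2) + 2, fun d => ?_⟩
    have hl := m.length_le_size hk d
    have hN : m.size W d + (m.stk d k).length * p.inc W ≤ m.size W d + m.size W d * p.inc W :=
      add_le_add_right (Nat.mul_le_mul_right _ hl) _
    obtain ⟨t, ht', v, S, t', hpop, rfl, hloop⟩ := run_loop m W ht hk (p.inc W) (size_den_le m W p hp)
      (m.size W d + m.size W d * p.inc W) (r.eval (m.size W d + m.size W d * p.inc W))
      (fun d' hd' => by
        obtain ⟨t, ht, h⟩ := hr d'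
        exact ⟨t, ht.trans (eval_mono r hd'), h⟩) (m.stk d k) d (by rwa [m.set_stk])
    rw [m.set_stk] at hpop
    refine ⟨1 + t', ht'.trans ?_, .seq hpop hloop⟩
    simp only [Polynomial.eval_add, Polynomial.eval_mul, Polynomial.eval_comp, Polynomial.eval_X,
      Polynomial.eval_natCast, Polynomial.eval_ofNat]
    rw [Nat.cast_id]
    gcongr

/-- Empty the stacks of a list and reset the internal state. -/
def clear (v : σ) : List K → LProg Γ σ
  | [] => load fun _ => v
  | k :: ks => seq (loop k (load id)) (clear v ks)

omit [Fintype K] in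
theorem wf_clear (v : σ) : ∀ ks : List K, (clear (Γ := Γ) v ks).wf (fun _ => true) = true
  | [] => rfl
  | k :: ks => by simp [clear, wf, touches, tame, wf_clear v ks]

omit [Fintype K] in
theorem var_clear (v : σ) : ∀ (ks : List K) (d : D), m.var ((clear v ks).den m d) = v
  | [], d => by simp [clear, den, m.var_setVar]
  | k :: ks, d => by simp [clear, den, var_clear v ks]

omit [Fintype K] in
theorem stk_clear (v : σ) : ∀ (ks : List K) (d : D) (k : K),
    m.stk ((clear v ks).den m d) k = if k ∈ ks then [] else m.stk d k
  | [], d, k => by simp [clear, den, m.stk_setVar]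
  | j :: ks, d, k => by
      have hf : ∀ (s : List (Γ j)) (d : D),
          m.stk (s.foldl (fun d a => m.setVar (m.read j (some a) d)
            (m.var (m.read j (some a) d))) d) = m.stk d := by
        intro s
        induction s with
        | nil => intro d; rfl
        | cons a s ih => intro d; rw [List.foldl_cons, ih, m.stk_setVar, m.stk_read]
      rw [clear, den, stk_clear v ks, den, m.stk_read]
      rcases eq_or_ne k j with rfl | hk
      · simp [m.stk_set_self]
      · simp only [den, id, m.stk_set_ne _ hk, hf, List.mem_cons, hk, false_or]

/-- A terminating program gives a machine that works in polynomial time. -/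
theorem PolyRun.computable {α β γ : Type} [Fintype σ] {k₀ k₁ : K} [Fintype (Γ k₀)] (e₀ : Γ k₀ ≃ α)
    (e₁ : Γ k₁ ≃ β) {p : LProg Γ σ} (hp : PolyRun m (fun _ => true) p) (d₀ : D)
    (hd₀ : m.stk d₀ = fun _ => []) (ob : γ → List β) (f : List α → γ)
    (hf : ∀ w, m.stk (p.den m (m.set d₀ k₀ (w.map e₀.symm))) k₁ = (ob (f w)).map e₁.symm) :
    Nonempty (Turing.TM2ComputableInPolyTime (id : List α → List α) ob f) := by
  -- A halting configuration must have empty stacks apart from the output and the initial internal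
  -- state, so the program is followed by a cleanup.
  have hc := hp.seq m _ (polyRun m (fun _ => true) (clear (m.var d₀) (Finset.univ.erase k₁).toList)
    (wf_clear _ _))
  set p' := p.seq (clear (m.var d₀) (Finset.univ.erase k₁).toList)
  obtain ⟨q, hq⟩ := hc
  have key : ∀ w : List α, ∃ t ≤ q.eval w.length,
      Steps ((p'.prog m).machine k₀ k₁ (m.var d₀)).step (fun _ => True) t
        (Turing.initList ((p'.prog m).machine k₀ k₁ (m.var d₀)) (w.map e₀.symm))
        (Turing.haltList ((p'.prog m).machine k₀ k₁ (m.var d₀)) ((ob (f w)).map e₁.symm)) := by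
    intro w
    obtain ⟨t, ht, h⟩ := hq (m.set d₀ k₀ (w.map e₀.symm))
    have hsz := m.size_set_add (W := fun _ => true) rfl d₀ (w.map e₀.symm)
    have hsz₀ : m.size (fun _ => true) d₀ = 0 := by simp [Model.size, hd₀]
    rw [hd₀, hsz₀, List.length_nil, List.length_map] at hsz
    have hsz' : m.size (fun _ => true) (m.set d₀ k₀ (w.map e₀.symm)) = w.length := by omega
    rw [hsz'] at ht
    refine ⟨t, ht, Prog.Run.machine_steps (I := fun _ => True) ?_⟩
    have hv : m.var (p'.den m (m.set d₀ k₀ (w.map e₀.symm))) = m.var d₀ := by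
      simp only [p', den, var_clear]
    have hs : m.stk (p'.den m (m.set d₀ k₀ (w.map e₀.symm))) =
        Function.update (fun _ => []) k₁ ((ob (f w)).map e₁.symm) := by
      funext k
      simp only [p', den, stk_clear, Finset.mem_toList, Finset.mem_erase, Finset.mem_univ, and_true]
      rcases eq_or_ne k k₁ with rfl | hk
      · simp [hf]
      · simp [hk]
    rw [hv, hs, m.var_set, m.stk_set, hd₀] at h
    exact h
  choose t ht h using key
  exact ⟨{
    tm := (p'.prog m).machine k₀ k₁ (m.var d₀)
    inputAlphabet := e₀
    outputAlphabet := e₁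
    time := q
    outputsFun := fun w => ⟨⟨t w, (h w).evals⟩, ht w⟩ }⟩

end LProg

end Terminating

end RG

namespace RG

/-! ### Polynomial space is closed under parallel queries to polynomial space -/

section Space

open Turing TM2

/-- The number of push instructions of a statement. -/
def pushes {K : Type} {Γ : K → Type} {Λ σ : Type} : Stmt Γ Λ σ → ℕ
  | .push _ _ q => pushes q + 1
  | .peek _ _ q | .pop _ _ q | .load _ q => pushes q
  | .branch _ q₁ q₂ => max (pushes q₁) (pushes q₂)
  | .goto _ | .halt => 0

theorem length_update_cons_le {K : Type} [DecidableEq K] {Γ : K → Type} (S : ∀ k, List (Γ k)) (k : K)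
    (a : Γ k) (j : K) : (Function.update S k (a :: S k) j).length ≤ (S j).length + 1 := by
  rcases eq_or_ne j k with rfl | h <;> simp [*]

theorem length_update_tail_le {K : Type} [DecidableEq K] {Γ : K → Type} (S : ∀ k, List (Γ k)) (k : K)
    (j : K) : (Function.update S k (S k).tail j).length ≤ (S j).length := by
  rcases eq_or_ne j k with rfl | h <;> simp [*]

theorem length_stepAux_le {K : Type} [DecidableEq K] {Γ : K → Type} {Λ σ : Type} (j : K) :
    ∀ (q : Stmt Γ Λ σ) (v : σ) (S : ∀ k, List (Γ k)),
      ((stepAux q v S).stk j).length ≤ (S j).length + pushes q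
  | .push k f q, v, S => by
      have h₁ := length_stepAux_le j q v (Function.update S k (f v :: S k))
      have h₂ := length_update_cons_le S k (f v) j
      rw [stepAux, pushes]
      omega
  | .peek k f q, v, S => length_stepAux_le j q _ S
  | .pop k f q, v, S => (length_stepAux_le j q _ _).trans
      (Nat.add_le_add_right (length_update_tail_le S k j) _)
  | .load f q, v, S => length_stepAux_le j q _ S
  | .branch f q₁ q₂, v, S => by
      have h₁ := length_stepAux_le j q₁ v S
      have h₂ := length_stepAux_le j q₂ v S
      rw [stepAux, pushes]
      cases f v <;> simp only [cond_true, cond_false] <;> omega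
  | .goto _, v, S => le_rfl
  | .halt, v, S => le_rfl

/-- A bound for the number of push instructions in a step of a machine. -/
def maxPushes (M : FinTM2) : ℕ :=
  letI := M.ΛFin
  Finset.univ.sup fun l => pushes (M.m l)

theorem pushes_le_maxPushes (M : FinTM2) (l : M.Λ) : pushes (M.m l) ≤ maxPushes M :=
  letI := M.ΛFin
  Finset.le_sup (f := fun l => pushes (M.m l)) (Finset.mem_univ l)

/-- The machine computes the output `o` on the input `u`, with stacks of height at most `b`. -/
def ComputesWithin (M : FinTM2) (b : ℕ) (u : List (M.Γ M.k₀)) (o : List (M.Γ M.k₁)) : Prop :=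
  ∃ n, Steps M.step (fun c => ∀ k, (Cfg.stk c k).length ≤ b) n (initList M u) (haltList M o)

theorem ComputesWithin.mono {M : FinTM2} {b b' : ℕ} {u : List (M.Γ M.k₀)} {o : List (M.Γ M.k₁)}
    (h : ComputesWithin M b u o) (hb : b ≤ b') : ComputesWithin M b' u o := by
  obtain ⟨n, h⟩ := h
  refine ⟨n, ?_⟩
  generalize initList M u = c at h
  generalize haltList M o = c' at h
  induction h with
  | refl => exact .refl _
  | head h hI _ ih => exact .head h (fun k => (hI k).trans hb) ih

/-- A step adds at most `maxPushes M` letters to a stack, whatever the configuration; therefore time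
bounds space. -/
theorem steps_length_le {M : FinTM2} {I : M.Cfg → Prop} {n : ℕ} {c c' : M.Cfg}
    (h : Steps M.step I n c c') : ∀ b, (∀ k, (Cfg.stk c k).length + n * maxPushes M ≤ b) →
    Steps M.step (fun c => ∀ k, (Cfg.stk c k).length ≤ b) n c c' := by
  induction h with
  | refl => intro b _; exact .refl _
  | @head n c d e h hI _ ih =>
    intro b hb
    have hd : ∀ k, (Cfg.stk d k).length ≤ (Cfg.stk c k).length + maxPushes M := by
      intro k
      obtain ⟨l, v, S⟩ := c
      cases l with
      | none => cases h
      | some l =>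
        obtain rfl := Option.some.inj h
        exact (length_stepAux_le k _ v S).trans (Nat.add_le_add_left (pushes_le_maxPushes M l) _)
    refine .head h (fun k => ?_) (ih b fun k => ?_)
    all_goals
      have h₁ := hb k
      have h₂ := hd k
      rw [Nat.succ_mul] at h₁
      omega

theorem stk_initList_length_le (M : FinTM2) (u : List (M.Γ M.k₀)) (k : M.K) :
    (Cfg.stk (initList M u) k).length ≤ u.length := by
  rw [Prog.initList_eq]
  rcases eq_or_ne k M.k₀ with rfl | h <;> simp [*]

theorem stk_haltList (M : FinTM2) (o : List (M.Γ M.k₁)) : Cfg.stk (haltList M o) M.k₁ = o := by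
  rw [Prog.haltList_eq]
  simp

theorem ComputesWithin.of_outputsInTime {M : FinTM2} {u : List (M.Γ M.k₀)} {o : List (M.Γ M.k₁)}
    {t : ℕ} (h : TM2OutputsInTime M u (some o) t) :
    ComputesWithin M (u.length + t * maxPushes M) u o := by
  refine ⟨_, steps_length_le (Steps.of_evals h.steps _ h.evals_in_steps) _ fun k => ?_⟩
  exact Nat.add_le_add (stk_initList_length_le M u k) (Nat.mul_le_mul_right _ h.steps_le_m)

/-- The run is not of length zero, since `initList` carries the label `main` and `haltList` carries
no label. So the bound applies to the halting configuration, whose stack `k₁` is the output. -/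
theorem ComputesWithin.length_le {M : FinTM2} {b : ℕ} {u : List (M.Γ M.k₀)} {o : List (M.Γ M.k₁)}
    (h : ComputesWithin M b u o) : o.length ≤ b := by
  obtain ⟨n, h⟩ := h
  have : ∀ n (c c' : M.Cfg), Steps M.step (fun c => ∀ k, (Cfg.stk c k).length ≤ b) n c c' →
      c = c' ∨ (Cfg.stk c' M.k₁).length ≤ b := by
    intro n c c' h
    induction h with
    | refl => exact .inl rfl
    | head h hI _ ih =>
      rcases ih with rfl | ih
      · exact .inr (hI _)
      · exact .inr ih
  rcases this _ _ _ h with h | h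
  · rw [Prog.initList_eq, Prog.haltList_eq] at h
    cases h
  · rwa [stk_haltList] at h

/-! ### A machine that contains three machines -/

/-- The stacks of the combined machine that do not belong to one of the three machines. -/
inductive OwnStack
  | inp | tmp | copy | query | ans | out
  deriving DecidableEq

theorem finite_ownStack : Finite OwnStack :=
  Finite.of_injective (β := Fin 6)
    (fun | .inp => 0 | .tmp => 1 | .copy => 2 | .query => 3 | .ans => 4 | .out => 5)
    (by intro a b; cases a <;> cases b <;> simp)

variable (α β : Type) (M : Fin 3 → FinTM2)

/-- The stacks of the combined machine. -/
abbrev AllStack := OwnStack ⊕ Σ j, (M j).K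

/-- The alphabets of the combined machine. -/
abbrev Alph : AllStack M → Type
  | .inl .inp | .inl .tmp | .inl .copy => α
  | .inl .query => β
  | .inl .ans | .inl .out => Bool
  | .inr x => (M x.1).Γ x.2

/-- The letters that the combined machine transports. -/
abbrev Transported := α ⊕ Option β ⊕ Bool

/-- The internal states of the combined machine. -/
@[ext] structure State where
  cur : Option (Transported α β)
  lab : ∀ j, Option (M j).Λ
  var : ∀ j, (M j).σ

theorem finite_state [Finite α] [Finite β] : Finite (State α β M) := by
  have := fun j => @Finite.of_fintype _ (M j).ΛFin
  have := fun j => @Finite.of_fintype _ (M j).σFin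
  exact Finite.of_injective
    (β := Option (Transported α β) × (∀ j, Option (M j).Λ) × (∀ j, (M j).σ))
    (fun s => (s.cur, s.lab, s.var)) fun s s' h => by
      simp only [Prod.mk.injEq] at h
      exact State.ext h.1 h.2.1 h.2.2

/-- The contents of the own stacks. -/
structure OwnStore where
  inp : List α := []
  tmp : List α := []
  copy : List α := []
  query : List β := []
  ans : List Bool := []
  out : List Bool := []

variable {α β M}

/-- The contents of all stacks. -/
def glue (s : OwnStore α β) (T : ∀ j k, List ((M j).Γ k)) : ∀ k, List (Alph α β M k)
  | .inl .inp => s.inp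
  | .inl .tmp => s.tmp
  | .inl .copy => s.copy
  | .inl .query => s.query
  | .inl .ans => s.ans
  | .inl .out => s.out
  | .inr x => T x.1 x.2

section glue

variable (s : OwnStore α β) (T : ∀ j k, List ((M j).Γ k))

theorem update_inp (l : List α) :
    Function.update (glue s T) (.inl .inp) l = glue { s with inp := l } T := by
  funext k; rcases k with (_ | _ | _ | _ | _ | _) | k <;> rfl

theorem update_tmp (l : List α) :
    Function.update (glue s T) (.inl .tmp) l = glue { s with tmp := l } T := by
  funext k; rcases k with (_ | _ | _ | _ | _ | _) | k <;> rfl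

theorem update_copy (l : List α) :
    Function.update (glue s T) (.inl .copy) l = glue { s with copy := l } T := by
  funext k; rcases k with (_ | _ | _ | _ | _ | _) | k <;> rfl

theorem update_query (l : List β) :
    Function.update (glue s T) (.inl .query) l = glue { s with query := l } T := by
  funext k; rcases k with (_ | _ | _ | _ | _ | _) | k <;> rfl

theorem update_ans (l : List Bool) :
    Function.update (glue s T) (.inl .ans) l = glue { s with ans := l } T := by
  funext k; rcases k with (_ | _ | _ | _ | _ | _) | k <;> rfl

theorem update_out (l : List Bool) :
    Function.update (glue s T) (.inl .out) l = glue { s with out := l } T := by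
  funext k; rcases k with (_ | _ | _ | _ | _ | _) | k <;> rfl

theorem update_machine (j : Fin 3) (k : (M j).K) (l : List ((M j).Γ k)) :
    Function.update (glue s T) (.inr ⟨j, k⟩) l =
      glue s (Function.update T j (Function.update (T j) k l)) := by
  funext x
  rcases x with x | ⟨i, x⟩
  · cases x <;> rfl
  · rcases eq_or_ne i j with rfl | hi
    · rcases eq_or_ne x k with rfl | hx
      · simp [glue]
      · have : (Sum.inr ⟨i, x⟩ : AllStack M) ≠ Sum.inr ⟨i, k⟩ := by simpa using hx
        rw [Function.update_of_ne this]
        simp [glue, hx]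
    · have : (Sum.inr ⟨i, x⟩ : AllStack M) ≠ Sum.inr ⟨j, k⟩ := by
        intro h
        exact hi (congrArg Sigma.fst (Sum.inr.inj h))
      rw [Function.update_of_ne this]
      simp [glue, hi]

end glue

/-- The statement of the machine `j`, as a program of the combined machine. -/
def stmtProg (j : Fin 3) : Stmt (M j).Γ (M j).Λ (M j).σ → Prog (Alph α β M) (State α β M)
  | .push k f q => .seq (.push (.inr ⟨j, k⟩) fun v => f (v.var j)) (stmtProg j q)
  | .peek k f q =>
    .seq (.peek (.inr ⟨j, k⟩) fun v a => { v with var := Function.update v.var j (f (v.var j) a) })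
      (stmtProg j q)
  | .pop k f q =>
    .seq (.pop (.inr ⟨j, k⟩) fun v a => { v with var := Function.update v.var j (f (v.var j) a) })
      (stmtProg j q)
  | .load f q =>
    .seq (.load fun v => { v with var := Function.update v.var j (f (v.var j)) }) (stmtProg j q)
  | .branch f q₁ q₂ => .choose fun v => if f (v.var j) then stmtProg j q₁ else stmtProg j q₂
  | .goto f => .load fun v => { v with lab := Function.update v.lab j (some (f (v.var j))) }
  | .halt => .load fun v => { v with lab := Function.update v.lab j none }

/-- All stacks have height at most `B`. -/
abbrev Below {K : Type} {Γ : K → Type} (B : ℕ) (S : ∀ k, List (Γ k)) : Prop :=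
  ∀ k, (S k).length ≤ B

/-- The hypothesis leaves room for the letters that `q` may still push; every push instruction uses
up one unit of that room. -/
theorem run_stmtProg (B : ℕ) (j : Fin 3) (s : OwnStore α β) :
    ∀ (q : Stmt (M j).Γ (M j).Λ (M j).σ) (v : State α β M) (T : ∀ j k, List ((M j).Γ k)),
      (∀ k, (glue s T k).length + pushes q ≤ B) →
      ∃ t, Prog.Run (Below B) (stmtProg j q) v (glue s T) t
        ⟨v.cur, Function.update v.lab j (stepAux q (v.var j) (T j)).l,
          Function.update v.var j (stepAux q (v.var j) (T j)).var⟩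
        (glue s (Function.update T j (stepAux q (v.var j) (T j)).stk))
  | .push k f q, v, T, hB => by
      have hB' : ∀ k', (Function.update (glue s T) (.inr ⟨j, k⟩)
          (f (v.var j) :: glue s T (.inr ⟨j, k⟩)) k').length + pushes q ≤ B := fun k' => by
        have h₁ := hB k'
        have h₂ := length_update_cons_le (glue s T) (.inr ⟨j, k⟩) (f (v.var j)) k'
        rw [pushes] at h₁
        omega
      have h := Prog.Run.push (I := Below B) (.inr ⟨j, k⟩) (fun v => f (v.var j)) v (glue s T)
        fun k' => (Nat.le_add_right _ _).trans (hB' k')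
      rw [update_machine] at h hB'
      obtain ⟨t, h'⟩ := run_stmtProg B j s q v _ hB'
      rw [Function.update_self, Function.update_idem] at h'
      exact ⟨_, .seq h h'⟩
  | .peek k f q, v, T, hB => by
      obtain ⟨t, h'⟩ := run_stmtProg B j s q
        { v with var := Function.update v.var j (f (v.var j) (T j k).head?) } T hB
      simp only [Function.update_self, Function.update_idem] at h'
      exact ⟨_, .seq (.peek _ _ _ _ fun k' => (Nat.le_add_right _ _).trans (hB k')) h'⟩
  | .pop k f q, v, T, hB => by
      have hB' : ∀ k', (Function.update (glue s T) (.inr ⟨j, k⟩)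
          (glue s T (.inr ⟨j, k⟩)).tail k').length + pushes q ≤ B := fun k' => by
        have h₁ := hB k'
        have h₂ := length_update_tail_le (glue s T) (.inr ⟨j, k⟩) k'
        rw [pushes] at h₁
        omega
      have h := Prog.Run.pop (I := Below B) (.inr ⟨j, k⟩)
        (fun v a => { v with var := Function.update v.var j (f (v.var j) a) }) v (glue s T)
        fun k' => (Nat.le_add_right _ _).trans (hB' k')
      rw [update_machine] at h hB'
      obtain ⟨t, h'⟩ := run_stmtProg B j s q
        { v with var := Function.update v.var j (f (v.var j) (T j k).head?) } _ hB'
      simp only [Function.update_self, Function.update_idem] at h'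
      exact ⟨_, .seq h h'⟩
  | .load f q, v, T, hB => by
      obtain ⟨t, h'⟩ := run_stmtProg B j s q
        { v with var := Function.update v.var j (f (v.var j)) } T hB
      simp only [Function.update_self, Function.update_idem] at h'
      exact ⟨_, .seq (.load _ _ _ fun k' => (Nat.le_add_right _ _).trans (hB k')) h'⟩
  | .branch f q₁ q₂, v, T, hB => by
      have hI : Below B (glue s T) := fun k' => (Nat.le_add_right _ _).trans (hB k')
      rw [stepAux]
      cases hf : f (v.var j)
      · obtain ⟨t, h'⟩ := run_stmtProg B j s q₂ v T
          fun k => (Nat.add_le_add_left (le_max_right _ _) _).trans (hB k)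
        exact ⟨_, .choose hI (by simpa [hf] using h')⟩
      · obtain ⟨t, h'⟩ := run_stmtProg B j s q₁ v T
          fun k => (Nat.add_le_add_left (le_max_left _ _) _).trans (hB k)
        exact ⟨_, .choose hI (by simpa [hf] using h')⟩
  | .goto f, v, T, hB => by
      have h := Prog.Run.load (I := Below B)
        (fun v => { v with lab := Function.update v.lab j (some (f (v.var j))) }) v (glue s T) hB
      refine ⟨1, ?_⟩
      simpa [stmtProg] using h
  | .halt, v, T, hB => by
      have h := Prog.Run.load (I := Below B)
        (fun v => { v with lab := Function.update v.lab j none }) v (glue s T) hB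
      refine ⟨1, ?_⟩
      simpa [stmtProg] using h

/-- Run the machine `j` until it halts. -/
def runMachine (j : Fin 3) : Prog (Alph α β M) (State α β M) :=
  .loop (fun v => (v.lab j).isSome) (.choose fun v =>
    match v.lab j with
    | none => .load id
    | some l => stmtProg j ((M j).m l))

/-- `b` bounds the stacks between two steps of the machine `j`. One such step takes several steps of
the program, and in between a stack may exceed `b` by up to `maxPushes (M j)`; this is what the
larger bound `B` is for. -/
theorem run_runMachine {B b : ℕ} {j : Fin 3} (hb : b + maxPushes (M j) ≤ B) (s : OwnStore α β)
    (n : ℕ) (c c' : (M j).Cfg)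
    (h : Steps (M j).step (fun c => ∀ k, (Cfg.stk c k).length ≤ b) n c c') :
    ∀ (v : State α β M) (T : ∀ j k, List ((M j).Γ k)), (∀ k, (glue s T k).length ≤ b) →
      c = ⟨v.lab j, v.var j, T j⟩ → Cfg.l c' = none →
      ∃ t, Prog.Run (Below B) (runMachine j) v (glue s T) t
        ⟨v.cur, Function.update v.lab j none, Function.update v.var j (Cfg.var c')⟩
        (glue s (Function.update T j (Cfg.stk c'))) := by
  induction h with
  | refl c =>
    rintro v T hT rfl hc
    have hc : v.lab j = none := hc
    refine ⟨1, ?_⟩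
    have h := Prog.Run.done (I := Below B) (c := fun v : State α β M => (v.lab j).isSome)
      (p := .choose fun v =>
        match v.lab j with
        | none => .load id
        | some l => stmtProg j ((M j).m l))
      (v := v) (S := glue s T) (fun k => (hT k).trans (by omega)) (by simp [hc])
    have e₁ : Function.update v.lab j none = v.lab := by rw [← hc, Function.update_eq_self]
    have e₂ : Function.update v.var j (v.var j) = v.var := Function.update_eq_self _ _
    have e₃ : Function.update T j (T j) = T := Function.update_eq_self _ _
    rw [e₁]
    change Prog.Run _ _ _ _ _ (⟨v.cur, v.lab, Function.update v.var j (v.var j)⟩ : State α β M)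
      (glue s (Function.update T j (T j)))
    rw [e₂, e₃]
    exact h
  | @head n c d c' h hd hs ih =>
    rintro v T hT rfl hc
    have hI : Below B (glue s T) := fun k => (hT k).trans (by omega)
    cases hl : v.lab j with
    | none =>
      rw [hl] at h
      cases h
    | some l =>
      rw [hl] at h
      obtain rfl := Option.some.inj h
      obtain ⟨t, h₁⟩ := run_stmtProg B j s ((M j).m l) v T fun k =>
        (Nat.add_le_add (hT k) (pushes_le_maxPushes (M j) l)).trans hb
      obtain ⟨t', h₂⟩ := ih ⟨v.cur, Function.update v.lab j (stepAux ((M j).m l) (v.var j) (T j)).l,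
          Function.update v.var j (stepAux ((M j).m l) (v.var j) (T j)).var⟩
        (Function.update T j (stepAux ((M j).m l) (v.var j) (T j)).stk) (by
          intro k
          rcases k with k | ⟨i, k⟩
          · rcases k with _ | _ | _ | _ | _ | _
            exacts [hT (.inl .inp), hT (.inl .tmp), hT (.inl .copy), hT (.inl .query),
              hT (.inl .ans), hT (.inl .out)]
          · rcases eq_or_ne i j with rfl | hi
            · simpa [glue] using hd k
            · simpa [glue, hi] using hT (.inr ⟨i, k⟩)) (by simp; rfl) hc
      simp only [Function.update_idem] at h₂
      exact ⟨_, .next hI (by simp [hl]) (.choose hI (by simpa only [hl] using h₁)) h₂⟩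

/-- The states in which no machine is running. -/
def idle (c : Option (Transported α β)) : State α β M := ⟨c, fun _ => none, fun j => (M j).initialState⟩

/-- Start the machine `j` and run it until it halts. -/
def call (j : Fin 3) : Prog (Alph α β M) (State α β M) :=
  .seq (.load fun v => { v with lab := Function.update v.lab j (some (M j).main) }) (runMachine j)

/-- Only one stack is possibly not empty. -/
def only (j : Fin 3) (k : (M j).K) (l : List ((M j).Γ k)) : ∀ k, List ((M j).Γ k) :=
  Function.update (fun _ => []) k l

/-- Contents of the stacks of the three machines, all empty. -/
def noStacks : ∀ j k, List ((M j).Γ k) := fun _ _ => []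

theorem only_nil (j : Fin 3) (k : (M j).K) : only j k [] = fun _ => [] := Function.update_eq_self _ _

theorem update_only (j : Fin 3) (k : (M j).K) (l l' : List ((M j).Γ k)) :
    Function.update (only j k l) k l' = only j k l' := Function.update_idem _ _ _

theorem only_self (j : Fin 3) (k : (M j).K) (l : List ((M j).Γ k)) : only j k l k = l :=
  Function.update_self _ _ _

theorem length_only_le (j : Fin 3) (k k' : (M j).K) (l : List ((M j).Γ k)) :
    (only j k l k').length ≤ l.length := by
  rcases eq_or_ne k' k with rfl | h <;> simp [only, *]

/-- On halting, the machine has restored its initial state and emptied all its stacks apart from the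
output. Once the output is taken away, it can be called again, so a single copy of the oracle
machine serves all queries. -/
theorem run_call {B b : ℕ} {j : Fin 3} (hb : b + maxPushes (M j) ≤ B) (s : OwnStore α β)
    (c : Option (Transported α β)) {u : List ((M j).Γ (M j).k₀)} {o : List ((M j).Γ (M j).k₁)}
    (h : ComputesWithin (M j) b u o)
    (T : ∀ j k, List ((M j).Γ k))
    (hs : Below b (glue s (Function.update T j (only j _ u)))) :
    ∃ t, Prog.Run (Below B) (call j) (idle c) (glue s (Function.update T j (only j _ u))) t
      (idle c) (glue s (Function.update T j (only j _ o))) := by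
  obtain ⟨n, h⟩ := h
  obtain ⟨t, h'⟩ := run_runMachine hb s n _ _ h
    ⟨c, Function.update (fun _ => none) j (some (M j).main), fun j => (M j).initialState⟩
    (Function.update T j (only j _ u)) hs
    (by rw [Prog.initList_eq]; simp [only]; rfl) (by rw [Prog.haltList_eq])
  rw [Prog.haltList_eq] at h'
  simp only [Function.update_idem, Function.update_eq_self] at h'
  refine ⟨1 + t, .seq (.load _ _ _ fun k => (hs k).trans (by omega)) ?_⟩
  exact h'

/-- Empty the stack `k`, with an action for each letter. -/
def forEach (k : AllStack M) (enc : Alph α β M k → Transported α β)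
    (body : Transported α β → Prog (Alph α β M) (State α β M)) : Prog (Alph α β M) (State α β M) :=
  .seq (.pop k fun v o => { v with cur := o.map enc }) (.loop (fun v => v.cur.isSome)
    (.seq (.choose fun v =>
      match v.cur with
      | none => .load id
      | some x => body x) (.pop k fun v o => { v with cur := o.map enc })))

/-- `R l S` is the loop invariant, indexed by the letters `l` that are still on the stack `k`. The
body may leave any value in `cur`, because the next pop overwrites it. -/
theorem run_forEach {B : ℕ} (k : AllStack M) (enc : Alph α β M k → Transported α β)
    (body : Transported α β → Prog (Alph α β M) (State α β M))
    (R : List (Alph α β M k) → (∀ k, List (Alph α β M k)) → Prop)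
    (hnil : ∀ S, R [] S → S k = [] ∧ Below B S)
    (hcons : ∀ a l S, R (a :: l) S → S k = a :: l ∧ Below B (Function.update S k l) ∧
      ∃ t c S', Prog.Run (Below B) (body (enc a)) (idle (some (enc a))) (Function.update S k l) t
        (idle c) S' ∧ R l S') (l : List (Alph α β M k)) :
    ∀ c S, R l S → ∃ t S', Prog.Run (Below B) (forEach k enc body) (idle c) S t (idle none) S' ∧
      R [] S' := by
  induction l with
  | nil =>
    intro c S hR
    obtain ⟨hk, hB⟩ := hnil S hR
    have hu : Function.update S k (S k).tail = S := by
      rw [hk, List.tail_nil, ← hk, Function.update_eq_self]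
    refine ⟨1 + 1, S, .seq (.pop _ _ _ _ (by rwa [hu])) ?_, hR⟩
    rw [hu, hk]
    exact .done hB rfl
  | cons a l ih =>
    intro c S hR
    obtain ⟨hk, hB, t, c', S', hrun, hR'⟩ := hcons a l S hR
    obtain ⟨t', S'', hrun', hR''⟩ := ih c' S' hR'
    cases hrun' with
    | seq hp hl =>
      have hpop := Prog.Run.pop (I := Below B) k
        (fun (v : State α β M) o => { v with cur := o.map enc }) (idle c) S
      rw [hk] at hpop
      have hl' := Prog.Run.next (I := Below B) (c := fun v : State α β M => v.cur.isSome)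
        (v := idle (some (enc a))) hB rfl (.seq (.choose hB hrun) hp) hl
      exact ⟨_, S'', .seq (hpop hB) hl', hR''⟩

/-- Move the letters of the stack `k` to the stack `k'`. -/
def pour (k k' : AllStack M) (enc : Alph α β M k → Transported α β)
    (dec : Transported α β → Option (Alph α β M k')) : Prog (Alph α β M) (State α β M) :=
  forEach k enc fun x =>
    match dec x with
    | none => .load id
    | some y => .push k' fun _ => y

/-- Letters are only moved, so the joint height of the two stacks never exceeds its initial value,
which `hB'` bounds. -/
theorem run_pour {B : ℕ} {k k' : AllStack M} (hk : k ≠ k') (enc : Alph α β M k → Transported α β)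
    (dec : Transported α β → Option (Alph α β M k')) (f : Alph α β M k → Alph α β M k')
    (hf : ∀ a, dec (enc a) = some (f a)) (c : Option (Transported α β))
    (S : ∀ k, List (Alph α β M k)) (hB : Below B S) (hB' : (S k).length + (S k').length ≤ B) :
    ∃ t, Prog.Run (Below B) (pour k k' enc dec) (idle c) S t (idle none)
      (Function.update (Function.update S k []) k' ((S k).reverse.map f ++ S k')) := by
  have aux : ∀ l r : List (Alph α β M k), S k = r ++ l → ∀ x : List (Alph α β M k'),
      x.length ≤ r.length + (S k').length →
      Below B (Function.update (Function.update S k l) k' x) := by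
    intro l r hr x hx j
    have hl := congrArg List.length hr
    rw [List.length_append] at hl
    rcases eq_or_ne j k' with rfl | hj
    · simp only [Function.update_self]; omega
    · rw [Function.update_of_ne hj]
      rcases eq_or_ne j k with rfl | hj'
      · simp only [Function.update_self]; have := hB j; omega
      · rw [Function.update_of_ne hj']; exact hB j
  obtain ⟨t, S', h, r, hr, rfl⟩ := run_forEach (B := B) k enc
    (fun x =>
      match dec x with
      | none => .load id
      | some y => .push k' fun _ => y)
    (fun l S' => ∃ r, S k = r ++ l ∧
      S' = Function.update (Function.update S k l) k' (r.reverse.map f ++ S k'))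
    (by
      rintro _ ⟨r, hr, rfl⟩
      refine ⟨by rw [Function.update_of_ne hk, Function.update_self], aux _ r hr _ (by simp)⟩)
    (by
      rintro a l _ ⟨r, hr, rfl⟩
      have e : Function.update (Function.update (Function.update S k (a :: l)) k'
          (r.reverse.map f ++ S k')) k l =
          Function.update (Function.update S k l) k' (r.reverse.map f ++ S k') := by
        rw [Function.update_comm hk, Function.update_idem, Function.update_comm hk.symm]
      refine ⟨by rw [Function.update_of_ne hk, Function.update_self], ?_, 1, some (enc a),
        _, ?_, r ++ [a], by simpa using hr, rfl⟩
      · rw [e]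
        exact aux l (r ++ [a]) (by simpa using hr) _ (by simp)
      · rw [e]
        have h := Prog.Run.push (I := Below B) k' (fun _ => f a) (idle (M := M) (some (enc a)))
          (Function.update (Function.update S k l) k' (r.reverse.map f ++ S k'))
        rw [Function.update_self, Function.update_idem] at h
        simp only [hf, List.reverse_append, List.reverse_singleton, List.map_cons,
          List.cons_append, List.nil_append]
        exact h (aux l (r ++ [a]) (by simpa using hr) _ (by simp)))
    (S k) c S ⟨[], rfl, by simp⟩
  rw [List.append_nil] at hr
  exact ⟨t, by rw [hr]; exact h⟩

theorem below_glue {B : ℕ} {s : OwnStore α β} {T : ∀ j k, List ((M j).Γ k)}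
    (hinp : s.inp.length ≤ B) (htmp : s.tmp.length ≤ B) (hcopy : s.copy.length ≤ B)
    (hquery : s.query.length ≤ B) (hans : s.ans.length ≤ B) (hout : s.out.length ≤ B)
    (hT : ∀ j k, (T j k).length ≤ B) : Below B (glue s T) := by
  rintro ((_ | _ | _ | _ | _ | _) | ⟨j, k⟩)
  exacts [hinp, htmp, hcopy, hquery, hans, hout, hT j k]

theorem length_update_le {B : ℕ} {T : ∀ j k, List ((M j).Γ k)} (hT : ∀ j k, (T j k).length ≤ B)
    (i : Fin 3) {U : ∀ k, List ((M i).Γ k)} (hU : ∀ k, (U k).length ≤ B) (j : Fin 3) (k : (M j).K) :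
    (Function.update T i U j k).length ≤ B := by
  rcases eq_or_ne j i with rfl | h
  · simpa using hU k
  · simpa [h] using hT j k

theorem joinWords_cons {β : Type} (q : List β) (qs : List (List β)) :
    joinWords (q :: qs) = q.map some ++ none :: joinWords qs := by
  simp [joinWords]

/-- The separator `none` does not occur inside the words, so the first separator determines the
first word. -/
theorem eq_of_joinWords {β : Type} {x : List (Option β)} : ∀ {p : List β} {ms : List (List β)},
    p.map some ++ none :: x = joinWords ms → ∃ ms', ms = p :: ms' ∧ x = joinWords ms'
  | p, [], h => by simp [joinWords] at h
  | p, m :: ms, h => by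
      rw [joinWords_cons] at h
      induction p generalizing m with
      | nil =>
        cases m with
        | nil => exact ⟨ms, rfl, by simpa using h⟩
        | cons b m => simp at h
      | cons a p ih =>
        cases m with
        | nil => simp at h
        | cons b m =>
          simp only [List.map_cons, List.cons_append, List.cons.injEq, Option.some.injEq] at h
          obtain ⟨ms', h₁, h₂⟩ := ih m h.2
          simp only [List.cons.injEq] at h₁
          exact ⟨ms', by rw [h.1, h₁.1, h₁.2], h₂⟩

theorem eq_nil_of_joinWords {β : Type} {p : List β} {ms : List (List β)}
    (h : p.map some = joinWords ms) : p = [] ∧ ms = [] := by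
  cases ms with
  | nil => simpa [joinWords] using h
  | cons m ms =>
    have : none ∈ p.map some := by rw [h, joinWords_cons]; simp
    simp at this

/-! ### The program that asks the queries one by one -/

section parallel

variable (e₀ : (M 0).Γ (M 0).k₀ ≃ α) (o₀ : (M 0).Γ (M 0).k₁ ≃ Option β)
  (e₁ : (M 1).Γ (M 1).k₀ ≃ β) (o₁ : (M 1).Γ (M 1).k₁ ≃ Bool)
  (e₂ : (M 2).Γ (M 2).k₀ ≃ α ⊕ Bool) (o₂ : (M 2).Γ (M 2).k₁ ≃ Bool)

/-- Move the input to two stacks. -/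
def copyInput : Prog (Alph α β M) (State α β M) :=
  forEach (.inl .inp) Sum.inl fun
    | .inl a => .seq (.push (.inl .tmp) fun _ => a) (.push (.inl .copy) fun _ => a)
    | .inr _ => .load id

/-- Hand the input over to the first machine. -/
def feedInput : Prog (Alph α β M) (State α β M) :=
  pour (.inl .tmp) (.inr ⟨0, (M 0).k₀⟩) Sum.inl fun
    | .inl a => some (e₀.symm a)
    | .inr _ => none

/-- Hand a query over to the second machine. -/
def feedQuery : Prog (Alph α β M) (State α β M) :=
  pour (.inl .query) (.inr ⟨1, (M 1).k₀⟩) (fun b => .inr (.inl (some b))) fun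
    | .inr (.inl (some b)) => some (e₁.symm b)
    | _ => none

/-- Store the answer of the second machine. -/
def takeAnswer : Prog (Alph α β M) (State α β M) :=
  pour (.inr ⟨1, (M 1).k₁⟩) (.inl .ans) (fun x => .inr (.inr (o₁ x))) fun
    | .inr (.inr b) => some b
    | _ => none

/-- Let the second machine answer all queries. -/
def answerAll : Prog (Alph α β M) (State α β M) :=
  forEach (.inr ⟨0, (M 0).k₁⟩) (fun x => .inr (.inl (o₀ x))) fun
    | .inr (.inl (some b)) => .push (.inl .query) fun _ => b
    | .inr (.inl none) => .seq (feedQuery e₁) (.seq (call 1) (takeAnswer o₁))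
    | _ => .load id

/-- Hand the answers over to the third machine. -/
def feedAnswers : Prog (Alph α β M) (State α β M) :=
  pour (.inl .ans) (.inr ⟨2, (M 2).k₀⟩) (fun b => .inr (.inr b)) fun
    | .inr (.inr b) => some (e₂.symm (.inr b))
    | _ => none

/-- Hand the input over to the third machine. -/
def feedCopy : Prog (Alph α β M) (State α β M) :=
  pour (.inl .copy) (.inr ⟨2, (M 2).k₀⟩) Sum.inl fun
    | .inl a => some (e₂.symm (.inl a))
    | .inr _ => none

/-- Output the verdict of the third machine. -/
def takeVerdict : Prog (Alph α β M) (State α β M) :=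
  pour (.inr ⟨2, (M 2).k₁⟩) (.inl .out) (fun x => .inr (.inr (o₂ x))) fun
    | .inr (.inr b) => some b
    | _ => none

/-- Compute the queries, answer them one by one, and evaluate the answers. -/
def parallelProg : Prog (Alph α β M) (State α β M) :=
  .seq copyInput (.seq (feedInput e₀) (.seq (call 0) (.seq (answerAll o₀ e₁ o₁)
    (.seq (feedAnswers e₂) (.seq (feedCopy e₂) (.seq (call 2) (takeVerdict o₂)))))))

variable {b B : ℕ}

theorem run_copyInput (w : List α) (hw : w.length ≤ B) :
    ∃ t, Prog.Run (Below B) copyInput (idle none) (glue { inp := w } (noStacks (M := M))) t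
      (idle (β := β) none) (glue { tmp := w.reverse, copy := w.reverse } noStacks) := by
  -- `r'` may be shorter than `r`, because the two copies are pushed one after the other.
  have hR : ∀ l r : List α, w = r ++ l → ∀ r' : List α, r'.length ≤ r.length →
      Below B (glue (β := β) ⟨l, r.reverse, r'.reverse, [], [], []⟩ (noStacks (M := M))) := by
    intro l r h r' hr'
    have := congrArg List.length h
    rw [List.length_append] at this
    exact below_glue (by simp only; omega) (by simp; omega) (by simp; omega) (by simp) (by simp)
      (by simp) (by simp [noStacks])
  obtain ⟨t, S', h, r, hr, rfl⟩ := run_forEach (B := B) (.inl .inp) Sum.inl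
    (fun
    | .inl a => .seq (.push (.inl .tmp) fun _ => a) (.push (.inl .copy) fun _ => a)
    | .inr _ => .load id)
    (fun l S => ∃ r, w = r ++ l ∧
      S = glue (β := β) { inp := l, tmp := r.reverse, copy := r.reverse } (noStacks (M := M)))
    (by
      rintro _ ⟨r, hr, rfl⟩
      exact ⟨rfl, hR _ _ hr _ le_rfl⟩)
    (by
      rintro (a : α) (l : List α) _ ⟨r, hr, rfl⟩
      have hr' : w = (r ++ [a]) ++ l := by simpa using hr
      refine ⟨rfl, ?_, 1 + 1, some (.inl a),
        glue { inp := l, tmp := (r ++ [a]).reverse, copy := (r ++ [a]).reverse } noStacks, ?_,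
        r ++ [a], hr', rfl⟩
      · rw [update_inp]
        intro k
        refine le_trans ?_ (hR _ _ hr r le_rfl k)
        rcases k with (_ | _ | _ | _ | _ | _) | k <;> simp [glue]
      · rw [update_inp]
        have h₁ := Prog.Run.push (Γ := Alph α β M) (I := Below B) (.inl .tmp) (fun _ => a)
          (idle (α := α) (β := β) (M := M) (some (.inl a)))
          (glue { inp := l, tmp := r.reverse, copy := r.reverse } noStacks)
        have h₂ := Prog.Run.push (Γ := Alph α β M) (I := Below B) (.inl .copy) (fun _ => a)
          (idle (α := α) (β := β) (M := M) (some (.inl a)))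
          (glue { inp := l, tmp := a :: r.reverse, copy := r.reverse } noStacks)
        rw [update_tmp] at h₁
        rw [update_copy] at h₂
        have b₁ := hR _ _ hr' r (by simp)
        have b₂ := hR _ _ hr' (r ++ [a]) le_rfl
        rw [List.reverse_append, List.reverse_singleton, List.singleton_append] at b₁ b₂ ⊢
        exact .seq (h₁ b₁) (h₂ b₂))
    w none _ ⟨[], rfl, rfl⟩
  rw [List.append_nil] at hr
  subst hr
  exact ⟨t, h⟩

-- The letters of the query were stacked as they came and lie in reverse order on `query`; pouring
-- them into the oracle machine restores the order. The strict bound `ha` leaves room for the new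
-- answer.
variable {o₀ e₁ o₁} in
theorem run_answer (hb : b + maxPushes (M 1) ≤ B) (q : List β) (x : Bool)
    (h : ComputesWithin (M 1) b (q.map e₁.symm) [o₁.symm x]) (c : Option (Transported α β))
    (s : OwnStore α β) (T : ∀ j k, List ((M j).Γ k)) (hs : s.query = q.reverse)
    (hT : T 1 = fun _ => []) (hB : Below b (glue s T)) (ha : s.ans.length < b) :
    ∃ t, Prog.Run (Below B) (.seq (feedQuery e₁) (.seq (call 1) (takeAnswer o₁))) (idle c) (glue s T)
      t (idle none) (glue { s with query := [], ans := x :: s.ans } T) := by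
  have hq : q.length ≤ b := by
    have : s.query.length ≤ b := hB (.inl .query)
    rwa [hs, List.length_reverse] at this
  have hTb : ∀ j k, (T j k).length ≤ b := fun j k => hB (.inr ⟨j, k⟩)
  have hB' : ∀ l : List ((M 1).Γ (M 1).k₀), l.length ≤ b →
      Below b (glue { s with query := ([] : List β) } (Function.update T 1 (only 1 _ l))) := fun l hl =>
    below_glue (hB (.inl .inp)) (hB (.inl .tmp)) (hB (.inl .copy)) (Nat.zero_le _)
      (hB (.inl .ans)) (hB (.inl .out))
      (length_update_le hTb 1 fun k => (length_only_le _ _ _ _).trans hl)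
  obtain ⟨t₁, h₁⟩ := run_pour (B := B) (k := .inl .query) (k' := .inr ⟨1, (M 1).k₀⟩) (by simp)
    (fun b => .inr (.inl (some b)))
    (fun
    | .inr (.inl (some b)) => some (e₁.symm b)
    | _ => none) e₁.symm (fun _ => rfl) c (glue s T) (fun k => (hB k).trans (by omega)) (by
      change s.query.length + (T 1 (M 1).k₀).length ≤ B
      rw [hT, hs, List.length_reverse, List.length_nil]
      omega)
  obtain ⟨t₂, h₂⟩ := run_call (B := B) hb { s with query := ([] : List β) } none h T (hB' _ (by simpa using hq))
  obtain ⟨t₃, h₃⟩ := run_pour (B := B) (k := .inr ⟨1, (M 1).k₁⟩) (k' := .inl .ans) (by simp)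
    (fun x => .inr (.inr (o₁ x)))
    (fun
    | .inr (.inr b) => some b
    | _ => none) o₁ (fun _ => rfl) none
    (glue { s with query := ([] : List β) } (Function.update T 1 (only 1 _ [o₁.symm x])))
    (below_glue ((hB (.inl .inp)).trans (by omega)) ((hB (.inl .tmp)).trans (by omega))
      ((hB (.inl .copy)).trans (by omega)) (Nat.zero_le _)
      ((hB (.inl .ans)).trans (by omega)) ((hB (.inl .out)).trans (by omega))
      (length_update_le (fun j k => (hTb j k).trans (by omega)) 1 fun k =>
        (length_only_le _ _ _ _).trans (by simp; omega)))
    (by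
      change (Function.update T 1 (only 1 _ [o₁.symm x]) 1 (M 1).k₁).length + s.ans.length ≤ B
      rw [Function.update_self, only_self, List.length_singleton]
      omega)
  refine ⟨t₁ + (t₂ + t₃), .seq ?_ (.seq h₂ ?_)⟩
  · rw [update_query, update_machine] at h₁
    have e : (glue s T (.inl .query)).reverse.map e₁.symm ++
        glue s T (.inr ⟨1, (M 1).k₀⟩) = q.map e₁.symm := by
      change s.query.reverse.map e₁.symm ++ T 1 (M 1).k₀ = _
      rw [hs, hT, List.reverse_reverse, List.append_nil]
    rw [e, hT] at h₁
    exact h₁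
  · rw [update_machine, update_ans, Function.update_idem, Function.update_self, update_only,
      only_nil, ← hT, Function.update_eq_self] at h₃
    have e : (glue { s with query := ([] : List β) } (Function.update T 1 (only 1 _ [o₁.symm x]))
        (.inr ⟨1, (M 1).k₁⟩)).reverse.map o₁ ++
        glue { s with query := ([] : List β) } (Function.update T 1 (only 1 _ [o₁.symm x])) (.inl .ans) =
        x :: s.ans := by
      change (Function.update T 1 (only 1 _ [o₁.symm x]) 1 (M 1).k₁).reverse.map o₁ ++ s.ans = _
      rw [Function.update_self, only_self]
      simp
    rw [e] at h₃
    exact h₃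

theorem joinWords_append {β : Type} (qs qs' : List (List β)) :
    joinWords (qs ++ qs') = joinWords qs ++ joinWords qs' := by
  simp [joinWords]

theorem length_le_length_joinWords {β : Type} (qs : List (List β)) :
    qs.length ≤ (joinWords qs).length := by
  induction qs with
  | nil => simp
  | cons q qs ih =>
    rw [joinWords_cons, List.length_append, List.length_cons, List.length_cons]
    omega

theorem length_answers {β : Type} (A : Language β) (qs : List (List β)) :
    (answers A qs).length = qs.length := by
  simp [answers]

-- Invariant of the loop: `ds` are the queries answered so far, `p` is the part of the current query
-- that has been read, and `p` together with the unread letters spells `ms`. Each answer is paid for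
-- by the separator of its query, so the length of the list of queries also bounds the answers.
variable {o₀ e₁ o₁} in
open Classical in
theorem run_answerAll (hb : b + maxPushes (M 1) ≤ B) (A : Language β) (qs : List (List β))
    (h : ∀ q ∈ qs, ComputesWithin (M 1) b (q.map e₁.symm) [o₁.symm (decide (q ∈ A))])
    (c : List α) (hc : c.length ≤ b) (hqs : (joinWords qs).length ≤ b) :
    ∃ t, Prog.Run (Below B) (answerAll o₀ e₁ o₁) (idle none) (glue { copy := c }
        (Function.update noStacks 0 (only 0 _ ((joinWords qs).map o₀.symm)))) t
      (idle none) (glue { copy := c, ans := (answers A qs).reverse } noStacks) := by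
  have hbd : ∀ (l : List ((M 0).Γ (M 0).k₁)) (ds ms : List (List β)) (p : List β), ds ++ ms = qs →
      p.length + l.length ≤ (joinWords ms).length →
      Below b (glue (α := α) { copy := c, query := p.reverse, ans := (answers A ds).reverse }
        (Function.update noStacks 0 (only 0 _ l))) ∧
      (answers A ds).length + l.length ≤ b := by
    intro l ds ms p hq hl
    have h₁ : (joinWords ds).length + (joinWords ms).length ≤ b := by
      rw [← List.length_append, ← joinWords_append, hq]; exact hqs
    have h₂ := length_le_length_joinWords ds
    have h₃ := length_answers A ds
    refine ⟨below_glue (by simp) (by simp) hc (by simp only [List.length_reverse]; omega)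
      (by simp only [List.length_reverse]; omega) (by simp)
      (length_update_le (by simp [noStacks]) 0 fun k => (length_only_le _ _ _ _).trans (by omega)),
      by omega⟩
  obtain ⟨t, S', h', ds, ms, p, hq, hp, rfl⟩ := run_forEach (B := B) (.inr ⟨0, (M 0).k₁⟩)
    (fun x => .inr (.inl (o₀ x)))
    (fun
    | .inr (.inl (some b)) => .push (.inl .query) fun _ => b
    | .inr (.inl none) => .seq (feedQuery e₁) (.seq (call 1) (takeAnswer o₁))
    | _ => .load id)
    (fun l S => ∃ ds ms p, ds ++ ms = qs ∧ p.map some ++ l.map o₀ = joinWords ms ∧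
      S = glue (α := α) { copy := c, query := p.reverse, ans := (answers A ds).reverse }
        (Function.update noStacks 0 (only 0 _ l)))
    (by
      rintro _ ⟨ds, ms, p, hq, hp, rfl⟩
      have hl := congrArg List.length hp
      simp only [List.length_append, List.length_map] at hl
      refine ⟨?_, fun k => ((hbd _ ds ms p hq hl.le).1 k).trans (by omega)⟩
      change Function.update noStacks 0 (only 0 _ []) 0 (M 0).k₁ = []
      rw [Function.update_self, only_self])
    (by
      rintro (a : (M 0).Γ (M 0).k₁) (l : List ((M 0).Γ (M 0).k₁)) _ ⟨ds, ms, p, hq, hp, rfl⟩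
      have hl := congrArg List.length hp
      simp only [List.length_append, List.length_map, List.length_cons] at hl
      have hbl := hbd l ds ms p hq (by omega)
      refine ⟨?_, ?_, ?_⟩
      · change Function.update noStacks 0 (only 0 _ (a :: l)) 0 (M 0).k₁ = a :: l
        rw [Function.update_self, only_self]
      · rw [update_machine, Function.update_self, Function.update_idem, update_only]
        exact fun k => (hbl.1 k).trans (by omega)
      · rw [update_machine, Function.update_self, Function.update_idem, update_only]
        rw [List.map_cons] at hp
        cases ha : o₀ a with
        | none =>
          rw [ha] at hp
          obtain ⟨ms', rfl, hms'⟩ := eq_of_joinWords hp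
          obtain ⟨t, h'⟩ := run_answer hb p (decide (p ∈ A)) (h p (by simp [← hq]))
            (some (.inr (.inl none)))
            { copy := c, query := p.reverse, ans := (answers A ds).reverse }
            (Function.update noStacks 0 (only 0 _ l)) rfl
            (by rw [Function.update_of_ne (by decide)]; rfl) hbl.1
            (by
              have := (hbd (a :: l) ds (p :: ms') p hq (by rw [List.length_cons]; omega)).2
              rw [List.length_cons] at this
              simp only [List.length_reverse]
              omega)
          refine ⟨t, none, _, h', ds ++ [p], ms', [], by simpa using hq, by simpa using hms', ?_⟩
          simp [answers]
        | some x =>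
          rw [ha] at hp
          have h' := Prog.Run.push (Γ := Alph α β M) (I := Below B) (.inl .query) (fun _ => x)
            (idle (α := α) (β := β) (M := M) (some (.inr (.inl (some x)))))
            (glue { copy := c, query := p.reverse, ans := (answers A ds).reverse }
              (Function.update noStacks 0 (only 0 _ l)))
          rw [update_query] at h'
          have hbx := (hbd l ds ms (p ++ [x]) hq (by simp; omega)).1
          rw [List.reverse_append, List.reverse_singleton, List.singleton_append] at hbx
          exact ⟨1, _, _, h' fun k => (hbx k).trans (by omega), ds, ms, p ++ [x], hq,
            by simpa using hp, by simp [glue]⟩)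
    ((joinWords qs).map o₀.symm) none _ ⟨[], qs, [], rfl, by simp, rfl⟩
  rw [List.map_nil, List.append_nil] at hp
  obtain ⟨rfl, rfl⟩ := eq_nil_of_joinWords hp
  rw [List.append_nil] at hq
  subst hq
  rw [only_nil] at h'
  have e : Function.update noStacks 0 (fun _ => []) = noStacks (M := M) :=
    Function.update_eq_self (f := noStacks) 0
  rw [e] at h'
  exact ⟨t, h'⟩

-- A stack is filled from the bottom, so the third machine receives the answers first and the input
-- afterwards. Both lie in reverse order on `ans` and `copy`, and pouring turns them round, so that
-- its stack reads `pair w (answers A qs)`.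
variable {e₀ o₀ e₁ o₁ e₂ o₂} in
open Classical in
theorem run_parallelProg (hb : ∀ j, b + maxPushes (M j) ≤ B) (A : Language β) (w : List α)
    (qs : List (List β)) (x : Bool)
    (h₀ : ComputesWithin (M 0) b (w.map e₀.symm) ((joinWords qs).map o₀.symm))
    (h₁ : ∀ q ∈ qs, ComputesWithin (M 1) b (q.map e₁.symm) [o₁.symm (decide (q ∈ A))])
    (h₂ : ComputesWithin (M 2) b ((pair w (answers A qs)).map e₂.symm) [o₂.symm x])
    (hw : (pair w (answers A qs)).length ≤ b) :
    ∃ t, Prog.Run (Below B) (parallelProg e₀ o₀ e₁ o₁ e₂ o₂) (idle none)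
      (glue { inp := w } noStacks) t (idle none) (glue { out := [x] } noStacks) := by
  have hB : b ≤ B := (Nat.le_add_right _ _).trans (hb 0)
  have hqs : (joinWords qs).length ≤ b := by simpa using h₀.length_le
  simp only [pair, List.length_append, List.length_map] at hw
  have hT : ∀ (j : Fin 3) (k : (M j).K) (l : List ((M j).Γ k)), l.length ≤ b → ∀ i k',
      (Function.update noStacks j (only j k l) i k').length ≤ b := fun j k l hl =>
    length_update_le (by simp [noStacks]) j fun k => (length_only_le _ _ _ _).trans hl
  have e : ∀ j k, Function.update noStacks j (only j k []) = noStacks (M := M) := fun j k => by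
    rw [only_nil]
    exact Function.update_eq_self (f := noStacks) j
  obtain ⟨t₁, r₁⟩ := run_copyInput (M := M) (β := β) (B := B) w (by omega)
  obtain ⟨t₂, r₂⟩ := run_pour (B := B) (k := .inl .tmp) (k' := .inr ⟨0, (M 0).k₀⟩) (by simp)
    Sum.inl
    (fun
    | .inl a => some (e₀.symm a)
    | .inr _ => none) e₀.symm (fun _ => rfl) none
    (glue (β := β) (M := M) { tmp := w.reverse, copy := w.reverse } noStacks)
    (below_glue (by simp) (by simp; omega) (by simp; omega) (by simp) (by simp) (by simp)
      (by simp [noStacks]))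
    (by
      change w.reverse.length + List.length [] ≤ B
      simp; omega)
  rw [update_tmp, update_machine] at r₂
  have e₂' : (glue (β := β) (M := M) { tmp := w.reverse, copy := w.reverse } noStacks
        (.inl .tmp)).reverse.map e₀.symm ++
      glue (β := β) (M := M) { tmp := w.reverse, copy := w.reverse } noStacks (.inr ⟨0, (M 0).k₀⟩) =
      w.map e₀.symm := by
    change w.reverse.reverse.map e₀.symm ++ [] = _
    simp
  rw [e₂'] at r₂
  obtain ⟨t₃, r₃⟩ := run_call (hb 0) (α := α) (β := β) { copy := w.reverse } none h₀ noStacks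
    (below_glue (by simp) (by simp) (by simp; omega) (by simp) (by simp) (by simp)
      (hT 0 _ _ (by simp; omega)))
  obtain ⟨t₄, r₄⟩ := run_answerAll (α := α) (o₀ := o₀) (hb 1) A qs h₁ w.reverse (by simp; omega) hqs
  obtain ⟨t₅, r₅⟩ := run_pour (B := B) (k := .inl .ans) (k' := .inr ⟨2, (M 2).k₀⟩) (by simp)
    (fun b => .inr (.inr b))
    (fun
    | .inr (.inr b) => some (e₂.symm (.inr b))
    | _ => none) (fun b => e₂.symm (.inr b)) (fun _ => rfl) none
    (glue (β := β) (M := M) { copy := w.reverse, ans := (answers A qs).reverse } noStacks)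
    (below_glue (by simp) (by simp) (by simp; omega) (by simp) (by simp; omega) (by simp)
      (by simp [noStacks]))
    (by
      change (answers A qs).reverse.length + List.length [] ≤ B
      simp; omega)
  rw [update_ans, update_machine] at r₅
  have e₅ : (glue (α := α) (β := β) (M := M) { copy := w.reverse, ans := (answers A qs).reverse } noStacks
        (.inl .ans)).reverse.map (fun b => e₂.symm (.inr b)) ++
      glue (α := α) (β := β) (M := M) { copy := w.reverse, ans := (answers A qs).reverse } noStacks
        (.inr ⟨2, (M 2).k₀⟩) =
      (answers A qs).map (fun b => e₂.symm (.inr b)) := by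
    change (answers A qs).reverse.reverse.map (fun b => e₂.symm (.inr b)) ++ [] = _
    simp
  rw [e₅] at r₅
  obtain ⟨t₆, r₆⟩ := run_pour (B := B) (k := .inl .copy) (k' := .inr ⟨2, (M 2).k₀⟩) (by simp)
    Sum.inl
    (fun
    | .inl a => some (e₂.symm (.inl a))
    | .inr _ => none) (fun a => e₂.symm (.inl a)) (fun _ => rfl) none
    (glue (β := β) (M := M) { copy := w.reverse } (Function.update noStacks 2
      (only 2 _ ((answers A qs).map fun b => e₂.symm (.inr b)))))
    (below_glue (by simp) (by simp) (by simp; omega) (by simp) (by simp) (by simp)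
      (fun j k => (hT 2 _ _ (by simp; omega) j k).trans hB))
    (by
      change w.reverse.length + (Function.update noStacks 2
        (only 2 _ ((answers A qs).map fun b => e₂.symm (.inr b))) 2 (M 2).k₀).length ≤ B
      rw [Function.update_self, only_self]
      simp; omega)
  rw [update_copy, update_machine, Function.update_self, Function.update_idem, update_only] at r₆
  have e₆ : (glue (β := β) (M := M) { copy := w.reverse } (Function.update noStacks 2
        (only 2 _ ((answers A qs).map fun b => e₂.symm (.inr b)))) (.inl .copy)).reverse.map
        (fun a => e₂.symm (.inl a)) ++
      glue (β := β) (M := M) { copy := w.reverse } (Function.update noStacks 2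
        (only 2 _ ((answers A qs).map fun b => e₂.symm (.inr b)))) (.inr ⟨2, (M 2).k₀⟩) =
      (pair w (answers A qs)).map e₂.symm := by
    change w.reverse.reverse.map (fun a => e₂.symm (.inl a)) ++ Function.update noStacks 2
        (only 2 _ ((answers A qs).map fun b => e₂.symm (.inr b))) 2 (M 2).k₀ = _
    rw [Function.update_self, only_self]
    simp [pair]
    rfl
  rw [e₆] at r₆
  obtain ⟨t₇, r₇⟩ := run_call (hb 2) (α := α) (β := β) {} none h₂ noStacks
    (below_glue (by simp) (by simp) (by simp) (by simp) (by simp) (by simp)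
      (hT 2 _ _ (by simp [pair]; omega)))
  have hb1 : 1 ≤ b := by simpa using h₂.length_le
  obtain ⟨t₈, r₈⟩ := run_pour (B := B) (k := .inr ⟨2, (M 2).k₁⟩) (k' := .inl .out) (by simp)
    (fun x => .inr (.inr (o₂ x)))
    (fun
    | .inr (.inr b) => some b
    | _ => none) o₂ (fun _ => rfl) none
    (glue (α := α) (β := β) (M := M) {} (Function.update noStacks 2 (only 2 _ [o₂.symm x])))
    (below_glue (by simp) (by simp) (by simp) (by simp) (by simp) (by simp)
      (fun j k => (hT 2 _ _ (by simpa using hb1) j k).trans hB))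
    (by
      change (Function.update noStacks 2 (only 2 _ [o₂.symm x]) 2 (M 2).k₁).length +
        List.length [] ≤ B
      rw [Function.update_self, only_self]
      simp; omega)
  rw [update_machine, update_out, Function.update_self, Function.update_idem, update_only, e] at r₈
  have e₈ : (glue (α := α) (β := β) (M := M) {} (Function.update noStacks 2 (only 2 _ [o₂.symm x]))
        (.inr ⟨2, (M 2).k₁⟩)).reverse.map o₂ ++
      glue (α := α) (β := β) (M := M) {} (Function.update noStacks 2 (only 2 _ [o₂.symm x])) (.inl .out) =
      [x] := by
    change (Function.update noStacks 2 (only 2 _ [o₂.symm x]) 2 (M 2).k₁).reverse.map o₂ ++ [] = _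
    rw [Function.update_self, only_self]
    simp
  rw [e₈] at r₈
  exact ⟨_, .seq r₁ (.seq r₂ (.seq r₃ (.seq r₄ (.seq r₅ (.seq r₆ (.seq r₇ r₈))))))⟩

end parallel

/-- The list of queries has polynomial length because it is written in polynomial time. Each query
is answered in the same polynomial space, and only one bit per query is kept. -/
theorem InPSPACE.of_parallelQuery {L : Language α} {A : Language β} {queries : List α → List (List β)}
    (hA : InPSPACE A) (h : IsParallelQueryAlgorithm L A queries) : InPSPACE L := by
  classical
  obtain ⟨f₁, hf₁, M₁, p₁, hM₁⟩ := hA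
  obtain ⟨⟨C₀⟩, V, ⟨f₂, hf₂, ⟨C₂⟩⟩, hL⟩ := h
  let M : Fin 3 → FinTM2 := ![C₀.tm, M₁.tm, C₂.tm]
  let _ := M₁.tm.Γk₀Fin
  let _ := C₀.tm.Γk₀Fin
  have : Fintype α := Fintype.ofEquiv _ C₀.inputAlphabet
  have : Fintype β := Fintype.ofEquiv _ M₁.inputAlphabet
  have := finite_state α β M
  let : Fintype (State α β M) := Fintype.ofFinite _
  have := finite_ownStack
  have : ∀ j, Finite (M j).K := fun j => @Finite.of_fintype _ (M j).kFin
  let : Fintype (AllStack M) := Fintype.ofFinite _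
  let P : Prog (Alph α β M) (State α β M) := parallelProg C₀.inputAlphabet C₀.outputAlphabet
    M₁.inputAlphabet M₁.outputAlphabet C₂.inputAlphabet C₂.outputAlphabet
  let : Fintype (Alph α β M (.inl .inp)) := ‹Fintype α›
  -- `l` bounds the space in which the queries are written, hence the length of their list and of
  -- each of them. `b` adds the space for answering a query of length at most `l` and for evaluating
  -- a word of length at most `X + l`. `B` adds room for the pushes within a single step of a
  -- machine.
  let l : Polynomial ℕ := .X + C₀.time * .C (maxPushes (M 0))
  let b : Polynomial ℕ := l + p₁.comp l + ((.X + l) + C₂.time.comp (.X + l) * .C (maxPushes (M 2)))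
  let B : Polynomial ℕ :=
    b + (.C (maxPushes (M 0)) + .C (maxPushes (M 1)) + .C (maxPushes (M 2)))
  have key : ∀ w : List α, ∃ t, Prog.Run (Below (B.eval w.length)) P (idle none)
      (glue { inp := w } noStacks) t (idle none)
      (glue { out := [f₂ (pair w (answers A (queries w)))] } noStacks) := by
    intro w
    have hb : b.eval w.length = l.eval w.length + p₁.eval (l.eval w.length) +
        ((w.length + l.eval w.length) +
          C₂.time.eval (w.length + l.eval w.length) * maxPushes (M 2)) := by
      simp [b]
    have hB : B.eval w.length = b.eval w.length +
        (maxPushes (M 0) + maxPushes (M 1) + maxPushes (M 2)) := by simp [B]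
    have h₀ : ComputesWithin (M 0) (l.eval w.length) (w.map C₀.inputAlphabet.symm)
        ((joinWords (queries w)).map C₀.outputAlphabet.symm) := by
      have := ComputesWithin.of_outputsInTime (C₀.outputsFun w)
      refine this.mono (le_of_eq ?_)
      simp [l, M]
    have hl : (joinWords (queries w)).length ≤ l.eval w.length :=
      le_of_eq_of_le (List.length_map (f := C₀.outputAlphabet.symm)).symm h₀.length_le
    have hq : ∀ q ∈ queries w, q.length ≤ l.eval w.length := by
      intro q hq
      obtain ⟨qs, qs', h⟩ := List.append_of_mem hq
      rw [h, joinWords_append, joinWords_cons] at hl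
      simp only [List.length_append, List.length_cons, List.length_map] at hl
      omega
    have hp : (pair w (answers A (queries w))).length ≤ w.length + l.eval w.length := by
      have := length_le_length_joinWords (queries w)
      simp only [pair, List.length_append, List.length_map, length_answers]
      omega
    refine run_parallelProg (b := b.eval w.length) ?_ A w (queries w) _ (h₀.mono (by omega)) ?_ ?_
      (by omega)
    · intro j
      fin_cases j <;> simp only [Fin.zero_eta, Fin.mk_one, Fin.reduceFinMk] <;> omega
    · intro q hqw
      obtain ⟨⟨h⟩, hs⟩ := hM₁ q
      have hfq : f₁ q = decide (q ∈ A) := by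
        rw [Bool.eq_iff_iff, hf₁ q, decide_eq_true_iff]
      rw [hfq] at h
      have h₁ : ComputesWithin M₁.tm (p₁.eval q.length) (q.map M₁.inputAlphabet.symm)
          [M₁.outputAlphabet.symm (decide (q ∈ A))] :=
        ⟨_, (Steps.of_evals h.steps _ h.evals_in_steps).imp_of_reaches hs⟩
      have := LProg.eval_mono p₁ (hq q hqw)
      exact h₁.mono (by omega)
    · have := ComputesWithin.of_outputsInTime (C₂.outputsFun (pair w (answers A (queries w))))
      refine this.mono ?_
      have hm := Nat.mul_le_mul_right (maxPushes (M 2)) (LProg.eval_mono C₂.time hp)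
      simp only [List.length_map, id]
      change _ + _ * maxPushes (M 2) ≤ _
      omega
  refine ⟨fun w => f₂ (pair w (answers A (queries w))), fun w => (hf₂ _).trans (hL w).symm,
    ⟨P.machine (.inl .inp) (.inl .out) (idle none), Equiv.refl _, Equiv.refl _⟩, B, fun w => ?_⟩
  obtain ⟨t, h⟩ := key w
  have e₁ : glue { inp := w } (noStacks (M := M)) =
      Function.update (fun _ => []) (.inl .inp) w (β := fun k => List (Alph α β M k)) := by
    have : (fun _ => []) = glue (α := α) (β := β) {} (noStacks (M := M)) := by
      funext k; rcases k with (_ | _ | _ | _ | _ | _) | k <;> rfl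
    rw [this, update_inp]
  have e₂ : glue { out := [f₂ (pair w (answers A (queries w)))] } (noStacks (M := M)) =
      Function.update (fun _ => []) (.inl .out) [f₂ (pair w (answers A (queries w)))]
        (β := fun k => List (Alph α β M k)) := by
    have : (fun _ => []) = glue (α := α) (β := β) {} (noStacks (M := M)) := by
      funext k; rcases k with (_ | _ | _ | _ | _ | _) | k <;> rfl
    rw [this, update_out]
  rw [e₁, e₂] at h
  have hs : ∀ u, u = w → Steps (P.machine (.inl .inp) (.inl .out) (idle none)).step
      (fun c => Below (B.eval w.length) (Cfg.stk c)) t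
      (initList (P.machine (.inl .inp) (.inl .out) (idle none)) u)
      (haltList (P.machine (.inl .inp) (.inl .out) (idle none))
        [f₂ (pair w (answers A (queries w)))]) := by
    rintro _ rfl
    exact h.machine_steps
  have hs := hs _ (List.map_id w)
  have hwB : w.length ≤ B.eval w.length := by
    simp only [B, b, l, Polynomial.eval_add, Polynomial.eval_X]
    omega
  refine ⟨⟨⟨t, hs.evals⟩⟩, fun c hc => hs.inv_of_reaches (fun k => ?_) rfl hc⟩
  exact (stk_initList_length_le _ _ k).trans
    (le_of_eq_of_le (congrArg List.length (List.map_id w)) hwB)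

end Space

end RG

namespace RG

/-! ### Rational elimination by giving everything to one player -/

section Elimination

variable {LOG : ResourceLogic} {n : ℕ}

/-- Weakening is applied once for each formula by which `Γ'` exceeds `Γ`. -/
theorem ResourceLogic.Affine.proves_mono (hLOG : LOG.Affine) {Γ Γ' : Multiset Formula} {A : Formula}
    (hle : Γ ≤ Γ') (hΓ : ∀ B ∈ Γ', LOG.IsFormula B) (h : LOG.Proves Γ A) : LOG.Proves Γ' A := by
  obtain ⟨Δ, rfl⟩ := Multiset.le_iff_exists_add.1 hle
  clear hle
  induction Δ using Multiset.induction_on with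
  | empty => simpa using h
  | cons B Δ ih =>
    rw [Multiset.add_cons] at hΓ ⊢
    exact hLOG _ _ _ (hΓ B (Multiset.mem_cons_self _ _))
      (ih fun C hC => hΓ C (Multiset.mem_cons_of_mem hC))

/-- The choice is greedy: `a` contributes `O ∩ f a`, and the rest `O - f a` is left to the others.
In particular every redistribution admits every outcome contained in the pool. -/
theorem exists_contributions {ι α : Type} [DecidableEq ι] [DecidableEq α] (f : ι → Multiset α)
    (s : Finset ι) : ∀ O ≤ ∑ i ∈ s, f i, ∃ g : ι → Multiset α, (∀ i, g i ≤ f i) ∧ ∑ i ∈ s, g i = O := by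
  induction s using Finset.induction_on with
  | empty =>
    intro O hO
    exact ⟨0, fun i => Multiset.zero_le _, by simpa [eq_comm] using hO⟩
  | insert a s ha ih =>
    intro O hO
    rw [Finset.sum_insert ha] at hO
    obtain ⟨g, hg, hs⟩ := ih (O - f a) (tsub_le_iff_left.2 hO)
    refine ⟨Function.update g a (O ∩ f a), fun i => ?_, ?_⟩
    · rcases eq_or_ne i a with rfl | hi
      · simpa using Multiset.inter_le_right
      · simpa [hi] using hg i
    · rw [Finset.sum_insert ha, Function.update_self, Finset.sum_update_of_notMem ha, hs,
        add_comm, Multiset.sub_add_inter]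

theorem out_single (i : Fin n) (Γ : Multiset Formula) : out (Pi.single i Γ : Profile n) = Γ := by
  simp [out]

/-- A strictly smaller contribution lacks some formula `A`, and the contributions of the others are
unchanged. -/
theorem out_update_lt {P : Profile n} {i : Fin n} {C : Multiset Formula} (h : C < P i) :
    ∃ A ∈ out P, out (Function.update P i C) ≤ (out P).erase A := by
  obtain ⟨A, hA⟩ := Multiset.lt_iff_cons_le.1 h
  have e : out P = P i + ∑ j ∈ Finset.univ \ {i}, P j := by
    rw [out, ← Finset.sum_sdiff (Finset.subset_univ {i}), Finset.sum_singleton, add_comm]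
  have e' : out (Function.update P i C) = C + ∑ j ∈ Finset.univ \ {i}, P j := by
    rw [out, Finset.sum_update_of_mem (Finset.mem_univ i)]
  have hle : A ::ₘ out (Function.update P i C) ≤ out P := by
    rw [e, e', ← Multiset.cons_add]
    exact add_le_add_left hA _
  exact ⟨A, Multiset.mem_of_le hle (Multiset.mem_cons_self _ _),
    by simpa using Multiset.erase_le_erase A hle⟩

theorem isFormula_pool {G : Game n} (hG : G.IsOver LOG) : ∀ A ∈ G.pool, LOG.IsFormula A := by
  intro A hA
  obtain ⟨i, _, hi⟩ := Multiset.mem_sum.1 hA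
  exact (hG i).2 A hi

theorem out_le_pool {G : Game n} {P : Profile n} (hP : P ∈ G.ch) : out P ≤ G.pool :=
  Finset.sum_le_sum fun i _ => hP i

/-- The checks of the elimination algorithm, in terms of provability. -/
theorem eliminationTest_iff (hLOG : LOG.Affine) (pref : Preference) {G : Game n} {P : Profile n}
    (hG : G.IsOver LOG) (hP : P ∈ G.ch) :
    EliminationTest LOG pref G P ↔ ∃ i,
      (¬ LOG.Proves (out P) (G.goal i) ∧ LOG.Proves G.pool (G.goal i)) ∨
      (pref = .parsimonious ∧ ∃ A ∈ out P, ¬ LOG.Proves (out P) (G.goal i) ∨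
        LOG.Proves ((out P).erase A) (G.goal i)) := by
  -- The pool is never a proper part of the outcome, so in the comparison with the pool only the
  -- clause about provability can apply.
  have hE : ¬ G.pool < out P := fun h => absurd (out_le_pool hP) h.not_ge
  refine exists_congr fun i => ?_
  cases pref with
  | dichotomous => simp [StronglyPrefers, out_single, Game.giveAll, and_comm]
  | parsimonious =>
    have hA : ∀ A ∈ out P, (out P).erase A < out P := fun A hA => Multiset.erase_lt.2 hA
    -- By monotonicity, removing `A` cannot make the goal provable. Hence the smaller contribution
    -- is preferred unless the goal is provable from `out P` and no longer provable without `A`.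
    have hm : ∀ A ∈ out P, LOG.Proves ((out P).erase A) (G.goal i) →
        LOG.Proves (out P) (G.goal i) := fun A hA =>
      hLOG.proves_mono (Multiset.erase_le _ _)
        fun B hB => isFormula_pool hG B (Multiset.mem_of_le (out_le_pool hP) hB)
    simp only [StronglyPrefers, out_single, Game.giveAll, Pi.single_eq_same, hE, and_false,
      false_or, or_false, true_and]
    refine or_congr and_comm (exists_congr fun A => and_congr_right fun hAP => ?_)
    have := hA A hAP
    have := hm A hAP
    tauto

theorem rationallyEliminable_iff (hLOG : LOG.Affine) (pref : Preference) {G : Game n}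
    {P : Profile n} (hG : G.IsOver LOG) (hP : P ∈ G.ch) :
    RationallyEliminable LOG pref G P ↔ EliminationTest LOG pref G P := by
  constructor
  · rintro ⟨ε, hε, h⟩
    have hε : ∑ i, ε i = G.pool := hε
    rw [eliminationTest_iff hLOG pref hG hP]
    -- The definition of elimination quantifies over all profiles with this outcome; one such
    -- profile is needed in order to obtain a deviation.
    obtain ⟨P', hP', hout⟩ := exists_contributions ε Finset.univ (out P)
      (by rw [hε]; exact out_le_pool hP)
    have hout : out P' = out P := hout
    have hne := h P' hP' hout
    simp only [NE, Set.mem_ofPred_eq, not_and, not_forall, not_not] at hne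
    obtain ⟨i, C, hC, hpref⟩ := hne hP'
    have hC : C ≤ ε i := hC
    have hQ : out (Function.update P' i C) ≤ G.pool := by
      rw [← hε]
      refine Finset.sum_le_sum fun j _ => ?_
      rcases eq_or_ne j i with rfl | hj
      · simpa using hC
      · simpa [hj] using hP' j
    have hup : LOG.Proves (out (Function.update P' i C)) (G.goal i) →
        LOG.Proves G.pool (G.goal i) := hLOG.proves_mono hQ (isFormula_pool hG)
    have hdown : C < P' i → ∃ A ∈ out P, out (Function.update P' i C) ≤ (out P).erase A := by
      intro hlt
      simpa only [hout] using out_update_lt hlt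
    have hm : ∀ A ∈ out P, out (Function.update P' i C) ≤ (out P).erase A →
        LOG.Proves (out (Function.update P' i C)) (G.goal i) →
        LOG.Proves ((out P).erase A) (G.goal i) := fun A hA hle =>
      hLOG.proves_mono hle fun B hB => isFormula_pool hG B
        (Multiset.mem_of_le (out_le_pool hP) (Multiset.mem_of_mem_erase hB))
    refine ⟨i, ?_⟩
    cases pref with
    | dichotomous =>
      simp only [StronglyPrefers, hout] at hpref
      exact .inl ⟨hpref.2, hup hpref.1⟩
    | parsimonious =>
      simp only [StronglyPrefers, hout, Function.update_self] at hpref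
      rcases hpref with ⟨-, h₂, hlt⟩ | ⟨h₁, h₂⟩ | ⟨h₁, h₂, hlt⟩
      · obtain ⟨A, hA, hle⟩ := hdown hlt
        exact .inr ⟨rfl, A, hA, .inl h₂⟩
      · exact .inl ⟨h₂, hup h₁⟩
      · obtain ⟨A, hA, hle⟩ := hdown hlt
        exact .inr ⟨rfl, A, hA, .inr (hm A hA hle h₁)⟩
  · rintro ⟨i, hi⟩
    refine ⟨(G.giveAll i).endow, by simp [redis, Game.giveAll, Game.pool], ?_⟩
    intro P' hP' hout hne
    -- The players other than `i` own nothing, so only one profile has the outcome of `P`.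
    have hP'i : P' = Pi.single i (out P) := by
      have h0 : ∀ j, j ≠ i → P' j = 0 := by
        intro j hj
        have : P' j ≤ (Pi.single i G.pool : Profile n) j := hP' j
        rw [Pi.single_eq_of_ne hj] at this
        exact Multiset.le_zero.1 this
      have h1 : P' i = out P := by
        rw [← hout, out, Finset.sum_eq_single i (fun j _ hj => h0 j hj) (by simp)]
      funext j
      rcases eq_or_ne j i with rfl | hj
      · simpa using h1
      · simpa [hj] using h0 j hj
    have hdev : ∀ C : Multiset Formula, Function.update P' i C = Pi.single i C := by
      intro C
      rw [hP'i]
      exact Function.update_idem _ _ _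
    have key : ∀ C ≤ G.pool, ¬ StronglyPrefers LOG pref (G.giveAll i) i (Pi.single i C)
        (Pi.single i (out P)) := by
      intro C hC
      have := hne.2 i C (by simpa [Game.giveAll] using hC)
      rwa [hdev, hP'i] at this
    rcases hi with h | ⟨-, A, -, h⟩
    · exact key _ le_rfl h
    · exact key _ ((Multiset.erase_le _ _).trans (out_le_pool hP)) h

end Elimination

/-! ### The encodings are injective -/

section Encoding

/-- Unique readability of prefix notation: the first letter reveals the outermost connective, and
the dot ends the name of an atom. The remainders `r` and `s` allow the induction to pass from the
first argument of a connective to the second. -/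
theorem encodeFormula_append_inj : ∀ (A B : Formula) (r s : List Letter),
    encodeFormula A ++ r = encodeFormula B ++ s → A = B ∧ r = s := by
  have atoms : ∀ (v w : List Bool) (r s : List Letter),
      v.map Letter.bit ++ .dot :: r = w.map Letter.bit ++ .dot :: s → v = w ∧ r = s := by
    intro v
    induction v with
    | nil =>
      intro w r s h
      cases w with
      | nil => simpa using h
      | cons b w => simp at h
    | cons a v ih =>
      intro w r s h
      cases w with
      | nil => simp at h
      | cons b w =>
        simp only [List.map_cons, List.cons_append, List.cons.injEq, Letter.bit.injEq] at h
        obtain ⟨h₁, h₂⟩ := ih w r s h.2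
        exact ⟨by rw [h.1, h₁], h₂⟩
  have atom_conn : ∀ (v : List Bool) (r s : List Letter) (c : Connective),
      v.map Letter.bit ++ .dot :: r ≠ .conn c :: s := by
    intro v r s c
    cases v <;> simp
  have binary : ∀ (c : Connective) (mk : Formula → Formula → Formula) (A A' : Formula),
      (∀ B B', encodeFormula (mk B B') = .conn c :: (encodeFormula B ++ encodeFormula B')) →
      (∀ B s l, encodeFormula B ++ s = .conn c :: l → ∃ B₁ B₂, B = mk B₁ B₂) →
      (∀ (B : Formula) (r s : List Letter),
        encodeFormula A ++ r = encodeFormula B ++ s → A = B ∧ r = s) →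
      (∀ (B : Formula) (r s : List Letter),
        encodeFormula A' ++ r = encodeFormula B ++ s → A' = B ∧ r = s) →
      ∀ (B : Formula) (r s : List Letter),
        encodeFormula (mk A A') ++ r = encodeFormula B ++ s → mk A A' = B ∧ r = s := by
    intro c mk A A' hmk hhd ih ih' B r s h
    rw [hmk] at h
    obtain ⟨B₁, B₂, rfl⟩ := hhd B s _ h.symm
    rw [hmk, List.cons_append, List.cons_append, List.append_assoc, List.append_assoc] at h
    obtain ⟨h₁, h₂⟩ := ih _ _ _ (List.cons.inj h).2
    obtain ⟨h₃, h₄⟩ := ih' _ _ _ h₂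
    exact ⟨by rw [h₁, h₃], h₄⟩
  intro A
  induction A with
  | atom v =>
    intro B r s h
    cases B with
    | atom w =>
      obtain ⟨h₁, h₂⟩ := atoms v w r s (by simpa [encodeFormula] using h)
      exact ⟨by rw [h₁], h₂⟩
    | _ => exact absurd (by simpa [encodeFormula] using h) (atom_conn v r _ _)
  | one | bot | top | zero =>
    intro B r s h
    cases B with
    | atom w => exact absurd (by simpa [encodeFormula] using h.symm) (atom_conn w s _ _)
    | _ => simp [encodeFormula] at h <;> exact ⟨rfl, h⟩
  | neg A ih =>
    intro B r s h
    cases B with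
    | atom w => exact absurd (by simpa [encodeFormula] using h.symm) (atom_conn w s _ _)
    | neg B =>
      obtain ⟨h₁, h₂⟩ := ih B r s (by simpa [encodeFormula] using h)
      exact ⟨by rw [h₁], h₂⟩
    | _ => simp [encodeFormula] at h
  | tensor A A' ih ih' =>
    refine binary .tensor .tensor A A' (fun _ _ => rfl) (fun B s l h => ?_) ih ih'
    rcases B with (_ | _) | _ <;> simp [encodeFormula] at h ⊢
  | par A A' ih ih' =>
    refine binary .par .par A A' (fun _ _ => rfl) (fun B s l h => ?_) ih ih'
    rcases B with (_ | _) | _ <;> simp [encodeFormula] at h ⊢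
  | lolli A A' ih ih' =>
    refine binary .lolli .lolli A A' (fun _ _ => rfl) (fun B s l h => ?_) ih ih'
    rcases B with (_ | _) | _ <;> simp [encodeFormula] at h ⊢
  | amp A A' ih ih' =>
    refine binary .amp .amp A A' (fun _ _ => rfl) (fun B s l h => ?_) ih ih'
    rcases B with (_ | _) | _ <;> simp [encodeFormula] at h ⊢
  | plus A A' ih ih' =>
    refine binary .plus .plus A A' (fun _ _ => rfl) (fun B s l h => ?_) ih ih'
    rcases B with (_ | _) | _ <;> simp [encodeFormula] at h ⊢

theorem encodeFormula_injective : Function.Injective encodeFormula := fun A B h =>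
  (encodeFormula_append_inj A B [] [] (by rw [h])).1

/-- The letters with which the encodings of formulas begin. -/
def Letter.Opens : Letter → Prop
  | .conn _ | .bit _ | .dot => True
  | .comma | .turnstile | .semicolon => False

theorem encodeFormula_eq_cons (A : Formula) : ∃ a l, encodeFormula A = a :: l ∧ a.Opens := by
  cases A with
  | atom w => cases w <;> exact ⟨_, _, rfl, trivial⟩
  | _ => exact ⟨_, _, rfl, trivial⟩

theorem encodeFormulas_cons (A : Formula) (Γ : List Formula) :
    encodeFormulas (A :: Γ) = encodeFormula A ++ .comma :: encodeFormulas Γ := by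
  simp [encodeFormulas]

theorem encodeFormulas_append (Γ Δ : List Formula) :
    encodeFormulas (Γ ++ Δ) = encodeFormulas Γ ++ encodeFormulas Δ := by
  simp [encodeFormulas]

/-- The letter `a` does not begin any formula, so it marks the end of the list. -/
theorem encodeFormulas_append_inj {a : Letter} (ha : ¬ a.Opens) (r s : List Letter) :
    ∀ Γ Δ : List Formula, encodeFormulas Γ ++ a :: r = encodeFormulas Δ ++ a :: s → Γ = Δ ∧ r = s
  | [], [], h => by simpa [encodeFormulas] using h
  | [], B :: Δ, h => by
      obtain ⟨b, l, hb, hop⟩ := encodeFormula_eq_cons B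
      rw [encodeFormulas_cons, hb] at h
      simp only [encodeFormulas, List.flatMap_nil, List.nil_append, List.cons_append,
        List.cons.injEq] at h
      exact absurd (h.1 ▸ hop) ha
  | A :: Γ, [], h => by
      obtain ⟨b, l, hb, hop⟩ := encodeFormula_eq_cons A
      rw [encodeFormulas_cons, hb] at h
      simp only [encodeFormulas, List.flatMap_nil, List.nil_append, List.cons_append,
        List.cons.injEq] at h
      exact absurd (h.1 ▸ hop) ha
  | A :: Γ, B :: Δ, h => by
      rw [encodeFormulas_cons, encodeFormulas_cons, List.append_assoc, List.append_assoc] at h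
      obtain ⟨h₁, h₂⟩ := encodeFormula_append_inj _ _ _ _ h
      simp only [List.cons_append, List.cons.injEq, true_and] at h₂
      obtain ⟨h₃, h₄⟩ := encodeFormulas_append_inj ha r s Γ Δ h₂
      exact ⟨by rw [h₁, h₃], h₄⟩

theorem encodeSequent_inj {Γ Δ Γ' Δ' : List Formula}
    (h : encodeSequent Γ Δ = encodeSequent Γ' Δ') : Γ = Γ' ∧ Δ = Δ' := by
  obtain ⟨h₁, h₂⟩ := encodeFormulas_append_inj (a := .turnstile) id _ _ _ _ h
  -- The right sides have no end mark of their own, so a turnstile is appended to both of them.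
  refine ⟨h₁, (encodeFormulas_append_inj (a := .turnstile) id [] [] Δ Δ' (by rw [h₂])).1⟩

theorem encodeSequent_mem_iff (LOG : ResourceLogic) (Γ : List Formula) (A : Formula) :
    encodeSequent Γ [A] ∈ SequentValidity LOG ↔ LOG.Proves Γ A := by
  constructor
  · rintro ⟨Γ', Δ', h, hp⟩
    obtain ⟨rfl, rfl⟩ := encodeSequent_inj h
    exact hp
  · intro h
    exact ⟨Γ, [A], rfl, h⟩

end Encoding

/-! ### The queries of the elimination algorithm -/

section Queries

/-- The outcome, as a list. -/
def REInput.outcome (x : REInput) : List Formula := x.flatMap PlayerData.contribution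

/-- The pool, as a list. -/
def REInput.resources (x : REInput) : List Formula := x.flatMap PlayerData.endowment

theorem sum_coe_get {α : Type} (f : PlayerData → List α) : ∀ x : List PlayerData,
    ∑ i : Fin x.length, (f (x.get i) : Multiset α) = (x.flatMap f : List α)
  | [] => by simp
  | d :: x => by
      have := sum_coe_get f x
      simp only [List.length_cons, Fin.sum_univ_succ, List.flatMap_cons, ← Multiset.coe_add]
      rw [← this]
      rfl

theorem out_profile (x : REInput) : out (REInput.profile x) = (x.outcome : Multiset Formula) :=
  sum_coe_get _ x

theorem pool_game (x : REInput) : (REInput.game x).pool = (x.resources : Multiset Formula) :=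
  sum_coe_get _ x

/-- The lists that arise from `pre ++ l` by removing a member of `l`. -/
def removals {α : Type} (pre : List α) : List α → List (List α)
  | [] => []
  | a :: l => (pre ++ l) :: removals (pre ++ [a]) l

theorem mem_removals {α : Type} [DecidableEq α] : ∀ (l pre Γ : List α), Γ ∈ removals pre l →
    ∃ A ∈ l, (Γ : Multiset α) = ((pre ++ l : List α) : Multiset α).erase A
  | [], _, _, h => by simp [removals] at h
  | a :: l, pre, Γ, h => by
      rw [removals, List.mem_cons] at h
      rcases h with rfl | h
      · refine ⟨a, by simp, ?_⟩
        rw [Multiset.coe_eq_coe.2 List.perm_middle, ← Multiset.cons_coe, Multiset.erase_cons_head]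
      · obtain ⟨A, hA, hΓ⟩ := mem_removals l _ Γ h
        exact ⟨A, List.mem_cons_of_mem _ hA, by simpa using hΓ⟩

theorem exists_mem_removals {α : Type} [DecidableEq α] : ∀ (l pre : List α) (A : α), A ∈ l →
    ∃ Γ ∈ removals pre l, (Γ : Multiset α) = ((pre ++ l : List α) : Multiset α).erase A
  | [], _, _, h => by simp at h
  | a :: l, pre, A, h => by
      rcases List.mem_cons.1 h with rfl | h
      · refine ⟨pre ++ l, by simp [removals], ?_⟩
        rw [Multiset.coe_eq_coe.2 (List.perm_middle (l₁ := pre)), ← Multiset.cons_coe,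
          Multiset.erase_cons_head]
      · obtain ⟨Γ, hΓ, he⟩ := exists_mem_removals l (pre ++ [a]) A h
        exact ⟨Γ, by simp [removals, hΓ], by simpa using he⟩

/-- In this mode the outcome is compared with the outcome minus one formula. -/
def removalMode (pref : Preference) (O : List Formula) : Bool :=
  match pref with
  | .dichotomous => false
  | .parsimonious => !O.isEmpty

/-- The queries for one goal. -/
def goalQueries (mode : Bool) (O E : List Formula) (A : Formula) : List (List Letter) :=
  if mode then (removals [] O).flatMap fun Γ => [encodeSequent O [A], encodeSequent Γ [A]]
  else [encodeSequent O [A], encodeSequent E [A]]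

/-- The queries of the elimination algorithm. -/
def inputQueries (pref : Preference) (x : REInput) : List (List Letter) :=
  x.flatMap fun d => goalQueries (removalMode pref x.outcome) x.outcome x.resources d.goal

/-- The evaluation of the answers. -/
def verdict (mode : Bool) : List Bool → Bool
  | a :: b :: l => (if mode then !a || b else !a && b) || verdict mode l
  | _ => false

theorem verdict_flatMap {ι : Type} (mode : Bool) (f g : ι → Bool) : ∀ l : List ι,
    verdict mode (l.flatMap fun i => [f i, g i]) = true ↔
      ∃ i ∈ l, (if mode then !f i || g i else !f i && g i) = true
  | [] => by simp [verdict]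
  | i :: l => by
      rw [List.flatMap_cons, List.cons_append, List.singleton_append, verdict, Bool.or_eq_true,
        verdict_flatMap mode f g l]
      simp

theorem isEliminationQuery_of_mem (pref : Preference) (x : REInput) (q : List Letter)
    (hq : q ∈ inputQueries pref x) : IsEliminationQuery pref x q := by
  simp only [inputQueries, List.mem_flatMap] at hq
  obtain ⟨d, hd, hq⟩ := hq
  obtain ⟨i, rfl⟩ := List.get_of_mem hd
  refine ⟨i, ?_⟩
  rw [goalQueries] at hq
  split at hq
  · next hm =>
    have hp : pref = .parsimonious := by
      cases pref
      · simp [removalMode] at hm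
      · rfl
    simp only [List.mem_flatMap, List.mem_cons, List.not_mem_nil, or_false] at hq
    obtain ⟨Γ, hΓ, rfl | rfl⟩ := hq
    · exact ⟨_, rfl, .inl (out_profile x).symm⟩
    · obtain ⟨A, hA, he⟩ := mem_removals _ _ _ hΓ
      refine ⟨_, rfl, .inr (.inr ⟨hp, A, ?_, ?_⟩)⟩
      · rw [out_profile]; exact hA
      · rw [out_profile, he, List.nil_append]
  · simp only [List.mem_cons, List.not_mem_nil, or_false] at hq
    rcases hq with rfl | rfl
    · exact ⟨_, rfl, .inl (out_profile x).symm⟩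
    · exact ⟨_, rfl, .inr (.inl (pool_game x).symm)⟩

open Classical in
theorem answers_inputQueries (LOG : ResourceLogic) (pref : Preference) (x : REInput) :
    verdict (removalMode pref x.outcome) (answers (SequentValidity LOG) (inputQueries pref x)) = true ↔
      ∃ d ∈ x, if removalMode pref x.outcome then
          ∃ Γ ∈ removals [] x.outcome, ¬ LOG.Proves x.outcome d.goal ∨ LOG.Proves Γ d.goal
        else ¬ LOG.Proves x.outcome d.goal ∧ LOG.Proves x.resources d.goal := by
  cases hm : removalMode pref x.outcome
  · have : answers (SequentValidity LOG) (inputQueries pref x) = x.flatMap fun d =>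
        [decide (LOG.Proves x.outcome d.goal), decide (LOG.Proves x.resources d.goal)] := by
      simp [inputQueries, goalQueries, hm, answers, List.map_flatMap, encodeSequent_mem_iff]
    rw [this, verdict_flatMap]
    simp
  -- The queries come in pairs, one pair for each goal together with each removal; flattening the
  -- two nested lists brings them into the form of `verdict_flatMap`.
  · have : answers (SequentValidity LOG) (inputQueries pref x) =
        (x.flatMap fun d => (removals [] x.outcome).map fun Γ => (d, Γ)).flatMap fun y =>
          [decide (LOG.Proves x.outcome y.1.goal), decide (LOG.Proves y.2 y.1.goal)] := by
      simp [inputQueries, goalQueries, hm, answers, List.map_flatMap, encodeSequent_mem_iff,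
        List.flatMap_assoc, List.flatMap_map]
    rw [this, verdict_flatMap]
    simp only [List.mem_flatMap, List.mem_map, if_true, Bool.or_eq_true, Bool.not_eq_true',
      decide_eq_false_iff_not, decide_eq_true_iff]
    constructor
    · rintro ⟨_, ⟨d, hd, Γ, hΓ, rfl⟩, h⟩
      exact ⟨d, hd, Γ, hΓ, h⟩
    · rintro ⟨d, hd, Γ, hΓ, h⟩
      exact ⟨(d, Γ), ⟨d, hd, Γ, hΓ, rfl⟩, h⟩

/-- In removal mode the comparison with the pool is dispensable: if the outcome does not prove the
goal, then removing any of its formulas is already preferred, and the outcome is not empty. With an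
empty outcome nothing can be removed, and only the comparison with the pool remains. -/
theorem rationallyEliminable_iff_verdict {LOG : ResourceLogic} (hLOG : LOG.Affine)
    (pref : Preference) (x : REInput) (hx : x.Legal LOG) :
    RationallyEliminable LOG pref (REInput.game x) (REInput.profile x) ↔
      verdict (removalMode pref x.outcome) (answers (SequentValidity LOG) (inputQueries pref x)) =
        true := by
  rw [rationallyEliminable_iff hLOG pref hx.1 hx.2, eliminationTest_iff hLOG pref hx.1 hx.2,
    answers_inputQueries, out_profile, pool_game]
  have hex : (∃ d ∈ x, if removalMode pref x.outcome then
        ∃ Γ ∈ removals [] x.outcome, ¬ LOG.Proves x.outcome d.goal ∨ LOG.Proves Γ d.goal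
      else ¬ LOG.Proves x.outcome d.goal ∧ LOG.Proves x.resources d.goal) ↔
      ∃ i : Fin x.length, if removalMode pref x.outcome then
        ∃ Γ ∈ removals [] x.outcome, ¬ LOG.Proves x.outcome (x.get i).goal ∨
          LOG.Proves Γ (x.get i).goal
      else ¬ LOG.Proves x.outcome (x.get i).goal ∧ LOG.Proves x.resources (x.get i).goal := by
    constructor
    · rintro ⟨d, hd, h⟩
      obtain ⟨i, rfl⟩ := List.get_of_mem hd
      exact ⟨i, h⟩
    · rintro ⟨i, h⟩
      exact ⟨_, List.get_mem x i, h⟩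
  rw [hex]
  refine exists_congr fun i => ?_
  change (¬ LOG.Proves x.outcome (x.get i).goal ∧ LOG.Proves x.resources (x.get i).goal) ∨ _ ↔ _
  cases pref with
  | dichotomous => simp [removalMode, REInput.game]
  | parsimonious =>
    rcases hO : x.outcome with _ | ⟨A, O⟩
    · simp [removalMode]
    · simp only [removalMode, List.isEmpty_cons, Bool.not_false, if_true, true_and]
      constructor
      · rintro (⟨h, -⟩ | ⟨B, hB, h⟩)
        -- Any removal would do, since the outcome fails to prove the goal; `O` arises by removing
        -- the head.
        · exact ⟨O, by simp [removals], .inl h⟩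
        · obtain ⟨Γ, hΓ, he⟩ := exists_mem_removals (A :: O) [] B hB
          refine ⟨Γ, hΓ, h.imp id fun h => ?_⟩
          rw [he]
          exact h
      · rintro ⟨Γ, hΓ, h⟩
        obtain ⟨B, hB, he⟩ := mem_removals _ _ _ hΓ
        rw [he] at h
        exact .inr ⟨B, hB, h⟩

end Queries

end RG

namespace RG

/-! ### Recognizing the encodings of inputs -/

section Parser

/-- The parser expects a new formula, is inside a formula, is inside the name of an atom, has just
read a formula, or has found an error. -/
inductive Status
  | idle | opened | bits | full | bad
  deriving DecidableEq

instance : Fintype Status := ⟨{.idle, .opened, .bits, .full, .bad}, fun s => by cases s <;> decide⟩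

/-- The part of the data of a player that is being read. -/
inductive Phase
  | goal | endowment | contribution
  deriving DecidableEq

instance : Fintype Phase := ⟨{.goal, .endowment, .contribution}, fun p => by cases p <;> decide⟩

def Phase.next : Phase → Phase
  | .goal => .endowment
  | .endowment => .contribution
  | .contribution => .goal

/-- The ways in which a letter changes the number of the formulas that are to be read. -/
inductive Action
  | branch
  | close
  | go (s : Status) (p : Phase)
  deriving DecidableEq

/-- The action for a letter at the beginning of a formula. -/
def openAction (conn : Connective → Bool) (p : Phase) : Letter → Action
  | .conn c =>
    if conn c then
      match c with
      | .one | .bot | .top | .zero => .close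
      | .neg => .go .opened p
      | .tensor | .par | .lolli | .amp | .plus => .branch
    else .go .bad p
  | .bit _ => .go .bits p
  | .dot => .close
  | .comma | .turnstile | .semicolon => .go .bad p

/-- The action of the parser. -/
def action (conn : Connective → Bool) (s : Status) (p : Phase) (a : Letter) : Action :=
  match s with
  | .idle => if a = .semicolon ∧ p ≠ .goal then .go .idle p.next else openAction conn p a
  | .opened => openAction conn p a
  | .bits =>
    match a with
    | .bit _ => .go .bits p
    | .dot => .close
    | _ => .go .bad p
  | .full =>
    if a = .comma ∧ p ≠ .goal then .go .idle p
    else if a = .semicolon ∧ p = .goal then .go .idle p.next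
    else .go .bad p
  | .bad => .go .bad p

/-- The state of the parser; `more` formulas are to be read after the present one. -/
structure ParserState where
  status : Status
  phase : Phase
  more : ℕ

def ParserState.step (conn : Connective → Bool) (s : ParserState) (a : Letter) : ParserState :=
  match action conn s.status s.phase a with
  | .branch => ⟨.opened, s.phase, s.more + 1⟩
  | .close => ⟨if s.more = 0 then .full else .opened, s.phase, s.more - 1⟩
  | .go t p => ⟨t, p, s.more⟩

/-- The parser accepts the word from the given state. -/
def ParserState.Accepts (conn : Connective → Bool) (s : ParserState) (w : List Letter) : Prop :=
  (w.foldl (step conn) s).status = .idle ∧ (w.foldl (step conn) s).phase = .goal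

variable {conn : Connective → Bool}

open ParserState

/-- The formulas of the language given by `conn`. -/
abbrev Formula.Uses (conn : Connective → Bool) (A : Formula) : Prop := A.Over {c | conn c = true}

theorem ParserState.foldl_bad (p : Phase) (n : ℕ) (w : List Letter) :
    w.foldl (step conn) ⟨.bad, p, n⟩ = ⟨.bad, p, n⟩ := by
  induction w with
  | nil => rfl
  | cons a w ih => exact ih

theorem ParserState.not_accepts_bad (p : Phase) (n : ℕ) (w : List Letter) :
    ¬ Accepts conn ⟨.bad, p, n⟩ w := by
  rw [Accepts, foldl_bad]
  simp

theorem accepts_cons {s : ParserState} {a : Letter} {w : List Letter} :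
    Accepts conn s (a :: w) ↔ Accepts conn (s.step conn a) w := Iff.rfl

/-- After a formula has been read. -/
def ParserState.closed (p : Phase) (n : ℕ) : ParserState :=
  ⟨if n = 0 then .full else .opened, p, n - 1⟩

theorem foldl_bits (p : Phase) (n : ℕ) (v : List Bool) :
    (v.map Letter.bit).foldl (step conn) ⟨.bits, p, n⟩ = ⟨.bits, p, n⟩ := by
  induction v with
  | nil => rfl
  | cons b v ih => exact ih

/-- A binary connective makes one more formula pending, namely its second argument, and the end of
an atom or a unit passes on to the next pending one. Over a whole formula this amounts to finishing
just the present formula. -/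
theorem foldl_encodeFormula : ∀ (A : Formula) (p : Phase) (n : ℕ) (s : Status), A.Uses conn →
    s = .idle ∨ s = .opened → (encodeFormula A).foldl (step conn) ⟨s, p, n⟩ = closed p n := by
  have binary : ∀ (c : Connective) (A B : Formula) (p : Phase) (n : ℕ) (s : Status),
      openAction conn p (.conn c) = .branch → s = .idle ∨ s = .opened →
      (∀ n, (encodeFormula A).foldl (step conn) ⟨.opened, p, n⟩ = closed p n) →
      (∀ n, (encodeFormula B).foldl (step conn) ⟨.opened, p, n⟩ = closed p n) →
      (Letter.conn c :: (encodeFormula A ++ encodeFormula B)).foldl (step conn) ⟨s, p, n⟩ =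
        closed p n := by
    intro c A B p n s hc hs hA hB
    have : step conn ⟨s, p, n⟩ (.conn c) = ⟨.opened, p, n + 1⟩ := by
      rcases hs with rfl | rfl <;> simp [step, action, hc]
    rw [List.foldl_cons, this, List.foldl_append, hA]
    exact hB n
  intro A
  induction A with
  | atom v =>
    intro p n s _ hs
    cases v with
    | nil => rcases hs with rfl | rfl <;> rfl
    | cons b v =>
      have : step conn ⟨s, p, n⟩ (.bit b) = ⟨.bits, p, n⟩ := by rcases hs with rfl | rfl <;> rfl
      rw [encodeFormula, List.map_cons, List.cons_append, List.foldl_cons, this, List.foldl_append,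
        foldl_bits]
      rfl
  | one | bot | top | zero =>
    intro p n s h hs
    simp only [Formula.Over, Set.mem_ofPred_eq] at h
    rcases hs with rfl | rfl <;> simp [encodeFormula, step, action, openAction, h, closed]
  | neg A ih =>
    intro p n s h hs
    simp only [Formula.Over, Set.mem_ofPred_eq] at h
    have : step conn ⟨s, p, n⟩ (.conn .neg) = ⟨.opened, p, n⟩ := by
      rcases hs with rfl | rfl <;> simp [step, action, openAction, h.1]
    rw [encodeFormula, List.foldl_cons, this]
    exact ih p n _ h.2 (.inr rfl)
  | tensor A B ihA ihB | par A B ihA ihB | lolli A B ihA ihB | amp A B ihA ihB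
  | plus A B ihA ihB =>
    intro p n s h hs
    simp only [Formula.Over, Set.mem_ofPred_eq] at h
    exact binary _ A B p n s (by simp [openAction, h.1]) hs
      (fun n => ihA p n _ h.2.1 (.inr rfl)) fun n => ihB p n _ h.2.2 (.inr rfl)

theorem foldl_encodeFormulas {p : Phase} (hp : p ≠ .goal) : ∀ Γ : List Formula,
    (∀ A ∈ Γ, A.Uses conn) → (encodeFormulas Γ).foldl (step conn) ⟨.idle, p, 0⟩ = ⟨.idle, p, 0⟩
  | [], _ => rfl
  | A :: Γ, h => by
      rw [encodeFormulas_cons, List.foldl_append, foldl_encodeFormula A p 0 _ (h A (by simp))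
        (.inl rfl), List.foldl_cons]
      have : step conn (closed p 0) .comma = ⟨.idle, p, 0⟩ := by simp [step, action, closed, hp]
      rw [this]
      exact foldl_encodeFormulas hp Γ fun B hB => h B (by simp [hB])

/-- All formulas of the input belong to the language given by `conn`. -/
def REInput.Uses (conn : Connective → Bool) (x : REInput) : Prop :=
  ∀ d ∈ x, d.goal.Uses conn ∧ (∀ A ∈ d.endowment, A.Uses conn) ∧ ∀ A ∈ d.contribution, A.Uses conn

/-- The encoding of the data of one player. -/
def encodePlayer (d : PlayerData) : List Letter :=
  encodeFormula d.goal ++ .semicolon :: (encodeFormulas d.endowment ++ .semicolon ::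
    (encodeFormulas d.contribution ++ [.semicolon]))

theorem encodeInput_cons (d : PlayerData) (x : REInput) :
    encodeInput (d :: x) = encodePlayer d ++ encodeInput x := rfl

theorem foldl_encodeInput : ∀ x : REInput, x.Uses conn →
    (encodeInput x).foldl (step conn) ⟨.idle, .goal, 0⟩ = ⟨.idle, .goal, 0⟩
  | [], _ => rfl
  | d :: x, h => by
      obtain ⟨h₁, h₂, h₃⟩ := h d (by simp)
      have e₁ : step conn (closed .goal 0) .semicolon = ⟨.idle, .endowment, 0⟩ := rfl
      have e₂ : step conn ⟨.idle, .endowment, 0⟩ .semicolon = ⟨.idle, .contribution, 0⟩ := rfl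
      have e₃ : step conn ⟨.idle, .contribution, 0⟩ .semicolon = ⟨.idle, .goal, 0⟩ := rfl
      rw [encodeInput_cons, encodePlayer, List.foldl_append, List.foldl_append,
        foldl_encodeFormula _ _ _ _ h₁ (.inl rfl), List.foldl_cons, e₁, List.foldl_append,
        foldl_encodeFormulas (by simp) _ h₂, List.foldl_cons, e₂, List.foldl_append,
        foldl_encodeFormulas (by simp) _ h₃, List.foldl_cons, e₃]
      exact foldl_encodeInput x fun d' hd' => h d' (by simp [hd'])

/-- The word begins with `n` formulas, and the parser accepts the rest. -/
def AcceptsFormulas (conn : Connective → Bool) (p : Phase) (n : ℕ) (w : List Letter) : Prop :=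
  ∃ (l : List Formula) (r : List Letter), l.length = n ∧ (∀ A ∈ l, A.Uses conn) ∧
    w = l.flatMap encodeFormula ++ r ∧ Accepts conn ⟨.full, p, 0⟩ r

theorem acceptsFormulas_closed {p : Phase} {n : ℕ} {w : List Letter}
    (ih : ∀ n, Accepts conn ⟨.opened, p, n⟩ w → AcceptsFormulas conn p (n + 1) w)
    (h : Accepts conn (closed p n) w) : AcceptsFormulas conn p n w := by
  cases n with
  | zero => exact ⟨[], w, rfl, by simp, by simp, h⟩
  | succ n => exact ih n h

theorem AcceptsFormulas.cons {p : Phase} {n : ℕ} {w : List Letter} {A : Formula}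
    (hA : A.Uses conn) : AcceptsFormulas conn p n w →
      AcceptsFormulas conn p (n + 1) (encodeFormula A ++ w) := by
  rintro ⟨l, r, hl, hu, rfl, hr⟩
  exact ⟨A :: l, r, by simp [hl], by simpa using ⟨hA, hu⟩, by simp, hr⟩

/-- The converse of `foldl_encodeFormula`: together with `n` pending formulas the present one makes
`n + 1`. The claim about names of atoms is proved in the same induction on the word. -/
theorem acceptsFormulas_of_accepts (p : Phase) : ∀ w : List Letter,
    (∀ n, Accepts conn ⟨.opened, p, n⟩ w → AcceptsFormulas conn p (n + 1) w) ∧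
    (∀ n, Accepts conn ⟨.bits, p, n⟩ w → ∃ (v : List Bool) (r : List Letter), w = v.map Letter.bit ++ .dot :: r ∧
      AcceptsFormulas conn p n r)
  | [] => ⟨fun n h => by simp [Accepts] at h, fun n h => by simp [Accepts] at h⟩
  | a :: w => by
      obtain ⟨ih₁, ih₂⟩ := acceptsFormulas_of_accepts p w
      have unary : ∀ (A : Formula) (n : ℕ), A.Uses conn → encodeFormula A = [a] →
          Accepts conn (closed p n) w → AcceptsFormulas conn p (n + 1) (a :: w) := by
        intro A n hA he h
        have := (acceptsFormulas_closed ih₁ h).cons hA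
        rwa [he] at this
      have binary : ∀ (mk : Formula → Formula → Formula) (n : ℕ),
          (∀ A B, A.Uses conn → B.Uses conn → (mk A B).Uses conn) →
          (∀ A B, encodeFormula (mk A B) = a :: (encodeFormula A ++ encodeFormula B)) →
          Accepts conn ⟨.opened, p, n + 1⟩ w → AcceptsFormulas conn p (n + 1) (a :: w) := by
        intro mk n hmk he h
        -- Of the `n + 2` formulas that follow the connective, the first two become its arguments.
        obtain ⟨l, r, hl, hu, rfl, hr⟩ := ih₁ _ h
        obtain ⟨A, l, rfl⟩ := List.exists_cons_of_length_eq_add_one hl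
        obtain ⟨B, l, rfl⟩ := List.exists_cons_of_length_eq_add_one (Nat.succ.inj hl)
        simp only [List.mem_cons, forall_eq_or_imp] at hu
        refine ⟨mk A B :: l, r, by simpa using hl, ?_, ?_, hr⟩
        · simpa using ⟨hmk A B hu.1 hu.2.1, hu.2.2⟩
        · simp [he]
      constructor
      · intro n h
        rw [accepts_cons, step, action] at h
        cases a with
        | conn c =>
          simp only [openAction] at h
          cases hc : conn c
          · rw [hc] at h
            exact absurd h (not_accepts_bad _ _ _)
          · rw [hc] at h
            cases c with
            | one => exact unary .one n hc rfl h
            | bot => exact unary .bot n hc rfl h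
            | top => exact unary .top n hc rfl h
            | zero => exact unary .zero n hc rfl h
            | neg =>
              obtain ⟨l, r, hl, hu, rfl, hr⟩ := ih₁ n h
              obtain ⟨A, l, rfl⟩ := List.exists_cons_of_length_eq_add_one hl
              simp only [List.mem_cons, forall_eq_or_imp] at hu
              refine ⟨A.neg :: l, r, by simpa using hl, ?_, by simp [encodeFormula], hr⟩
              simpa [Formula.Over, hc] using hu
            | tensor => exact binary .tensor n (fun A B hA hB => ⟨hc, hA, hB⟩) (fun _ _ => rfl) h
            | par => exact binary .par n (fun A B hA hB => ⟨hc, hA, hB⟩) (fun _ _ => rfl) h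
            | lolli => exact binary .lolli n (fun A B hA hB => ⟨hc, hA, hB⟩) (fun _ _ => rfl) h
            | amp => exact binary .amp n (fun A B hA hB => ⟨hc, hA, hB⟩) (fun _ _ => rfl) h
            | plus => exact binary .plus n (fun A B hA hB => ⟨hc, hA, hB⟩) (fun _ _ => rfl) h
        | bit b =>
          obtain ⟨v, r, rfl, hr⟩ := ih₂ n h
          have := hr.cons (A := .atom (b :: v)) trivial
          simpa [encodeFormula] using this
        | dot => exact unary (.atom []) n trivial rfl h
        | comma | turnstile | semicolon => exact absurd h (not_accepts_bad _ _ _)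
      · intro n h
        rw [accepts_cons] at h
        cases a with
        | bit b =>
          obtain ⟨v, r, rfl, hr⟩ := ih₂ n h
          exact ⟨b :: v, r, rfl, hr⟩
        | dot => exact ⟨[], w, rfl, acceptsFormulas_closed ih₁ h⟩
        | conn _ | comma | turnstile | semicolon => exact absurd h (not_accepts_bad _ _ _)

theorem exists_formula_of_accepts {p : Phase} {w : List Letter}
    (h : Accepts conn ⟨.opened, p, 0⟩ w) :
    ∃ A r, A.Uses conn ∧ w = encodeFormula A ++ r ∧ Accepts conn ⟨.full, p, 0⟩ r := by
  obtain ⟨l, r, hl, hu, rfl, hr⟩ := (acceptsFormulas_of_accepts p w).1 0 h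
  obtain ⟨A, rfl⟩ := List.length_eq_one_iff.1 hl
  exact ⟨A, r, hu A (by simp), by simp, hr⟩

theorem accepts_idle_cons {p : Phase} {a : Letter} {w : List Letter}
    (ha : ¬ (a = .semicolon ∧ p ≠ .goal)) :
    Accepts conn ⟨.idle, p, 0⟩ (a :: w) ↔ Accepts conn ⟨.opened, p, 0⟩ (a :: w) := by
  simp only [accepts_cons, step, action, if_neg ha]

/-- The induction is on a bound for the length, because a whole formula is split off at once. -/
theorem exists_formulas_of_accepts {p : Phase} (hp : p ≠ .goal) : ∀ (n : ℕ) (w : List Letter),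
    w.length ≤ n → Accepts conn ⟨.idle, p, 0⟩ w → ∃ Γ r, (∀ A ∈ Γ, A.Uses conn) ∧
      w = encodeFormulas Γ ++ .semicolon :: r ∧ Accepts conn ⟨.idle, p.next, 0⟩ r
  | _, [], _, h => absurd h.2 hp
  | 0, _ :: _, hn, _ => by simp at hn
  | n + 1, a :: w, hn, h => by
      by_cases ha : a = .semicolon
      · subst ha
        refine ⟨[], w, by simp, rfl, ?_⟩
        simpa [accepts_cons, step, action, hp] using h
      · rw [accepts_idle_cons (by simp [ha])] at h
        obtain ⟨A, r, hA, hw, hr⟩ := exists_formula_of_accepts h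
        cases r with
        | nil => simp [Accepts] at hr
        | cons b r =>
          have hb : b = .comma := by
            by_contra hb
            simp only [accepts_cons, step, action, hb, hp, false_and, and_false, if_false] at hr
            exact not_accepts_bad _ _ _ hr
          subst hb
          have hlen := congrArg List.length hw
          simp only [List.length_cons, List.length_append] at hlen hn
          have hr' : Accepts conn ⟨.idle, p, 0⟩ r := by
            simpa [accepts_cons, step, action, hp] using hr
          obtain ⟨Γ, s, hΓ, rfl, hs⟩ := exists_formulas_of_accepts hp n r (by omega) hr'
          refine ⟨A :: Γ, s, ?_, ?_, hs⟩
          · simpa using ⟨hA, hΓ⟩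
          · rw [hw, encodeFormulas_cons]; simp

theorem exists_input_of_accepts : ∀ (n : ℕ) (w : List Letter), w.length ≤ n →
    Accepts conn ⟨.idle, .goal, 0⟩ w → ∃ x : REInput, x.Uses conn ∧ w = encodeInput x
  | _, [], _, _ => ⟨[], by simp [REInput.Uses], rfl⟩
  | 0, _ :: _, hn, _ => by simp at hn
  | n + 1, a :: w, hn, h => by
      rw [accepts_idle_cons (by simp)] at h
      obtain ⟨A, r, hA, hw, hr⟩ := exists_formula_of_accepts h
      cases r with
      | nil => simp [Accepts] at hr
      | cons b r =>
        have hb : b = .semicolon := by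
          by_contra hb
          simp [accepts_cons, step, action, hb] at hr
          exact not_accepts_bad _ _ _ hr
        subst hb
        have hr' : Accepts conn ⟨.idle, .endowment, 0⟩ r := hr
        obtain ⟨Γ, s, hΓ, rfl, hs⟩ := exists_formulas_of_accepts (by simp) _ r le_rfl hr'
        obtain ⟨Δ, t, hΔ, rfl, ht⟩ := exists_formulas_of_accepts (by simp [Phase.next]) _ s le_rfl hs
        have hlen := congrArg List.length hw
        simp only [List.length_cons, List.length_append] at hlen hn
        obtain ⟨x, hx, rfl⟩ := exists_input_of_accepts n t (by omega) ht
        refine ⟨⟨A, Γ, Δ⟩ :: x, ?_, ?_⟩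
        · intro d hd
          rcases List.mem_cons.1 hd with rfl | hd
          · exact ⟨hA, hΓ, hΔ⟩
          · exact hx d hd
        · rw [hw, encodeInput_cons, encodePlayer]; simp

/-- The parser recognizes the encodings of the inputs over the given language. -/
theorem accepts_iff (w : List Letter) :
    Accepts conn ⟨.idle, .goal, 0⟩ w ↔ ∃ x : REInput, x.Uses conn ∧ w = encodeInput x := by
  refine ⟨exists_input_of_accepts _ w le_rfl, ?_⟩
  rintro ⟨x, hx, rfl⟩
  rw [Accepts, foldl_encodeInput x hx]
  exact ⟨rfl, rfl⟩

theorem encodePlayer_append_inj (d d' : PlayerData) (r s : List Letter)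
    (h : encodePlayer d ++ r = encodePlayer d' ++ s) : d = d' ∧ r = s := by
  obtain ⟨A, Γ, Δ⟩ := d
  obtain ⟨A', Γ', Δ'⟩ := d'
  simp only [encodePlayer, List.append_assoc, List.cons_append, List.nil_append] at h
  obtain ⟨rfl, h₁⟩ := encodeFormula_append_inj _ _ _ _ h
  obtain ⟨rfl, h₂⟩ := encodeFormulas_append_inj (a := .semicolon) id _ _ _ _ (List.cons.inj h₁).2
  obtain ⟨rfl, h₃⟩ := encodeFormulas_append_inj (a := .semicolon) id _ _ _ _ h₂
  exact ⟨rfl, h₃⟩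

theorem encodeInput_injective : Function.Injective encodeInput := by
  have hne : ∀ d x, encodeInput (d :: x) ≠ [] := by
    intro d x h
    have := congrArg List.length h
    simp [encodeInput_cons, encodePlayer] at this
  intro x
  induction x with
  | nil =>
    intro y h
    cases y with
    | nil => rfl
    | cons d y => exact absurd h.symm (hne d y)
  | cons d x ih =>
    intro y h
    cases y with
    | nil => exact absurd h (hne d x)
    | cons d' y =>
      rw [encodeInput_cons, encodeInput_cons] at h
      obtain ⟨rfl, h'⟩ := encodePlayer_append_inj _ _ _ _ h
      rw [ih h']

end Parser

end RG

namespace RG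

/-! ### A machine that writes the queries -/

section Machine

instance : Fintype Connective :=
  ⟨{.one, .bot, .top, .zero, .neg, .tensor, .par, .lolli, .amp, .plus}, fun c => by
    cases c <;> decide⟩

instance : Fintype Letter :=
  Fintype.ofSurjective (fun x : Connective ⊕ Bool ⊕ Fin 4 => match x with
    | .inl c => .conn c
    | .inr (.inl b) => .bit b
    | .inr (.inr 0) => .dot
    | .inr (.inr 1) => .comma
    | .inr (.inr 2) => .turnstile
    | .inr (.inr 3) => Letter.semicolon) fun a => by
    cases a with
    | conn c => exact ⟨.inl c, rfl⟩
    | bit b => exact ⟨.inr (.inl b), rfl⟩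
    | dot => exact ⟨.inr (.inr 0), rfl⟩
    | comma => exact ⟨.inr (.inr 1), rfl⟩
    | turnstile => exact ⟨.inr (.inr 2), rfl⟩
    | semicolon => exact ⟨.inr (.inr 3), rfl⟩

/-- The stacks besides the input stack: the output and its reversal, the input and its reversal, a
counter, a formula and its reversal, an endowment and its reversal, the pool, the outcome, its parts
before and after a formula, that formula, a second copy of the outcome and its reversal, a goal, and
an auxiliary stack. -/
inductive Stack
  | out | outRev | word | wordRev | counter | item | itemRev | stock | stockRev
  | pool | outcome | before | after | removed | copy | copyRev | goal | aux
  deriving DecidableEq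

instance : Fintype Stack :=
  ⟨{.out, .outRev, .word, .wordRev, .counter, .item, .itemRev, .stock, .stockRev, .pool, .outcome,
    .before, .after, .removed, .copy, .copyRev, .goal, .aux}, fun k => by cases k <;> decide⟩

/-- Apart from the input stack there is an additional letter `none`. It separates the words of the
output, serves as the unit of the unary counter and marks formulas of the stock that are crossed
out. -/
abbrev Sym : Option Stack → Type
  | none => Letter
  | some _ => Option Letter

/-- The internal state. -/
structure Control where
  cur : Option (Option Letter)
  saved : Option (Option Letter)
  status : Status
  phase : Phase
  nonempty : Bool
  ok : Bool
  equal : Bool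
  found : Bool

noncomputable instance : Fintype Control :=
  Fintype.ofInjective (fun v => (v.cur, v.saved, v.status, v.phase, v.nonempty, v.ok, v.equal,
    v.found)) fun v v' h => by
    cases v
    cases v'
    simpa using h

/-- The internal state and the stacks. -/
structure Store extends Control where
  inp : List Letter
  out : List (Option Letter)
  outRev : List (Option Letter)
  word : List (Option Letter)
  wordRev : List (Option Letter)
  counter : List (Option Letter)
  item : List (Option Letter)
  itemRev : List (Option Letter)
  stock : List (Option Letter)
  stockRev : List (Option Letter)
  pool : List (Option Letter)
  outcome : List (Option Letter)
  before : List (Option Letter)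
  after : List (Option Letter)
  removed : List (Option Letter)
  copy : List (Option Letter)
  copyRev : List (Option Letter)
  goal : List (Option Letter)
  aux : List (Option Letter)

namespace Store

def stack (d : Store) : ∀ k : Option Stack, List (Sym k)
  | none => d.inp
  | some .out => d.out
  | some .outRev => d.outRev
  | some .word => d.word
  | some .wordRev => d.wordRev
  | some .counter => d.counter
  | some .item => d.item
  | some .itemRev => d.itemRev
  | some .stock => d.stock
  | some .stockRev => d.stockRev
  | some .pool => d.pool
  | some .outcome => d.outcome
  | some .before => d.before
  | some .after => d.after
  | some .removed => d.removed
  | some .copy => d.copy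
  | some .copyRev => d.copyRev
  | some .goal => d.goal
  | some .aux => d.aux

def setStack (d : Store) : ∀ k : Option Stack, List (Sym k) → Store
  | none, l => { d with inp := l }
  | some .out, l => { d with out := l }
  | some .outRev, l => { d with outRev := l }
  | some .word, l => { d with word := l }
  | some .wordRev, l => { d with wordRev := l }
  | some .counter, l => { d with counter := l }
  | some .item, l => { d with item := l }
  | some .itemRev, l => { d with itemRev := l }
  | some .stock, l => { d with stock := l }
  | some .stockRev, l => { d with stockRev := l }
  | some .pool, l => { d with pool := l }
  | some .outcome, l => { d with outcome := l }
  | some .before, l => { d with before := l }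
  | some .after, l => { d with after := l }
  | some .removed, l => { d with removed := l }
  | some .copy, l => { d with copy := l }
  | some .copyRev, l => { d with copyRev := l }
  | some .goal, l => { d with goal := l }
  | some .aux, l => { d with aux := l }

end Store

/-- Letters of the input are wrapped in `some`, so that `cur` has one type for all stacks; its outer
`none` records that the stack was empty. -/
def Control.store : (k : Option Stack) → Control → Option (Sym k) → Control
  | none, v, o => { v with cur := o.map some }
  | some _, v, o => { v with cur := o }

def model : Model Sym Control Store where
  var := Store.toControl
  stk := Store.stack
  setVar d v := { d with toControl := v }
  set := Store.setStack
  rd := Control.store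
  got v := v.cur.isSome
  ext' d d' hv hs := by
    have h := fun k => congrFun hs k
    obtain ⟨v, inp, out, outRev, word, wordRev, counter, item, itemRev, stock, stockRev, pool,
      outcome, before, after, removed, copy, copyRev, goal, aux⟩ := d
    have h₀ := h none
    have h₁ := h (some .out)
    have h₂ := h (some .outRev)
    have h₃ := h (some .word)
    have h₄ := h (some .wordRev)
    have h₅ := h (some .counter)
    have h₆ := h (some .item)
    have h₇ := h (some .itemRev)
    have h₈ := h (some .stock)
    have h₉ := h (some .stockRev)
    have k₀ := h (some .pool)
    have k₁ := h (some .outcome)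
    have k₂ := h (some .before)
    have k₃ := h (some .after)
    have k₄ := h (some .removed)
    have k₅ := h (some .copy)
    have k₆ := h (some .copyRev)
    have k₇ := h (some .goal)
    have k₈ := h (some .aux)
    simp only [Store.stack] at hv h₀ h₁ h₂ h₃ h₄ h₅ h₆ h₇ h₈ h₉ k₀ k₁ k₂ k₃ k₄ k₅ k₆ k₇ k₈
    subst hv h₀ h₁ h₂ h₃ h₄ h₅ h₆ h₇ h₈ h₉ k₀ k₁ k₂ k₃ k₄ k₅ k₆ k₇ k₈
    rfl
  var_setVar _ _ := rfl
  stk_setVar d v := by funext k; rcases k with _ | k <;> [rfl; (cases k <;> rfl)]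
  var_set d k l := by rcases k with _ | k <;> [rfl; (cases k <;> rfl)]
  stk_set d k l := by
    funext j
    rcases eq_or_ne j k with rfl | h
    · rw [Function.update_self]
      rcases j with _ | j <;> [rfl; (cases j <;> rfl)]
    · rw [Function.update_of_ne h]
      rcases k with _ | k <;> rcases j with _ | j <;>
        [exact absurd rfl h; (cases j <;> rfl); (cases k <;> rfl);
          (cases k <;> cases j <;> first | rfl | exact absurd rfl h)]
  got_rd k v o := by cases k <;> cases o <;> rfl

end Machine

/-! ### The programs of the query writer -/

namespace Writer

open LProg

abbrev Program := LProg Sym Control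

/-- The letter that was popped last. -/
def current (v : Control) : Option Letter := v.cur.getD none

def isLetter (a : Letter) (v : Control) : Bool := v.cur = some (some a)

def skip : Program := load id

/-- Move a stack to another stack, in reverse order. -/
def move (k k' : Stack) : Program := loop (some k) (push (some k') current)

def empty (k : Stack) : Program := loop (some k) skip

/-- Forget the letter that was popped last and the saved letter. -/
def forget : Program := load fun v => { v with cur := none, saved := none }

/-- The action of the parser for the letter that was popped last. -/
def nextAction (conn : Connective → Bool) (v : Control) : Action :=
  match v.cur with
  | some (some a) => action conn v.status v.phase a
  | _ => .go v.status v.phase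

def followAction (conn : Connective → Bool) (v : Control) : Control :=
  match nextAction conn v with
  | .go s p => { v with status := s, phase := p }
  | _ => v

/-- The number of pending formulas is kept in unary on `counter`. When a formula closes, popping the
counter both decreases it and tells whether it was zero. The letters are saved on `wordRev` for the
next pass. -/
def parseLetter (conn : Connective → Bool) : Program :=
  seq (push (some .wordRev) current) <|
    ite (fun v => nextAction conn v = .branch)
      (seq (push (some .counter) fun _ => none) (load fun v => { v with status := .opened })) <|
    ite (fun v => nextAction conn v = .close)
      (seq (pop (some .counter))
        (load fun v => { v with status := if v.cur.isSome then .opened else .full }))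
      (load (followAction conn))

/-- Parse the input. -/
def parse (conn : Connective → Bool) : Program := seq (loop none (parseLetter conn)) forget

/-- Compare a formula with the present formula of the stock, and cross out the latter if it is the
first one that equals the former. -/
def compareLetter : Program :=
  seq (load fun v => { v with saved := v.cur }) <|
    ite (fun v => v.cur = some none || v.cur = some (some .comma))
      -- The end mark of the entry has been reached; letters left on `item` show that the formula is
      -- longer than the entry.
      (seq (loop (some .item) (seq (push (some .itemRev) current)
          (load fun v => { v with equal := false })))
        -- The end mark is still a comma only if the entry has not been crossed out, and `found`
        -- excludes all matches but the first.
        (seq (load fun v => 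
            { v with equal := v.saved = some (some .comma) && (v.equal && !v.found) })
          (seq (push (some .stockRev) fun v => if v.equal then none else v.saved.getD none)
            (seq (load fun v => { v with found := v.found || v.equal, equal := true })
              (move .itemRev .item)))))
      (seq (push (some .stockRev) current)
        (seq (shift (some .item) (some .itemRev) current)
          (load fun v => { v with equal := v.equal && v.cur = v.saved })))

/-- Cross out a formula in the stock. -/
def takeItem : Program :=
  seq (move .itemRev .item) <| seq (loop (some .stock) compareLetter) <|
    seq (load fun v => { v with ok := v.ok && v.found, found := false }) <|
      seq (empty .item) (move .stockRev .stock)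

/-- The contributions are collected on three stacks: `outcome` is written in full for every removal,
`before` is later split at the removed formula, and `copyRev` supplies the stack that drives the
loop over the removals. -/
def checkLetter : Program :=
  seq (push (some .wordRev) current) <|
    ite (isLetter .semicolon)
      (seq
        (ite (fun v => v.phase = .endowment) (move .stockRev .stock) <|
          ite (fun v => v.phase = .contribution) (empty .stock) skip)
        (load fun v => { v with phase := v.phase.next }))
      (ite (fun v => v.phase = .goal) skip <|
        ite (fun v => v.phase = .endowment)
          (seq (push (some .stockRev) current) (push (some .pool) current)) <|
        seq (push (some .outcome) current) <| seq (push (some .before) current) <|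
          seq (push (some .copyRev) current) <| seq (load fun v => { v with nonempty := true }) <|
            ite (isLetter .comma) takeItem (push (some .itemRev) current))

/-- Check that the contributions are contained in the endowments, and collect the pool and the
outcome. -/
def check : Program := seq (loop (some .word) checkLetter) forget

/-- Write the content of a stack. -/
def write (k : Stack) : Program :=
  seq (move k .aux) (loop (some .aux) (seq (push (some k) current) (push (some .outRev) current)))

/-- Write the content of a stack in reverse order. -/
def writeRev (k : Stack) : Program :=
  seq (loop (some k) (seq (push (some .aux) current) (push (some .outRev) current))) (move .aux k)

/-- Write the right side of a sequent. -/
def writeGoal : Program :=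
  seq (push (some .outRev) fun _ => some .turnstile) <| seq (write .goal) <|
    seq (push (some .outRev) fun _ => some .comma) (push (some .outRev) fun _ => none)

/-- Write the queries for the outcome minus one formula. -/
def writeRemoval : Program :=
  seq (write .outcome) <| seq writeGoal <| seq (write .before) <| seq (writeRev .after) <|
    seq writeGoal <| seq (move .removed .aux) (move .aux .before)

/-- A loop must not touch the stack that drives it, and the body works on `after`. Therefore the
loop runs on `copy`, which holds the same letters, and `after` is consumed in parallel. -/
def removalLetter : Program :=
  seq (push (some .copyRev) current) <| seq (shift (some .after) (some .removed) current) <|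
    ite (isLetter .comma) writeRemoval skip

/-- Write the queries for one goal. -/
def writeQueries (mode : Bool → Bool) : Program :=
  ite (fun v => mode v.nonempty)
    (seq (move .before .after) <| seq (move .copyRev .copy) (loop (some .copy) removalLetter))
    (seq (write .outcome) <| seq writeGoal <| seq (write .pool) writeGoal)

def queryLetter (mode : Bool → Bool) : Program :=
  ite (isLetter .semicolon)
    (seq (ite (fun v => v.phase = .goal) (seq (writeQueries mode) (empty .goal)) skip)
      (load fun v => { v with phase := v.phase.next }))
    (ite (fun v => v.phase = .goal) (push (some .goal) current) skip)

/-- The mode, depending on whether the outcome is nonempty. -/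
def mode (pref : Preference) (nonempty : Bool) : Bool :=
  match pref with
  | .dichotomous => false
  | .parsimonious => nonempty

/-- Write the queries in reverse order. -/
def main (conn : Connective → Bool) (pref : Preference) : Program :=
  seq (parse conn) <|
    ite (fun v => v.status = .idle && v.phase = .goal)
      (seq (move .wordRev .word) <| seq check <|
        ite (fun v => v.ok)
          (seq (move .wordRev .word) (loop (some .word) (queryLetter (mode pref)))) skip)
      skip

/-- The output is exempt from the bounds on growth. The body of a loop may thus write as much as it
likes, as long as each pass adds at most a constant to the stacks that drive loops. -/
def working : Option Stack → Bool
  | some .out | some .outRev => false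
  | _ => true

theorem wf_main (conn : Connective → Bool) (pref : Preference) :
    (main conn pref).wf working = true := rfl

/-- The final reversal is driven by `outRev`, which is not a working stack, so the two parts are
bounded with respect to different sets of stacks. -/
theorem polyRun_main (conn : Connective → Bool) (pref : Preference) :
    PolyRun model (fun _ => true) ((main conn pref).seq (move .outRev .out)) :=
  ((polyRun model working _ (wf_main conn pref)).mono model working fun _ _ => rfl).seq model _
    (polyRun model _ _ rfl)

end Writer

end RG

namespace RG

/-! ### Effects of the basic programs -/

namespace Writer

open LProg

theorem den_of_true {c : Control → Bool} {p q : Program} {d : Store} (h : c d.toControl = true) :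
    (ite c p q).den model d = p.den model d := if_pos h

theorem den_of_false {c : Control → Bool} {p q : Program} {d : Store} (h : c d.toControl = false) :
    (ite c p q).den model d = q.den model d := if_neg (by rw [Bool.not_eq_true]; exact h)

theorem den_seq (p q : Program) (d : Store) :
    (p.seq q).den model d = q.den model (p.den model d) := rfl

theorem den_move (k k' : Stack) (d : Store) :
    (move k k').den model d = model.read (some k) none (model.set (model.set d (some k')
      ((model.stk d (some k)).reverse ++ model.stk d (some k'))) (some k) []) := by
  have hf : ∀ (s : List (Option Letter)) (d : Store), model.read (some k) none
      (s.foldl (fun d a => (push (some k') current : Program).den model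
        (model.read (some k) (some a) d)) d) =
      model.read (some k) none (model.set d (some k') (s.reverse ++ model.stk d (some k'))) := by
    intro s
    induction s with
    | nil => intro d; exact congrArg _ (model.set_stk d (some k')).symm
    | cons a s ih =>
      intro d
      rw [List.foldl_cons, ih, den, model.set_set, model.stk_set_self, model.stk_read]
      simp only [model.read_set, List.reverse_cons, List.append_assoc]
      rfl
  rw [move, den, model.read_set, hf, ← model.read_set]

theorem den_empty (k : Stack) (d : Store) :
    (empty k).den model d = model.read (some k) none (model.set d (some k) []) := by
  have hf : ∀ (s : List (Option Letter)) (d : Store), model.read (some k) none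
      (s.foldl (fun d a => skip.den model (model.read (some k) (some a) d)) d) =
      model.read (some k) none d := by
    intro s
    induction s with
    | nil => intro d; rfl
    | cons a s ih => intro d; rw [List.foldl_cons, ih]; rfl
  rw [empty, den, model.read_set, hf, ← model.read_set]

/-- Forget the letter that was popped last and the saved letter. -/
def erase (d : Store) : Store := { d with cur := none, saved := none }

/-- The effects of programs are computed up to `cur` and `saved`, whose values do not matter between
two letters. Here unknown values are put back, so that the next letter can be processed. -/
theorem exists_of_erase {d d' : Store} (h : erase d = erase d') :
    ∃ c s, d = { d' with cur := c, saved := s } :=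
  ⟨d.cur, d.saved, congrArg (fun e : Store => { e with cur := d.cur, saved := d.saved }) h⟩

theorem decide_some_eq_of_ne {a b : Letter} (h : a ≠ b) :
    decide (some (some a) = some (some b)) = false := by simpa using h

/-! ### The pass that parses the word -/

section parse

variable {conn : Connective → Bool}

theorem followAction_of {v : Control} {s : Status} {p : Phase}
    (h : nextAction conn v = .go s p) : followAction conn v = { v with status := s, phase := p } := by
  rw [followAction, h]

theorem den_parseLetter (d : Store) (s : ParserState) (a : Letter) :
    erase ((parseLetter conn).den model (model.read none (some a) { d with
        status := s.status, phase := s.phase, counter := List.replicate s.more none })) =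
    erase { d with
      status := (s.step conn a).status
      phase := (s.step conn a).phase
      counter := List.replicate (s.step conn a).more none
      wordRev := some a :: d.wordRev } := by
  rw [ParserState.step]
  rcases h : action conn s.status s.phase a with _ | _ | ⟨t, p⟩
  · rw [parseLetter, den, den_of_true (by exact decide_eq_true h)]
    rfl
  · rw [parseLetter, den, den_of_false (by exact decide_eq_false fun e => by cases h.symm.trans e),
      den_of_true (decide_eq_true (by exact h))]
    rcases s with ⟨t, p, _ | n⟩ <;> rfl
  · rw [parseLetter, den, den_of_false (by exact decide_eq_false fun e => by cases h.symm.trans e),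
      den_of_false (by exact decide_eq_false fun e => by cases h.symm.trans e), den,
      followAction_of (by exact h)]
    rfl

theorem den_parse (d : Store) (s : ParserState) (w : List Letter) :
    (parse conn).den model { d with
      inp := w, status := s.status, phase := s.phase, counter := List.replicate s.more none } =
    erase { d with
      inp := []
      status := (w.foldl (ParserState.step conn) s).status
      phase := (w.foldl (ParserState.step conn) s).phase
      counter := List.replicate (w.foldl (ParserState.step conn) s).more none
      wordRev := (w.map some).reverse ++ d.wordRev } := by
  have hf : ∀ (w : List Letter) (d : Store) (s : ParserState),
      erase (w.foldl (fun d a => (parseLetter conn).den model (model.read none (some a) d)) { d with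
        status := s.status, phase := s.phase, counter := List.replicate s.more none }) =
      erase { d with
        status := (w.foldl (ParserState.step conn) s).status
        phase := (w.foldl (ParserState.step conn) s).phase
        counter := List.replicate (w.foldl (ParserState.step conn) s).more none
        wordRev := (w.map some).reverse ++ d.wordRev } := by
    intro w
    induction w with
    | nil => intro d s; rfl
    | cons a w ih =>
      intro d s
      obtain ⟨c, v, hc⟩ := exists_of_erase (den_parseLetter d s a)
      rw [List.foldl_cons, hc, List.foldl_cons]
      refine (ih { d with wordRev := some a :: d.wordRev, cur := c, saved := v } (s.step conn a)).trans ?_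
      rw [List.map_cons, List.reverse_cons, List.append_assoc]
      rfl
  exact congrArg (fun d : Store => { d with inp := [] }) (hf w { d with inp := w } s)

end parse
end Writer
end RG

namespace RG

namespace Writer

open LProg

/-! ### Inclusion of the contributions in the endowments -/

/-- A stock: formulas, some of them crossed out. -/
def entries (l : List (Formula × Bool)) : List (Option Letter) :=
  l.flatMap fun e => (encodeFormula e.1).map some ++ [if e.2 then none else some .comma]

/-- Cross out the first remaining copy of `C`. -/
def cross (C : Formula) : List (Formula × Bool) → List (Formula × Bool)
  | [] => []
  | e :: l => if e = (C, false) then (C, true) :: l else e :: cross C l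

/-- The formulas that are not crossed out. -/
def remaining (l : List (Formula × Bool)) : Multiset Formula :=
  ((l.filter fun e => !e.2).map Prod.fst : List Formula)

theorem mem_remaining {C : Formula} {l : List (Formula × Bool)} :
    C ∈ remaining l ↔ (C, false) ∈ l := by
  simp [remaining]

theorem remaining_cross {C : Formula} : ∀ {l : List (Formula × Bool)}, (C, false) ∈ l →
    remaining (cross C l) = (remaining l).erase C
  | [], h => by simp at h
  | e :: l, h => by
      rw [cross]
      split
      · next he => simp [remaining, he]
      · next he =>
        have h : (C, false) ∈ l := (List.mem_cons.1 h).resolve_left fun e => he e.symm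
        have ih := remaining_cross h
        obtain ⟨A, _ | _⟩ := e
        · have hA : A ≠ C := fun h => he (by rw [h])
          have h₁ : ∀ l, remaining ((A, false) :: l) = A ::ₘ remaining l := fun l => by
            simp [remaining]
          rw [h₁, h₁, ih, Multiset.erase_cons_tail _ hA]
        · have h₁ : ∀ l, remaining ((A, true) :: l) = remaining l := fun l => by simp [remaining]
          rw [h₁, h₁, ih]

/-- Cross out formulas one after the other. -/
def crossAll : List Formula → List (Formula × Bool) → List (Formula × Bool)
  | [], l => l
  | C :: Δ, l => crossAll Δ (cross C l)

/-- All formulas can be crossed out one after the other. -/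
def covers : List Formula → List (Formula × Bool) → Bool
  | [], _ => true
  | C :: Δ, l => decide ((C, false) ∈ l) && covers Δ (cross C l)

/-- Crossing out greedily decides inclusion of multisets, since it is immaterial which of several
equal copies is used. -/
theorem covers_iff : ∀ (Δ : List Formula) (l : List (Formula × Bool)),
    covers Δ l = true ↔ (Δ : Multiset Formula) ≤ remaining l
  | [], l => by simp [covers]
  | C :: Δ, l => by
      rw [covers, Bool.and_eq_true, decide_eq_true_iff, covers_iff Δ, ← Multiset.cons_coe]
      constructor
      · rintro ⟨h, h'⟩
        rw [remaining_cross h] at h'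
        have := Multiset.cons_le_cons C h'
        rwa [Multiset.cons_erase (mem_remaining.2 h)] at this
      · intro h
        have hC := mem_remaining.1 (Multiset.mem_of_le h (Multiset.mem_cons_self _ _))
        refine ⟨hC, ?_⟩
        rw [remaining_cross hC]
        simpa using Multiset.erase_le_erase C h

theorem entries_coe (Γ : List Formula) :
    entries (Γ.map fun A => (A, false)) = (encodeFormulas Γ).map some := by
  simp [entries, encodeFormulas, List.flatMap_map, List.map_flatMap]

theorem remaining_coe (Γ : List Formula) : remaining (Γ.map fun A => (A, false)) = Γ := by
  simp [remaining, List.filter_map, Function.comp_def]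

theorem opens_of_mem_encodeFormula {a : Letter} : ∀ {A : Formula}, a ∈ encodeFormula A → a.Opens
  | .atom w, h => by
      simp only [encodeFormula, List.mem_append, List.mem_map, List.mem_singleton] at h
      rcases h with ⟨b, _, rfl⟩ | rfl <;> trivial
  | .one, h | .bot, h | .top, h | .zero, h => by
      rw [encodeFormula, List.mem_singleton] at h
      subst h
      trivial
  | .neg A, h => by
      rcases List.mem_cons.1 h with rfl | h
      · trivial
      · exact opens_of_mem_encodeFormula h
  | .tensor A B, h | .par A B, h | .lolli A B, h | .amp A B, h | .plus A B, h => by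
      rcases List.mem_cons.1 h with rfl | h
      · trivial
      · rcases List.mem_append.1 h with h | h
        · exact opens_of_mem_encodeFormula h
        · exact opens_of_mem_encodeFormula h

/-! ### Searching the stock for a formula -/

section takeItem

theorem den_compare_letter {a : Letter} (ha : a ≠ .comma) (d : Store) :
    erase (compareLetter.den model (model.read (some .stock) (some (some a)) d)) = erase { d with
      item := d.item.tail
      itemRev := d.item.head?.toList ++ d.itemRev
      stockRev := some a :: d.stockRev
      equal := d.equal && decide (d.item.head? = some (some a)) } := by
  have h : ∀ i : List (Option Letter), erase (compareLetter.den model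
      (model.read (some .stock) (some (some a)) { d with item := i })) = erase { d with
        item := i.tail
        itemRev := i.head?.toList ++ d.itemRev
        stockRev := some a :: d.stockRev
        equal := d.equal && decide (i.head? = some (some a)) } := by
    intro i
    rw [compareLetter, den, den_of_false (by simpa [den, model, Model.read, Control.store] using ha)]
    cases i <;> rfl
  exact h d.item

/-- For each letter of the entry one letter of the formula moves from `item` to `itemRev`. `take`
and `drop` also account for a formula that is shorter than the entry. -/
theorem foldl_compare_letters : ∀ (b : List Letter), (∀ a ∈ b, a ≠ .comma) → ∀ d : Store,
    erase ((b.map some).foldl (fun d a => compareLetter.den model (model.read (some .stock) (some a) d))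
      d) =
    erase { d with
      item := d.item.drop b.length
      itemRev := (d.item.take b.length).reverse ++ d.itemRev
      stockRev := (b.map some).reverse ++ d.stockRev
      equal := d.equal && decide (d.item.take b.length = b.map some) } := by
  intro b
  induction b with
  | nil => intro _ d; simp
  | cons a b ih =>
    intro hb d
    obtain ⟨ha, hb⟩ := List.forall_mem_cons.1 hb
    obtain ⟨c, s, h⟩ := exists_of_erase (den_compare_letter ha d)
    rw [List.map_cons, List.foldl_cons, h]
    refine (ih hb _).trans ?_
    cases hi : d.item with
    | nil => simp [erase]
    | cons x i =>
      simp [erase, Bool.and_assoc]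
      congr!

theorem foldl_unequal : ∀ (i : List (Option Letter)) (d : Store), ∃ c,
    i.foldl (fun d a => (seq (push (some .itemRev) current)
        (load fun v => { v with equal := false }) : Program).den model
          (model.read (some .item) (some a) d)) d =
    { d with itemRev := i.reverse ++ d.itemRev, equal := d.equal && i.isEmpty, cur := c } := by
  intro i
  induction i with
  | nil => exact fun d => ⟨d.cur, by simp⟩
  | cons a i ih =>
    intro d
    obtain ⟨c, h⟩ := ih ((seq (push (some .itemRev) current)
      (load fun v => { v with equal := false }) : Program).den model
        (model.read (some .item) (some a) d))
    refine ⟨c, h.trans ?_⟩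
    rw [List.reverse_cons, List.append_assoc, List.isEmpty_cons, Bool.and_false]
    rfl

/-- `u` tells whether the entry had been crossed out before. The two parts of the formula are put
together again on `item`, ready for the next entry. -/
theorem den_compare_close (d : Store) (u : Bool) :
    erase (compareLetter.den model (model.read (some .stock)
      (some (if u then none else some .comma)) d)) =
    erase { d with
      item := d.itemRev.reverse ++ d.item
      itemRev := []
      stockRev := (if u || (d.equal && d.item.isEmpty && !d.found) then none else some .comma) ::
        d.stockRev
      found := d.found || (!u && (d.equal && d.item.isEmpty && !d.found))
      equal := true } := by
  obtain ⟨c, h⟩ := foldl_unequal d.item { d with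
    cur := some (if u then none else some .comma), saved := some (if u then none else some .comma) }
  have h' : (loop (some .item) (seq (push (some .itemRev) current)
      (load fun v => { v with equal := false })) : Program).den model
        ((load fun v => { v with saved := v.cur } : Program).den model
          (model.read (some .stock) (some (if u then none else some .comma)) d)) = { d with
      item := []
      itemRev := d.item.reverse ++ d.itemRev
      equal := d.equal && d.item.isEmpty
      cur := none
      saved := some (if u then none else some .comma) } :=
    congrArg (fun d : Store => { d with item := [], cur := none }) h
  have h'' : (d.item.reverse ++ d.itemRev).reverse ++ [] = d.itemRev.reverse ++ d.item := by simp
  rw [compareLetter, den_seq, den_of_true (by cases u <;> rfl), den_seq, h', den_seq, den_seq, den_seq,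
    den_move, ← h'']
  cases u <;> rfl

theorem foldl_compare_entry (d : Store) (C : Formula) (e : Formula × Bool)
    (hi : d.item = (encodeFormula C).map some) (hr : d.itemRev = []) (he : d.equal = true) :
    erase (((encodeFormula e.1).map some ++ [if e.2 then none else some Letter.comma]).foldl
      (fun d a => compareLetter.den model (model.read (some .stock) (some a) d)) d) =
    erase { d with
      stockRev := (entries (if d.found then [e] else cross C [e])).reverse ++ d.stockRev
      found := d.found || decide (e = (C, false)) } := by
  obtain ⟨B, u⟩ := e
  obtain ⟨c, s, h⟩ := exists_of_erase (foldl_compare_letters (encodeFormula B)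
    (fun a ha h => by have := opens_of_mem_encodeFormula ha; rw [h] at this; exact this) d)
  rw [List.foldl_append, h, List.foldl_cons, List.foldl_nil]
  refine (den_compare_close _ u).trans ?_
  -- The words are equal if they agree over the length of the entry and nothing of the formula is
  -- left; injectivity of the encoding turns this into equality of formulas.
  have hq : (decide (d.item.take (encodeFormula B).length = (encodeFormula B).map some) &&
      (d.item.drop (encodeFormula B).length).isEmpty) = decide (B = C) := by
    rw [hi, Bool.eq_iff_iff]
    simp only [Bool.and_eq_true, decide_eq_true_iff, List.isEmpty_iff]
    constructor
    · rintro ⟨h₁, h₂⟩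
      have := List.take_append_drop (encodeFormula B).length ((encodeFormula C).map some)
      rw [h₁, h₂, List.append_nil] at this
      exact encodeFormula_injective (List.map_injective_iff.2 (Option.some_injective _) this)
    · rintro rfl
      simp
  have hx : (d.equal && decide (d.item.take (encodeFormula B).length = (encodeFormula B).map some) &&
      (d.item.drop (encodeFormula B).length).isEmpty && !d.found) = (decide (B = C) && !d.found) := by
    rw [he, Bool.true_and, hq]
  change erase { d with
    item := ((d.item.take (encodeFormula B).length).reverse ++ d.itemRev).reverse ++
      d.item.drop (encodeFormula B).length
    itemRev := []
    stockRev := (if u || (d.equal && decide (d.item.take (encodeFormula B).length =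
      (encodeFormula B).map some) && (d.item.drop (encodeFormula B).length).isEmpty && !d.found)
      then none else some .comma) :: (((encodeFormula B).map some).reverse ++ d.stockRev)
    found := d.found || (!u && (d.equal && decide (d.item.take (encodeFormula B).length =
      (encodeFormula B).map some) && (d.item.drop (encodeFormula B).length).isEmpty && !d.found))
    equal := true } = _
  rw [hx, hr, List.append_nil, List.reverse_reverse, List.take_append_drop]
  have hs : (if u || (decide (B = C) && !d.found) then none else some Letter.comma) ::
      (((encodeFormula B).map some).reverse ++ d.stockRev) =
      (entries (if d.found then [(B, u)] else cross C [(B, u)])).reverse ++ d.stockRev := by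
    by_cases hB : B = C <;> cases u <;> cases d.found <;> simp [hB, cross, entries]
  have hf : (d.found || (!u && (decide (B = C) && !d.found))) =
      (d.found || decide ((B, u) = (C, false))) := by
    by_cases hB : B = C <;> cases u <;> cases d.found <;> simp [hB]
  rw [hs, hf]
  cases d with | mk v =>
  cases v
  simp only at hr he
  subst hr he
  rfl

/-- After the first match `found` holds and the remaining entries are copied unchanged, in
accordance with `cross`. -/
theorem foldl_compare_entries (C : Formula) : ∀ (l : List (Formula × Bool)) (d : Store),
    d.item = (encodeFormula C).map some → d.itemRev = [] → d.equal = true →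
    erase ((entries l).foldl
      (fun d a => compareLetter.den model (model.read (some .stock) (some a) d)) d) =
    erase { d with
      stockRev := (entries (if d.found then l else cross C l)).reverse ++ d.stockRev
      found := d.found || decide ((C, false) ∈ l) }
  | [], d, _, _, _ => by simp [entries, cross]
  | e :: l, d, hi, hr, he => by
    obtain ⟨c, s, h⟩ := exists_of_erase (foldl_compare_entry d C e hi hr he)
    rw [entries, List.flatMap_cons, List.foldl_append, h]
    refine (foldl_compare_entries C l _ (by exact hi) (by exact hr) (by exact he)).trans ?_
    have hs : (entries (if d.found || decide (e = (C, false)) then l else cross C l)).reverse ++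
        ((entries (if d.found then [e] else cross C [e])).reverse ++ d.stockRev) =
        (entries (if d.found then e :: l else cross C (e :: l))).reverse ++ d.stockRev := by
      by_cases h : e = (C, false) <;> cases d.found <;> simp [h, cross, entries]
    have hf : (d.found || decide (e = (C, false)) || decide ((C, false) ∈ l)) =
        (d.found || decide ((C, false) ∈ e :: l)) := by
      rw [Bool.or_assoc, ← Bool.decide_or]
      simp only [List.mem_cons, eq_comm]
    rw [← hs, ← hf]
    rfl

theorem den_takeItem (d : Store) (C : Formula) (l : List (Formula × Bool))
    (hr : d.itemRev = ((encodeFormula C).map some).reverse) (hi : d.item = [])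
    (hs : d.stock = entries l) (hs' : d.stockRev = []) (he : d.equal = true) (hf : d.found = false) :
    erase (takeItem.den model d) = erase { d with
      itemRev := []
      stock := entries (cross C l)
      ok := d.ok && decide ((C, false) ∈ l) } := by
  obtain ⟨c, s, h⟩ := exists_of_erase (foldl_compare_entries C l { d with
    item := (encodeFormula C).map some, itemRev := [], cur := none } rfl rfl he)
  have h' : (loop (some .stock) compareLetter).den model ((move .itemRev .item).den model d) = { d with
      item := (encodeFormula C).map some
      itemRev := []
      stock := []
      stockRev := (entries (cross C l)).reverse
      found := decide ((C, false) ∈ l)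
      cur := none
      saved := s } := by
    rw [den_move]
    have h₁ : model.read (some .itemRev) none (model.set (model.set d (some .item)
        ((model.stk d (some .itemRev)).reverse ++ model.stk d (some .item))) (some .itemRev) []) =
        { d with item := d.itemRev.reverse ++ d.item, itemRev := [], cur := none } := rfl
    rw [h₁, hr, hi, List.append_nil, List.reverse_reverse]
    change (fun e : Store => { e with stock := [], cur := none }) (d.stock.foldl _ _) = _
    rw [← hs] at h
    rw [h]
    have e₁ : (entries (if d.found then l else cross C l)).reverse ++ d.stockRev =
        (entries (cross C l)).reverse := by rw [hf, hs']; simp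
    have e₂ : (d.found || decide ((C, false) ∈ l)) = decide ((C, false) ∈ l) := by
      rw [hf, Bool.false_or]
    change ({ d with
      item := (encodeFormula C).map some
      itemRev := []
      stock := []
      stockRev := (entries (if d.found then l else cross C l)).reverse ++ d.stockRev
      found := d.found || decide ((C, false) ∈ l)
      cur := none
      saved := s } : Store) = _
    rw [e₁, e₂]
  have e : (entries (cross C l)).reverse.reverse ++ [] = entries (cross C l) := by simp
  rw [takeItem, den_seq, den_seq, h', den_seq, den_seq, den_empty, den_move]
  change erase { d with
    item := []
    itemRev := []
    stock := (entries (cross C l)).reverse.reverse ++ []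
    stockRev := []
    ok := d.ok && decide ((C, false) ∈ l)
    found := false } = _
  rw [e]
  cases d with | mk v =>
  cases v
  simp only at hi hs' he hf
  subst hi hs' he hf
  rfl

end takeItem

end Writer
end RG

namespace RG

namespace Writer

open LProg

/-! ### The pass that checks the contributions -/

section check

/-- The effect of `checkLetter` for a letter. -/
def checked (d : Store) (a : Option Letter) : Store :=
  checkLetter.den model (model.read (some .word) (some a) d)

theorem checked_goal {d : Store} (hd : d.phase = .goal) {a : Letter} (ha : a ≠ .semicolon) :
    erase (checked d (some a)) = erase { d with wordRev := some a :: d.wordRev } := by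
  rw [checked, checkLetter, den_seq, den_of_false (by exact decide_some_eq_of_ne ha),
    den_of_true (decide_eq_true (by exact hd))]
  rfl

theorem checked_endowment {d : Store} (hd : d.phase = .endowment) {a : Letter}
    (ha : a ≠ .semicolon) :
    erase (checked d (some a)) = erase { d with
      wordRev := some a :: d.wordRev
      stockRev := some a :: d.stockRev
      pool := some a :: d.pool } := by
  have hd' : d.phase ≠ .goal := by rw [hd]; decide
  rw [checked, checkLetter, den_seq, den_of_false (by exact decide_some_eq_of_ne ha),
    den_of_false (by exact decide_eq_false hd'), den_of_true (decide_eq_true (by exact hd))]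
  rfl

theorem checked_contribution {d : Store} (hd : d.phase = .contribution) {a : Letter}
    (ha : a ≠ .semicolon) (ha' : a ≠ .comma) :
    erase (checked d (some a)) = erase { d with
      wordRev := some a :: d.wordRev
      outcome := some a :: d.outcome
      before := some a :: d.before
      copyRev := some a :: d.copyRev
      itemRev := some a :: d.itemRev
      nonempty := true } := by
  have hd' : d.phase ≠ .goal := by rw [hd]; decide
  have hd'' : d.phase ≠ .endowment := by rw [hd]; decide
  rw [checked, checkLetter, den_seq, den_of_false (by exact decide_some_eq_of_ne ha),
    den_of_false (by exact decide_eq_false hd'), den_of_false (by exact decide_eq_false hd''),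
    den_seq, den_seq, den_seq, den_seq, den_of_false (by exact decide_some_eq_of_ne ha')]
  rfl

/-- No formula is being compared. -/
def Clean (d : Store) : Prop :=
  d.item = [] ∧ d.stockRev = [] ∧ d.equal = true ∧ d.found = false

theorem checked_comma {d : Store} (hd : d.phase = .contribution) (C : Formula)
    (l : List (Formula × Bool)) (hr : d.itemRev = ((encodeFormula C).map some).reverse)
    (hs : d.stock = entries l) (hc : Clean d) :
    erase (checked d (some .comma)) = erase { d with
      wordRev := some .comma :: d.wordRev
      outcome := some .comma :: d.outcome
      before := some .comma :: d.before
      copyRev := some .comma :: d.copyRev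
      itemRev := []
      nonempty := true
      stock := entries (cross C l)
      ok := d.ok && decide ((C, false) ∈ l) } := by
  have hd' : d.phase ≠ .goal := by rw [hd]; decide
  have hd'' : d.phase ≠ .endowment := by rw [hd]; decide
  rw [checked, checkLetter, den_seq, den_of_false (by exact decide_some_eq_of_ne (by decide)),
    den_of_false (by exact decide_eq_false hd'), den_of_false (by exact decide_eq_false hd''),
    den_seq, den_seq, den_seq, den_seq, den_of_true (by exact decide_eq_true rfl)]
  exact den_takeItem _ C l hr hc.1 hs hc.2.1 hc.2.2.1 hc.2.2.2

theorem checked_semicolon_goal {d : Store} (hd : d.phase = .goal) :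
    erase (checked d (some .semicolon)) = erase { d with
      wordRev := some .semicolon :: d.wordRev, phase := .endowment } := by
  have hd' : d.phase ≠ .endowment := by rw [hd]; decide
  have hd'' : d.phase ≠ .contribution := by rw [hd]; decide
  rw [checked, checkLetter, den_seq, den_of_true (by exact decide_eq_true rfl), den_seq,
    den_of_false (by exact decide_eq_false hd'), den_of_false (by exact decide_eq_false hd'')]
  change erase { d with wordRev := some .semicolon :: d.wordRev, phase := d.phase.next } = _
  rw [hd]
  rfl

theorem checked_semicolon_endowment {d : Store} (hd : d.phase = .endowment) :
    erase (checked d (some .semicolon)) = erase { d with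
      wordRev := some .semicolon :: d.wordRev
      stock := d.stockRev.reverse ++ d.stock
      stockRev := []
      phase := .contribution } := by
  rw [checked, checkLetter, den_seq, den_of_true (by exact decide_eq_true rfl), den_seq,
    den_of_true (by exact decide_eq_true hd), den_move]
  change erase { d with
    wordRev := some .semicolon :: d.wordRev
    stock := d.stockRev.reverse ++ d.stock
    stockRev := []
    phase := d.phase.next } = _
  rw [hd]
  rfl

theorem checked_semicolon_contribution {d : Store} (hd : d.phase = .contribution) :
    erase (checked d (some .semicolon)) = erase { d with
      wordRev := some .semicolon :: d.wordRev
      stock := []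
      phase := .goal } := by
  have hd' : d.phase ≠ .endowment := by rw [hd]; decide
  rw [checked, checkLetter, den_seq, den_of_true (by exact decide_eq_true rfl), den_seq,
    den_of_false (by exact decide_eq_false hd'), den_of_true (by exact decide_eq_true hd), den_empty]
  change erase { d with
    wordRev := some .semicolon :: d.wordRev
    stock := []
    phase := d.phase.next } = _
  rw [hd]
  rfl

theorem foldl_checked_goal : ∀ (w : List Letter), (∀ a ∈ w, a ≠ .semicolon) → ∀ d : Store,
    d.phase = .goal →
    erase ((w.map some).foldl checked d) = erase { d with wordRev := (w.map some).reverse ++ d.wordRev }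
  | [], _, _, _ => rfl
  | a :: w, hw, d, hd => by
    obtain ⟨ha, hw⟩ := List.forall_mem_cons.1 hw
    obtain ⟨c, s, h⟩ := exists_of_erase (checked_goal hd ha)
    rw [List.map_cons, List.foldl_cons, h]
    refine (foldl_checked_goal w hw _ (by exact hd)).trans ?_
    rw [List.reverse_cons, List.append_assoc]
    rfl

theorem foldl_checked_endowment : ∀ (w : List Letter), (∀ a ∈ w, a ≠ .semicolon) → ∀ d : Store,
    d.phase = .endowment →
    erase ((w.map some).foldl checked d) = erase { d with
      wordRev := (w.map some).reverse ++ d.wordRev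
      stockRev := (w.map some).reverse ++ d.stockRev
      pool := (w.map some).reverse ++ d.pool }
  | [], _, _, _ => rfl
  | a :: w, hw, d, hd => by
    obtain ⟨ha, hw⟩ := List.forall_mem_cons.1 hw
    obtain ⟨c, s, h⟩ := exists_of_erase (checked_endowment hd ha)
    rw [List.map_cons, List.foldl_cons, h]
    refine (foldl_checked_endowment w hw _ (by exact hd)).trans ?_
    simp only [List.reverse_cons, List.append_assoc]
    rfl

theorem foldl_checked_contribution : ∀ (w : List Letter),
    (∀ a ∈ w, a ≠ .semicolon ∧ a ≠ .comma) → ∀ d : Store, d.phase = .contribution →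
    erase ((w.map some).foldl checked d) = erase { d with
      wordRev := (w.map some).reverse ++ d.wordRev
      outcome := (w.map some).reverse ++ d.outcome
      before := (w.map some).reverse ++ d.before
      copyRev := (w.map some).reverse ++ d.copyRev
      itemRev := (w.map some).reverse ++ d.itemRev
      nonempty := d.nonempty || !w.isEmpty }
  | [], _, d, _ => by simp
  | a :: w, hw, d, hd => by
    obtain ⟨ha, hw⟩ := List.forall_mem_cons.1 hw
    obtain ⟨c, s, h⟩ := exists_of_erase (checked_contribution hd ha.1 ha.2)
    rw [List.map_cons, List.foldl_cons, h]
    refine (foldl_checked_contribution w hw _ (by exact hd)).trans ?_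
    simp only [List.reverse_cons, List.append_assoc, List.isEmpty_cons, Bool.not_false, Bool.or_true]
    rfl

/-- Effects known up to `erase` compose, provided that the second one is known for all values of
`cur` and `saved`. -/
theorem erase_foldl_append {f : Store → Option Letter → Store} {s t : List (Option Letter)}
    {d d' d'' : Store} (h : erase (s.foldl f d) = erase d')
    (h' : ∀ c v, erase (t.foldl f { d' with cur := c, saved := v }) = erase d'') :
    erase ((s ++ t).foldl f d) = erase d'' := by
  obtain ⟨c, v, h⟩ := exists_of_erase h
  rw [List.foldl_append, h]
  exact h' c v

theorem foldl_checked_formula (C : Formula) (l : List (Formula × Bool)) (d : Store)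
    (hd : d.phase = .contribution) (hr : d.itemRev = []) (hs : d.stock = entries l) (hc : Clean d) :
    erase (((encodeFormula C ++ [Letter.comma]).map some).foldl checked d) = erase { d with
      wordRev := ((encodeFormula C ++ [Letter.comma]).map some).reverse ++ d.wordRev
      outcome := ((encodeFormula C ++ [Letter.comma]).map some).reverse ++ d.outcome
      before := ((encodeFormula C ++ [Letter.comma]).map some).reverse ++ d.before
      copyRev := ((encodeFormula C ++ [Letter.comma]).map some).reverse ++ d.copyRev
      itemRev := []
      stock := entries (cross C l)
      nonempty := true
      ok := d.ok && decide ((C, false) ∈ l) } := by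
  obtain ⟨c, s, h⟩ := exists_of_erase (foldl_checked_contribution (encodeFormula C)
    (fun a ha => by
      have := opens_of_mem_encodeFormula ha
      constructor <;> rintro rfl <;> exact this) d hd)
  rw [hr, List.append_nil] at h
  rw [List.map_append, List.foldl_append, h, List.reverse_append]
  exact checked_comma (by exact hd) C l (by exact rfl) (by exact hs) (by exact hc)

theorem foldl_checked_formulas : ∀ (Δ : List Formula) (l : List (Formula × Bool)) (d : Store),
    d.phase = .contribution → d.itemRev = [] → d.stock = entries l → Clean d →
    erase (((encodeFormulas Δ).map some).foldl checked d) = erase { d with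
      wordRev := ((encodeFormulas Δ).map some).reverse ++ d.wordRev
      outcome := ((encodeFormulas Δ).map some).reverse ++ d.outcome
      before := ((encodeFormulas Δ).map some).reverse ++ d.before
      copyRev := ((encodeFormulas Δ).map some).reverse ++ d.copyRev
      stock := entries (crossAll Δ l)
      nonempty := d.nonempty || !Δ.isEmpty
      ok := d.ok && covers Δ l }
  | [], l, d, _, _, hs, _ => by simp [encodeFormulas, crossAll, covers, ← hs]
  | C :: Δ, l, d, hd, hr, hs, hc => by
    obtain ⟨c, s, h⟩ := exists_of_erase (foldl_checked_formula C l d hd hr hs hc)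
    have e : encodeFormulas (C :: Δ) = (encodeFormula C ++ [Letter.comma]) ++ encodeFormulas Δ := rfl
    rw [e, List.map_append, List.foldl_append, h]
    refine (foldl_checked_formulas Δ _ _ (by exact hd) (by exact rfl) (by exact rfl)
      (by exact hc)).trans ?_
    rw [List.reverse_append]
    simp only [List.append_assoc, List.isEmpty_cons, Bool.not_false, Bool.or_true, Bool.true_or,
      Bool.and_assoc, covers, crossAll, ← hr]
    rfl

theorem ne_semicolon_of_mem_encodeFormula {a : Letter} {A : Formula} (h : a ∈ encodeFormula A) :
    a ≠ .semicolon := by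
  rintro rfl
  exact opens_of_mem_encodeFormula h

theorem ne_semicolon_of_mem_encodeFormulas {a : Letter} {Γ : List Formula}
    (h : a ∈ encodeFormulas Γ) : a ≠ .semicolon := by
  simp only [encodeFormulas, List.mem_flatMap, List.mem_append, List.mem_singleton] at h
  obtain ⟨A, -, h | rfl⟩ := h
  · exact ne_semicolon_of_mem_encodeFormula h
  · simp

/-- The contribution is contained in the endowment. -/
def _root_.RG.PlayerData.contained (p : PlayerData) : Bool :=
  covers p.contribution (p.endowment.map fun A => (A, false))

theorem foldl_checked_goal_endowment (p : PlayerData) (d : Store) (hd : d.phase = .goal)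
    (hs : d.stock = []) (hc : Clean d) :
    erase (((encodeFormula p.goal).map some ++ ([some Letter.semicolon] ++
      ((encodeFormulas p.endowment).map some ++ [some Letter.semicolon]))).foldl checked d) =
    erase { d with
      wordRev := some .semicolon :: (((encodeFormulas p.endowment).map some).reverse ++
        some .semicolon :: (((encodeFormula p.goal).map some).reverse ++ d.wordRev))
      pool := ((encodeFormulas p.endowment).map some).reverse ++ d.pool
      stock := entries (p.endowment.map fun A => (A, false))
      phase := .contribution } := by
  refine erase_foldl_append (foldl_checked_goal _ (fun a ha => ne_semicolon_of_mem_encodeFormula ha)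
    d hd) fun c v => ?_
  dsimp only
  refine erase_foldl_append (checked_semicolon_goal (by exact hd)) fun c v => ?_
  dsimp only
  refine erase_foldl_append (foldl_checked_endowment _
    (fun a ha => ne_semicolon_of_mem_encodeFormulas ha) _ (by exact rfl)) fun c v => ?_
  dsimp only
  refine (checked_semicolon_endowment (by exact rfl)).trans ?_
  dsimp only
  have h : (((encodeFormulas p.endowment).map some).reverse ++ []).reverse ++ [] =
      entries (p.endowment.map fun A => (A, false)) := by
    rw [entries_coe]
    simp
  rw [← h]
  cases d with | mk v =>
  cases v
  obtain ⟨_, h₁, _⟩ := hc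
  simp only at hs h₁
  subst hs h₁
  rfl

/-- The stock is empty before and after each player, so a contribution is compared only with the
endowment of the same player. -/
theorem foldl_checked_player (p : PlayerData) (d : Store) (hd : d.phase = .goal) (hr : d.itemRev = [])
    (hs : d.stock = []) (hc : Clean d) :
    erase (((encodePlayer p).map some).foldl checked d) = erase { d with
      wordRev := ((encodePlayer p).map some).reverse ++ d.wordRev
      pool := ((encodeFormulas p.endowment).map some).reverse ++ d.pool
      outcome := ((encodeFormulas p.contribution).map some).reverse ++ d.outcome
      before := ((encodeFormulas p.contribution).map some).reverse ++ d.before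
      copyRev := ((encodeFormulas p.contribution).map some).reverse ++ d.copyRev
      nonempty := d.nonempty || !p.contribution.isEmpty
      ok := d.ok && p.contained } := by
  have e : (encodePlayer p).map some = ((encodeFormula p.goal).map some ++ ([some Letter.semicolon] ++
      ((encodeFormulas p.endowment).map some ++ [some Letter.semicolon]))) ++
        ((encodeFormulas p.contribution).map some ++ [some Letter.semicolon]) := by
    simp [encodePlayer]
  have hw : ((encodePlayer p).map some).reverse ++ d.wordRev = some Letter.semicolon ::
      (((encodeFormulas p.contribution).map some).reverse ++ some Letter.semicolon ::
        (((encodeFormulas p.endowment).map some).reverse ++ some Letter.semicolon ::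
          (((encodeFormula p.goal).map some).reverse ++ d.wordRev))) := by simp [encodePlayer]
  rw [hw, e]
  refine erase_foldl_append (foldl_checked_goal_endowment p d hd hs hc) fun c v => ?_
  dsimp only
  refine erase_foldl_append (foldl_checked_formulas _ (p.endowment.map fun A => (A, false)) _
    (by exact rfl) (by exact hr) (by exact rfl) (by exact hc)) fun c v => ?_
  dsimp only
  refine (checked_semicolon_contribution (by exact rfl)).trans ?_
  dsimp only
  cases d with | mk v =>
  cases v
  simp only at hd hs
  subst hd hs
  rfl

theorem outcome_cons (p : PlayerData) (x : REInput) :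
    REInput.outcome (p :: x) = p.contribution ++ x.outcome := rfl

theorem resources_cons (p : PlayerData) (x : REInput) :
    REInput.resources (p :: x) = p.endowment ++ x.resources := rfl

theorem foldl_checked_input : ∀ (x : REInput) (d : Store), d.phase = .goal → d.itemRev = [] →
    d.stock = [] → Clean d →
    erase (((encodeInput x).map some).foldl checked d) = erase { d with
      wordRev := ((encodeInput x).map some).reverse ++ d.wordRev
      pool := ((encodeFormulas x.resources).map some).reverse ++ d.pool
      outcome := ((encodeFormulas x.outcome).map some).reverse ++ d.outcome
      before := ((encodeFormulas x.outcome).map some).reverse ++ d.before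
      copyRev := ((encodeFormulas x.outcome).map some).reverse ++ d.copyRev
      nonempty := d.nonempty || !x.outcome.isEmpty
      ok := d.ok && x.all PlayerData.contained }
  | [], d, _, _, _, _ => by
    simp [encodeInput, REInput.resources, REInput.outcome, encodeFormulas]
  | p :: x, d, hd, hr, hs, hc => by
    rw [encodeInput_cons, List.map_append]
    refine erase_foldl_append (foldl_checked_player p d hd hr hs hc) fun c v => ?_
    dsimp only
    refine (foldl_checked_input x _ (by exact hd) (by exact hr) (by exact hs) (by exact hc)).trans ?_
    dsimp only
    rw [outcome_cons, resources_cons, encodeFormulas_append, encodeFormulas_append]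
    have hn : (!(p.contribution ++ REInput.outcome x).isEmpty) =
        (!p.contribution.isEmpty || !(REInput.outcome x).isEmpty) := by
      cases p.contribution <;> simp
    simp only [List.map_append, List.reverse_append, List.append_assoc, hn, ← Bool.or_assoc,
      List.all_cons, ← Bool.and_assoc]
    rfl

theorem den_check (x : REInput) (d : Store) (hw : d.word = (encodeInput x).map some)
    (hd : d.phase = .goal) (hr : d.itemRev = []) (hs : d.stock = []) (hc : Clean d) :
    check.den model d = erase { d with
      word := []
      wordRev := ((encodeInput x).map some).reverse ++ d.wordRev
      pool := ((encodeFormulas x.resources).map some).reverse ++ d.pool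
      outcome := ((encodeFormulas x.outcome).map some).reverse ++ d.outcome
      before := ((encodeFormulas x.outcome).map some).reverse ++ d.before
      copyRev := ((encodeFormulas x.outcome).map some).reverse ++ d.copyRev
      nonempty := d.nonempty || !x.outcome.isEmpty
      ok := d.ok && x.all PlayerData.contained } := by
  have h := foldl_checked_input x d hd hr hs hc
  change (fun e : Store => { e with word := [] }) (erase (d.word.foldl checked d)) = _
  rw [hw, h]
  rfl

end check

end Writer
end RG

namespace RG

namespace Writer

open LProg

/-! ### The pass that writes the queries -/

section queries

theorem foldl_write {k : Stack} (hk : k = .outcome ∨ k = .pool ∨ k = .before ∨ k = .goal) :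
    ∀ (s : List (Option Letter)) (d : Store), ∃ c,
    s.foldl (fun d a => (seq (push (some k) current) (push (some .outRev) current) : Program).den model
      (model.read (some .aux) (some a) d)) d =
    { model.set d (some k) (s.reverse ++ model.stk d (some k)) with
      outRev := s.reverse ++ d.outRev, cur := c } := by
  intro s
  induction s with
  | nil =>
    intro d
    refine ⟨d.cur, ?_⟩
    rcases hk with rfl | rfl | rfl | rfl <;> rfl
  | cons a s ih =>
    intro d
    obtain ⟨c, h⟩ := ih ((seq (push (some k) current) (push (some .outRev) current) : Program).den model
      (model.read (some .aux) (some a) d))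
    refine ⟨c, h.trans ?_⟩
    rw [List.reverse_cons, List.append_assoc, List.append_assoc]
    cases d with | mk v =>
    cases v
    rcases hk with rfl | rfl | rfl | rfl <;> rfl

/-- These stacks hold their words in reverse order, as does `outRev`; the two reversals by way of
`aux` copy them unchanged and restore them. -/
theorem den_write {k : Stack} (hk : k = .outcome ∨ k = .pool ∨ k = .before ∨ k = .goal) (d : Store)
    (hd : d.aux = []) :
    (write k).den model d =
      { d with outRev := model.stk d (some k) ++ d.outRev, cur := none } := by
  have h₁ := foldl_write hk ((model.stk d (some k)).reverse ++ d.aux)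
    { model.set d (some k) [] with
      aux := (model.stk d (some k)).reverse ++ d.aux, cur := none }
  obtain ⟨c, h⟩ := h₁
  have h₂ := congrArg (fun d : Store => { d with aux := [], cur := none }) h
  have e : ((model.stk d (some k)).reverse ++ d.aux).reverse ++ d.outRev =
      model.stk d (some k) ++ d.outRev := by simp [hd]
  have e' : ((model.stk d (some k)).reverse ++ d.aux).reverse ++ [] = model.stk d (some k) := by
    simp [hd]
  have h₃ := congrArg (fun l => ({ model.set d (some k) l with
    outRev := ((model.stk d (some k)).reverse ++ d.aux).reverse ++ d.outRev, cur := none } : Store)) e'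
  rw [write, den_seq, den_move, ← e]
  cases d with | mk v =>
  cases v
  simp only at hd
  subst hd
  rcases hk with rfl | rfl | rfl | rfl <;> exact Eq.trans (Eq.trans rfl h₂) (Eq.trans rfl h₃)

theorem foldl_writeRev : ∀ (s : List (Option Letter)) (d : Store), ∃ c,
    s.foldl (fun d a => (seq (push (some .aux) current) (push (some .outRev) current) : Program).den
      model (model.read (some .after) (some a) d)) d =
    { d with aux := s.reverse ++ d.aux, outRev := s.reverse ++ d.outRev, cur := c }
  | [], d => ⟨d.cur, rfl⟩
  | a :: s, d => by
    obtain ⟨c, h⟩ := foldl_writeRev s ((seq (push (some .aux) current)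
      (push (some .outRev) current) : Program).den model (model.read (some .after) (some a) d))
    refine ⟨c, h.trans ?_⟩
    rw [List.reverse_cons, List.append_assoc, List.append_assoc]
    rfl

/-- `after` holds its word in reading order and so has to be reversed on its way to `outRev`. -/
theorem den_writeRev (d : Store) (hd : d.aux = []) :
    (writeRev .after).den model d =
      { d with outRev := d.after.reverse ++ d.outRev, cur := none } := by
  obtain ⟨c, h⟩ := foldl_writeRev d.after d
  have h₁ : (loop (some .after) (seq (push (some .aux) current) (push (some .outRev) current)) :
      Program).den model d = { d with
        after := [], aux := d.after.reverse ++ d.aux, outRev := d.after.reverse ++ d.outRev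
        cur := none } := congrArg (fun d : Store => { d with after := [], cur := none }) h
  rw [writeRev, den_seq, h₁, den_move]
  change ({ d with
    after := (d.after.reverse ++ d.aux).reverse ++ []
    aux := []
    outRev := d.after.reverse ++ d.outRev
    cur := none } : Store) = _
  have e : (d.after.reverse ++ d.aux).reverse ++ [] = d.after := by simp [hd]
  rw [e, ← hd]

theorem den_writeGoal (d : Store) (hd : d.aux = []) :
    writeGoal.den model d = { d with
      outRev := none :: some .comma :: (d.goal ++ some .turnstile :: d.outRev), cur := none } := by
  rw [writeGoal, den_seq, den_seq, den_write (by simp) _ (by exact hd)]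
  rfl

/-- The output after a query has been written. -/
def written (q : List Letter) (l : List (Option Letter)) : List (Option Letter) :=
  none :: ((q.map some).reverse ++ l)

theorem written_encodeSequent (Γ : List Formula) (A : Formula) (l : List (Option Letter)) :
    written (encodeSequent Γ [A]) l = none :: some .comma :: (((encodeFormula A).map some).reverse ++
      some .turnstile :: (((encodeFormulas Γ).map some).reverse ++ l)) := by
  simp [written, encodeSequent, encodeFormulas]

theorem reverse_joinWords_cons (q : List Letter) (qs : List (List Letter)) (l : List (Option Letter)) :
    (joinWords (q :: qs)).reverse ++ l = (joinWords qs).reverse ++ written q l := by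
  simp [joinWords, written]

/-- The formula to be left out lies on `removed`, hence neither in `Γ` nor in `Δ`. Afterwards it
joins `before`, ready for the next removal. -/
theorem den_writeRemoval (d : Store) (hd : d.aux = []) (O Γ Δ : List Formula) (A : Formula)
    (hO : d.outcome = ((encodeFormulas O).map some).reverse)
    (hg : d.goal = ((encodeFormula A).map some).reverse)
    (hb : d.before = ((encodeFormulas Γ).map some).reverse)
    (ha : d.after = (encodeFormulas Δ).map some) :
    writeRemoval.den model d = { d with
      outRev := written (encodeSequent (Γ ++ Δ) [A]) (written (encodeSequent O [A]) d.outRev)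
      before := d.removed ++ d.before
      removed := []
      cur := none } := by
  rw [written_encodeSequent, written_encodeSequent, encodeFormulas_append, List.map_append,
    List.reverse_append, List.append_assoc, ← hO, ← hg, ← hb, ← ha]
  have e : (d.removed.reverse ++ []).reverse ++ d.before = d.removed ++ d.before := by simp
  rw [← e]
  cases d with | mk v =>
  cases v
  simp only at hd
  subst hd
  rw [writeRemoval, den_seq, den_write (by simp) _ (by exact rfl), den_seq,
    den_writeGoal _ (by exact rfl), den_seq, den_write (by simp) _ (by exact rfl), den_seq,
    den_writeRev _ (by exact rfl), den_seq, den_writeGoal _ (by exact rfl), den_seq, den_move, den_move]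
  rfl

/-- The effect of `removalLetter` for a letter. -/
def removed (d : Store) (a : Option Letter) : Store :=
  removalLetter.den model (model.read (some .copy) (some a) d)

theorem removed_letter {a : Letter} (ha : a ≠ .comma) (d : Store) (r : List (Option Letter))
    (hr : d.after = some a :: r) :
    erase (removed d (some a)) = erase { d with
      copyRev := some a :: d.copyRev, after := r, removed := some a :: d.removed } := by
  cases d with | mk v =>
  cases v
  simp only at hr
  subst hr
  rw [removed, removalLetter, den_seq, den_seq, den_of_false (by exact decide_some_eq_of_ne ha)]
  rfl

theorem foldl_removed_letters : ∀ (w : List Letter), (∀ a ∈ w, a ≠ .comma) →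
    ∀ (d : Store) (r : List (Option Letter)), d.after = w.map some ++ r →
    erase ((w.map some).foldl removed d) = erase { d with
      copyRev := (w.map some).reverse ++ d.copyRev
      after := r
      removed := (w.map some).reverse ++ d.removed }
  | [], _, d, r, hr => by rw [← show d.after = r from hr]; rfl
  | a :: w, hw, d, r, hr => by
    obtain ⟨ha, hw⟩ := List.forall_mem_cons.1 hw
    obtain ⟨c, s, h⟩ := exists_of_erase (removed_letter ha d _ hr)
    rw [List.map_cons, List.foldl_cons, h]
    refine (foldl_removed_letters w hw _ r (by exact rfl)).trans ?_
    rw [List.reverse_cons, List.append_assoc, List.append_assoc]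
    rfl

theorem removed_comma (d : Store) (hd : d.aux = []) (O Γ Δ : List Formula) (A : Formula)
    (hO : d.outcome = ((encodeFormulas O).map some).reverse)
    (hg : d.goal = ((encodeFormula A).map some).reverse)
    (hb : d.before = ((encodeFormulas Γ).map some).reverse)
    (ha : d.after = some .comma :: (encodeFormulas Δ).map some) :
    erase (removed d (some .comma)) = erase { d with
      copyRev := some .comma :: d.copyRev
      after := (encodeFormulas Δ).map some
      outRev := written (encodeSequent (Γ ++ Δ) [A]) (written (encodeSequent O [A]) d.outRev)
      before := some .comma :: d.removed ++ d.before
      removed := [] } := by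
  have h : (shift (some .after) (some .removed) current : Program).den model
      ((push (some .copyRev) current : Program).den model
        (model.read (some .copy) (some (some .comma)) d)) = { d with
      copyRev := some .comma :: d.copyRev
      after := (encodeFormulas Δ).map some
      removed := some .comma :: d.removed
      cur := some (some .comma) } := by
    cases d with | mk v =>
    cases v
    simp only at ha
    subst ha
    rfl
  rw [removed, removalLetter, den_seq, den_seq, h, den_of_true (by exact decide_eq_true rfl),
    den_writeRemoval _ (by exact hd) O Γ Δ A (by exact hO) (by exact hg) (by exact hb) (by exact rfl)]
  rfl

theorem foldl_removed_formula (C : Formula) (d : Store) (hd : d.aux = []) (O Γ Δ : List Formula)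
    (A : Formula)
    (hO : d.outcome = ((encodeFormulas O).map some).reverse)
    (hg : d.goal = ((encodeFormula A).map some).reverse)
    (hb : d.before = ((encodeFormulas Γ).map some).reverse)
    (ha : d.after = (encodeFormulas (C :: Δ)).map some) (hr : d.removed = []) :
    erase (((encodeFormula C ++ [Letter.comma]).map some).foldl removed d) = erase { d with
      copyRev := ((encodeFormula C ++ [Letter.comma]).map some).reverse ++ d.copyRev
      after := (encodeFormulas Δ).map some
      outRev := written (encodeSequent (Γ ++ Δ) [A]) (written (encodeSequent O [A]) d.outRev)
      before := ((encodeFormulas (Γ ++ [C])).map some).reverse } := by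
  have e : ((encodeFormulas (Γ ++ [C])).map some).reverse =
      some Letter.comma :: ((encodeFormula C).map some).reverse ++ d.before := by
    rw [hb]
    simp [encodeFormulas]
  rw [e, List.map_append, List.reverse_append]
  refine erase_foldl_append (foldl_removed_letters (encodeFormula C) (fun a ha => by
    rintro rfl; exact opens_of_mem_encodeFormula ha) d
      (some .comma :: (encodeFormulas Δ).map some) ?_) fun c v => ?_
  · rw [ha, encodeFormulas_cons]
    simp
  · dsimp only
    refine (removed_comma _ (by exact hd) O Γ Δ A (by exact hO) (by exact hg) (by exact hb)
      (by exact rfl)).trans ?_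
    cases d with | mk v =>
    cases v
    simp only at hr
    subst hr
    rw [List.append_nil]
    rfl

/-- The induction follows the recursion of `removals`: `before` spells `Γ`, `after` spells `Δ`, and
`outcome` keeps the whole of `O`. -/
theorem foldl_removed (O : List Formula) (A : Formula) : ∀ (Δ Γ : List Formula) (d : Store),
    d.aux = [] → d.outcome = ((encodeFormulas O).map some).reverse →
    d.goal = ((encodeFormula A).map some).reverse →
    d.before = ((encodeFormulas Γ).map some).reverse →
    d.after = (encodeFormulas Δ).map some → d.removed = [] →
    erase (((encodeFormulas Δ).map some).foldl removed d) = erase { d with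
      copyRev := ((encodeFormulas Δ).map some).reverse ++ d.copyRev
      after := []
      outRev := (joinWords ((removals Γ Δ).flatMap fun Λ =>
        [encodeSequent O [A], encodeSequent Λ [A]])).reverse ++ d.outRev
      before := ((encodeFormulas (Γ ++ Δ)).map some).reverse }
  | [], Γ, d, _, _, _, hb, ha, _ => by
    rw [List.append_nil, ← hb]
    cases d with | mk v =>
    cases v
    have ha : _ = [] := ha
    simp only at ha
    subst ha
    rfl
  | C :: Δ, Γ, d, hd, hO, hg, hb, ha, hr => by
    have e : encodeFormulas (C :: Δ) = (encodeFormula C ++ [.comma]) ++ encodeFormulas Δ := rfl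
    rw [e, List.map_append]
    refine erase_foldl_append (foldl_removed_formula C d hd O Γ Δ A hO hg hb ha hr) fun c v => ?_
    dsimp only
    refine (foldl_removed O A Δ (Γ ++ [C]) _ (by exact hd) (by exact hO) (by exact hg) (by exact rfl)
      (by exact rfl) (by exact hr)).trans ?_
    rw [removals, List.flatMap_cons, List.cons_append, List.cons_append, List.nil_append,
      reverse_joinWords_cons, reverse_joinWords_cons, List.reverse_append, List.append_assoc,
      List.append_assoc, List.singleton_append]
    rfl

/-- The stacks are as they are when the queries for a goal are to be written. -/
def Prepared (x : REInput) (d : Store) : Prop :=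
  d.aux = [] ∧ d.after = [] ∧ d.removed = [] ∧ d.copy = [] ∧
    d.outcome = ((encodeFormulas x.outcome).map some).reverse ∧
    d.pool = ((encodeFormulas x.resources).map some).reverse ∧
    d.before = ((encodeFormulas x.outcome).map some).reverse ∧
    d.copyRev = ((encodeFormulas x.outcome).map some).reverse

/-- Apart from the output all stacks are restored, because they are needed again for the goal of the
next player. -/
theorem den_writeQueries {mode : Bool → Bool} {x : REInput} {d : Store} (hd : Prepared x d)
    {A : Formula} (hg : d.goal = ((encodeFormula A).map some).reverse) :
    erase ((writeQueries mode).den model d) = erase { d with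
      outRev := (joinWords (goalQueries (mode d.nonempty) x.outcome x.resources A)).reverse ++
        d.outRev } := by
  obtain ⟨h₁, h₂, h₃, h₄, h₅, h₆, h₇, h₈⟩ := hd
  cases hm : mode d.nonempty
  · rw [writeQueries, den_of_false hm, den_seq, den_write (by simp) _ (by exact h₁), den_seq,
      den_writeGoal _ (by exact h₁), den_seq, den_write (by simp) _ (by exact h₁),
      den_writeGoal _ (by exact h₁)]
    simp only [goalQueries, Bool.false_eq_true, if_false, reverse_joinWords_cons]
    rw [written_encodeSequent, written_encodeSequent, ← h₅, ← h₆, ← hg]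
    rfl
  · have h := foldl_removed x.outcome A x.outcome [] { d with
      before := [], after := d.before.reverse ++ d.after, copy := (encodeFormulas x.outcome).map some
      copyRev := [], cur := none } h₁ h₅ hg rfl (by
        change d.before.reverse ++ d.after = _
        rw [h₂, h₇]
        simp) h₃
    have key : ∀ L, L = (encodeFormulas x.outcome).map some →
        erase ((loop (some .copy) removalLetter).den model { d with
          before := [], after := d.before.reverse ++ d.after, copy := L
          copyRev := [], cur := none }) = erase { d with
        outRev := (joinWords ((removals [] x.outcome).flatMap fun Λ =>
          [encodeSequent x.outcome [A], encodeSequent Λ [A]])).reverse ++ d.outRev } := by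
      rintro L rfl
      refine (congrArg (fun e : Store => { e with copy := [] }) h).trans ?_
      rw [List.append_nil, List.nil_append]
      cases d with | mk v =>
      cases v
      simp only at h₂ h₄ h₇ h₈
      subst h₂ h₄ h₇ h₈
      rfl
    rw [writeQueries, den_of_true hm, den_seq, den_seq, den_move, den_move]
    simp only [goalQueries, if_true]
    exact key (d.copyRev.reverse ++ d.copy) (by rw [h₄, h₈]; simp)

/-- The effect of `queryLetter` for a letter. -/
def queried (mode : Bool → Bool) (d : Store) (a : Option Letter) : Store :=
  (queryLetter mode).den model (model.read (some .word) (some a) d)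

theorem queried_goal {mode : Bool → Bool} {d : Store} (hd : d.phase = .goal) {a : Letter}
    (ha : a ≠ .semicolon) :
    erase (queried mode d (some a)) = erase { d with goal := some a :: d.goal } := by
  rw [queried, queryLetter, den_of_false (by exact decide_some_eq_of_ne ha),
    den_of_true (by exact decide_eq_true hd)]
  rfl

theorem queried_of_ne_goal {mode : Bool → Bool} {d : Store} (hd : d.phase ≠ .goal) {a : Letter}
    (ha : a ≠ .semicolon) : erase (queried mode d (some a)) = erase d := by
  rw [queried, queryLetter, den_of_false (by exact decide_some_eq_of_ne ha),
    den_of_false (by exact decide_eq_false hd)]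
  rfl

theorem queried_semicolon_of_ne_goal {mode : Bool → Bool} {d : Store} (hd : d.phase ≠ .goal) :
    erase (queried mode d (some .semicolon)) = erase { d with phase := d.phase.next } := by
  rw [queried, queryLetter, den_of_true (by exact decide_eq_true rfl), den_seq,
    den_of_false (by exact decide_eq_false hd)]
  rfl

theorem queried_semicolon_goal {mode : Bool → Bool} {x : REInput} {d : Store} (hp : Prepared x d)
    (hd : d.phase = .goal) {A : Formula} (hg : d.goal = ((encodeFormula A).map some).reverse) :
    erase (queried mode d (some .semicolon)) = erase { d with
      phase := .endowment
      goal := []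
      outRev := (joinWords (goalQueries (mode d.nonempty) x.outcome x.resources A)).reverse ++
        d.outRev } := by
  obtain ⟨c, s, h⟩ := exists_of_erase (den_writeQueries (mode := mode) (x := x) (d := { d with
    cur := some (some .semicolon) }) (by exact hp) (by exact hg))
  rw [queried, queryLetter, den_of_true (by exact decide_eq_true rfl), den_seq,
    den_of_true (by exact decide_eq_true hd), den_seq]
  have h' : (writeQueries mode).den model (model.read (some .word) (some (some .semicolon)) d) = _ := h
  rw [h', den_empty]
  cases d with | mk v =>
  cases v
  simp only at hd
  subst hd
  rfl

theorem foldl_queried_goal {mode : Bool → Bool} : ∀ (w : List Letter), (∀ a ∈ w, a ≠ .semicolon) →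
    ∀ d : Store, d.phase = .goal →
    erase ((w.map some).foldl (queried mode) d) = erase { d with
      goal := (w.map some).reverse ++ d.goal }
  | [], _, _, _ => rfl
  | a :: w, hw, d, hd => by
    obtain ⟨ha, hw⟩ := List.forall_mem_cons.1 hw
    obtain ⟨c, s, h⟩ := exists_of_erase (queried_goal (mode := mode) hd ha)
    rw [List.map_cons, List.foldl_cons, h]
    refine (foldl_queried_goal w hw _ (by exact hd)).trans ?_
    rw [List.reverse_cons, List.append_assoc]
    rfl

theorem foldl_queried_of_ne_goal {mode : Bool → Bool} : ∀ (w : List Letter),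
    (∀ a ∈ w, a ≠ .semicolon) → ∀ d : Store, d.phase ≠ .goal →
    erase ((w.map some).foldl (queried mode) d) = erase d
  | [], _, _, _ => rfl
  | a :: w, hw, d, hd => by
    obtain ⟨ha, hw⟩ := List.forall_mem_cons.1 hw
    obtain ⟨c, s, h⟩ := exists_of_erase (queried_of_ne_goal (mode := mode) hd ha)
    rw [List.map_cons, List.foldl_cons, h]
    exact foldl_queried_of_ne_goal w hw _ (by exact hd)

theorem foldl_queried_player {mode : Bool → Bool} {x : REInput} {d : Store}
    (hp : Prepared x d) (hd : d.phase = .goal) (hg : d.goal = []) (p : PlayerData) :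
    erase (((encodePlayer p).map some).foldl (queried mode) d) = erase { d with
      outRev := (joinWords (goalQueries (mode d.nonempty) x.outcome x.resources p.goal)).reverse ++
        d.outRev } := by
  have e : (encodePlayer p).map some = (encodeFormula p.goal).map some ++ ([some Letter.semicolon] ++
      ((encodeFormulas p.endowment).map some ++ ([some Letter.semicolon] ++
        ((encodeFormulas p.contribution).map some ++ [some Letter.semicolon])))) := by
    simp [encodePlayer]
  rw [e]
  refine erase_foldl_append (foldl_queried_goal _
    (fun a ha => ne_semicolon_of_mem_encodeFormula ha) d hd) fun c v => ?_
  dsimp only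
  rw [hg, List.append_nil]
  refine erase_foldl_append (queried_semicolon_goal (by exact hp)
    (by exact hd) (by exact rfl)) fun c v => ?_
  dsimp only
  refine erase_foldl_append (foldl_queried_of_ne_goal _
    (fun a ha => ne_semicolon_of_mem_encodeFormulas ha) _ (by simp)) fun c v => ?_
  dsimp only
  refine erase_foldl_append (queried_semicolon_of_ne_goal (by simp)) fun c v => ?_
  dsimp only
  refine erase_foldl_append (foldl_queried_of_ne_goal _
    (fun a ha => ne_semicolon_of_mem_encodeFormulas ha) _ (by simp [Phase.next])) fun c v => ?_
  dsimp only
  refine (queried_semicolon_of_ne_goal (by simp [Phase.next])).trans ?_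
  cases d with | mk v =>
  cases v
  simp only at hd hg
  subst hd hg
  rfl

/-- `y` runs through the final segments of the input, whereas `x` is the whole input, which
determines the outcome and the pool. -/
theorem foldl_queried_input {mode : Bool → Bool} {x : REInput} : ∀ (y : REInput) (d : Store),
    Prepared x d → d.phase = .goal → d.goal = [] →
    erase (((encodeInput y).map some).foldl (queried mode) d) = erase { d with
      outRev := (joinWords (y.flatMap fun p => goalQueries (mode d.nonempty) x.outcome x.resources
        p.goal)).reverse ++ d.outRev }
  | [], _, _, _, _ => rfl
  | p :: y, d, hp, hd, hg => by
    rw [encodeInput_cons, List.map_append]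
    refine erase_foldl_append (foldl_queried_player hp hd hg p) fun c v => ?_
    dsimp only
    refine (foldl_queried_input y _ (by exact hp) (by exact hd) (by exact hg)).trans ?_
    rw [List.flatMap_cons, joinWords_append, List.reverse_append, List.append_assoc]
    rfl

theorem den_queryLoop {mode : Bool → Bool} {x : REInput} {d : Store} (hp : Prepared x d)
    (hd : d.phase = .goal) (hg : d.goal = []) (hw : d.word = (encodeInput x).map some) :
    ((loop (some .word) (queryLetter mode)).den model d).outRev =
      (joinWords (x.flatMap fun p => goalQueries (mode d.nonempty) x.outcome x.resources
        p.goal)).reverse ++ d.outRev := by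
  have h := foldl_queried_input (mode := mode) x d hp hd hg
  rw [← hw] at h
  exact congrArg Store.outRev h

end queries

/-! ### The effect of the whole program -/

section main

/-- All stacks are empty. -/
def blank : Store where
  cur := none
  saved := none
  status := .idle
  phase := .goal
  nonempty := false
  ok := true
  equal := true
  found := false
  inp := []
  out := []
  outRev := []
  word := []
  wordRev := []
  counter := []
  item := []
  itemRev := []
  stock := []
  stockRev := []
  pool := []
  outcome := []
  before := []
  after := []
  removed := []
  copy := []
  copyRev := []
  goal := []
  aux := []

variable (conn : Connective → Bool) (pref : Preference)

/-- The contributions are contained in the endowments. -/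
def _root_.RG.REInput.contained (x : REInput) : Bool := x.all PlayerData.contained

theorem den_main_of_not_accepts {w : List Letter}
    (h : ¬ ParserState.Accepts conn ⟨.idle, .goal, 0⟩ w) :
    ((main conn pref).den model { blank with inp := w }).outRev = [] := by
  have hp := den_parse (conn := conn) blank ⟨.idle, .goal, 0⟩ w
  have hp' : (parse conn).den model { blank with inp := w } = _ := hp
  rw [main, den_seq, hp', den_of_false]
  · rfl
  · refine Bool.eq_false_iff.2 fun h' => h ?_
    have h' : (decide _ && decide _) = true := h'
    rw [Bool.and_eq_true, decide_eq_true_iff, decide_eq_true_iff] at h'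
    exact h'

theorem den_main_of_accepts {x : REInput} (h : x.Uses conn) :
    ((main conn pref).den model { blank with inp := encodeInput x }).outRev =
      if x.contained then (joinWords (inputQueries pref x)).reverse else [] := by
  have hp := den_parse (conn := conn) blank ⟨.idle, .goal, 0⟩ (encodeInput x)
  rw [foldl_encodeInput x h] at hp
  have hp' : (parse conn).den model { blank with inp := encodeInput x } = { blank with
    wordRev := ((encodeInput x).map some).reverse ++ [] } := hp
  have hm : (move .wordRev .word).den model { blank with
      wordRev := ((encodeInput x).map some).reverse ++ [] } = { blank with
      word := (encodeInput x).map some } := by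
    rw [den_move]
    change ({ blank with
      word := (((encodeInput x).map some).reverse ++ []).reverse ++ [] } : Store) = _
    simp
  rw [main, den_seq, hp', den_of_true (by exact rfl), den_seq, hm, den_seq,
    den_check x _ (by exact rfl) (by exact rfl) (by exact rfl) (by exact rfl)
      ⟨rfl, rfl, rfl, rfl⟩]
  have hnil : ∀ l : List Letter, (l.map some).reverse ++ ([] : List (Option Letter)) =
    (l.map some).reverse := fun _ => List.append_nil _
  cases hc : x.contained
  · rw [den_of_false (by exact hc)]
    rfl
  · rw [den_of_true (by exact hc), den_seq, den_move]
    refine (den_queryLoop (x := x) ⟨rfl, rfl, rfl, rfl, hnil _, hnil _, hnil _, hnil _⟩ rfl rfl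
      ?_).trans ?_
    · change (((encodeInput x).map some).reverse ++ []).reverse ++ [] = _
      simp
    · have hmode : mode pref (!x.outcome.isEmpty) = removalMode pref x.outcome := by
        cases pref <;> rfl
      change (joinWords (x.flatMap fun p => goalQueries (mode pref (!x.outcome.isEmpty)) x.outcome
        x.resources p.goal)).reverse ++ [] = _
      rw [hmode, List.append_nil]
      rfl

end main

end Writer
end RG

namespace RG

/-! ### The algorithm with parallel queries -/

section Legal

open Classical in
/-- The connectives of the logic. -/
noncomputable def ResourceLogic.conn (LOG : ResourceLogic) (c : Connective) : Bool :=
  decide (c ∈ LOG.connectives)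

theorem uses_conn_iff {LOG : ResourceLogic} {A : Formula} : A.Uses LOG.conn ↔ LOG.IsFormula A := by
  simp [Formula.Uses, ResourceLogic.conn, ResourceLogic.IsFormula]

theorem contained_iff (p : PlayerData) :
    p.contained = true ↔ (p.contribution : Multiset Formula) ≤ p.endowment := by
  rw [PlayerData.contained, Writer.covers_iff, Writer.remaining_coe]

/-- Legality speaks only of the formulas of goals and endowments, the parser also of those in
contributions. Containment in the endowments makes up the difference. -/
theorem legal_iff {LOG : ResourceLogic} {x : REInput} :
    x.Legal LOG ↔ x.Uses LOG.conn ∧ x.contained = true := by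
  have hall : ∀ Q : PlayerData → Prop, (∀ i : Fin x.length, Q (x.get i)) ↔ ∀ p ∈ x, Q p := by
    intro Q
    constructor
    · intro h p hp
      obtain ⟨i, rfl⟩ := List.get_of_mem hp
      exact h i
    · exact fun h i => h _ (List.get_mem x i)
  have h₁ := hall fun p => LOG.IsFormula p.goal ∧ ∀ A ∈ (p.endowment : Multiset Formula), LOG.IsFormula A
  have h₂ := hall fun p => (p.contribution : Multiset Formula) ≤ p.endowment
  refine (and_congr h₁ h₂).trans ?_
  rw [REInput.contained, List.all_eq_true]
  simp only [REInput.Uses, contained_iff, uses_conn_iff, Multiset.mem_coe]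
  constructor
  · rintro ⟨h, h'⟩
    exact ⟨fun p hp => ⟨(h p hp).1, (h p hp).2, fun A hA =>
      (h p hp).2 A (Multiset.mem_of_le (h' p hp) hA)⟩, h'⟩
  · rintro ⟨h, h'⟩
    exact ⟨fun p hp => ⟨(h p hp).1, (h p hp).2.1⟩, h'⟩

end Legal

/-! ### The queries as a function of the word -/

section Queries

variable (LOG : ResourceLogic) (pref : Preference)

open Classical in
/-- The queries for an arbitrary word. -/
noncomputable def wordQueries (w : List Letter) : List (List Letter) :=
  if h : ∃ x : REInput, w = encodeInput x ∧ x.Legal LOG then inputQueries pref h.choose else []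

variable {LOG}

/-- The input that is chosen in `wordQueries` is `x` itself, because the encoding is injective. -/
theorem wordQueries_encodeInput {x : REInput} (hx : x.Legal LOG) :
    wordQueries LOG pref (encodeInput x) = inputQueries pref x := by
  have h : ∃ y : REInput, encodeInput x = encodeInput y ∧ y.Legal LOG := ⟨x, rfl, hx⟩
  rw [wordQueries, dif_pos h, ← encodeInput_injective h.choose_spec.1]

theorem wordQueries_of_not_legal {w : List Letter}
    (h : ¬ ∃ x : REInput, w = encodeInput x ∧ x.Legal LOG) : wordQueries LOG pref w = [] :=
  dif_neg h

/-- Nothing is written unless the parser accepts and the contributions are contained in the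
endowments; together these checks single out the encodings of legal inputs. -/
theorem outRev_main (w : List Letter) :
    ((Writer.main LOG.conn pref).den model { Writer.blank with inp := w }).outRev =
      (joinWords (wordQueries LOG pref w)).reverse := by
  by_cases h : ParserState.Accepts LOG.conn ⟨.idle, .goal, 0⟩ w
  · obtain ⟨x, hx, rfl⟩ := accepts_iff w |>.1 h
    rw [Writer.den_main_of_accepts LOG.conn pref hx]
    split
    · next hc => rw [wordQueries_encodeInput pref (legal_iff.2 ⟨hx, hc⟩)]
    · next hc =>
      rw [wordQueries_of_not_legal]
      · rfl
      · rintro ⟨y, hy, hl⟩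
        rw [← encodeInput_injective hy] at hl
        exact hc (legal_iff.1 hl).2
  · rw [Writer.den_main_of_not_accepts LOG.conn pref h, wordQueries_of_not_legal]
    · rfl
    · rintro ⟨y, rfl, hl⟩
      exact h ((accepts_iff _).2 ⟨y, (legal_iff.1 hl).1, rfl⟩)

theorem polyTime_wordQueries : PolyTime fun w => joinWords (wordQueries LOG pref w) := by
  refine LProg.PolyRun.computable (k₀ := none) (k₁ := some .out) model (Equiv.refl Letter)
    (Equiv.refl (Option Letter)) (Writer.polyRun_main LOG.conn pref) Writer.blank ?_ id _ fun w => ?_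
  · funext k
    rcases k with _ | k
    · rfl
    · cases k <;> rfl
  · have hset : model.set Writer.blank none (w.map (Equiv.refl Letter).symm) =
        { Writer.blank with inp := w } := by
      have : w.map (Equiv.refl Letter).symm = w := List.map_id w
      rw [this]
      rfl
    -- `main` does not touch `out`, which is therefore still empty when the output is reversed onto
    -- it.
    have hout := LProg.stk_den model (k := some .out) (Writer.main LOG.conn pref) rfl
      { Writer.blank with inp := w }
    rw [hset, Writer.den_seq, Writer.den_move]
    change ((Writer.main LOG.conn pref).den model { Writer.blank with inp := w }).outRev.reverse ++
      model.stk ((Writer.main LOG.conn pref).den model { Writer.blank with inp := w }) (some .out) = _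
    rw [hout, outRev_main, List.reverse_reverse]
    exact (List.append_nil _).trans (List.map_id _).symm

end Queries

/-! ### Finite automata as machines -/

section Automaton

variable {α σ : Type}

abbrev AutomatonSym (α : Type) : Bool → Type
  | false => α
  | true => Bool

/-- A machine that reads its input letter by letter. -/
def automatonModel (step : σ → α → σ) :
    Model (AutomatonSym α) (σ × Bool) ((σ × Bool) × ∀ k, List (AutomatonSym α k)) where
  var := Prod.fst
  stk := Prod.snd
  setVar d v := (v, d.2)
  set d k l := (d.1, Function.update d.2 k l)
  rd k v o :=
    match k, o with
    | false, some a => (step v.1 a, true)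
    | _, o => (v.1, o.isSome)
  got := Prod.snd
  ext' _ _ h h' := Prod.ext h h'
  var_setVar _ _ := rfl
  stk_setVar _ _ := rfl
  var_set _ _ _ := rfl
  stk_set _ _ _ := rfl
  got_rd k v o := by cases k <;> cases o <;> rfl

/-- The languages of finite automata can be recognized in polynomial time. -/
theorem inP_automaton [Fintype α] [Fintype σ] (step : σ → α → σ) (s₀ : σ) (acc : σ → Bool) :
    InP ({w | acc (w.foldl step s₀) = true} : Language α) := by
  refine ⟨fun w => acc (w.foldl step s₀), fun w => Iff.rfl, ?_⟩
  -- The transition takes place in `rd`, when a letter is popped, so the body of the loop has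
  -- nothing to do.
  let p : LProg (AutomatonSym α) (σ × Bool) :=
    .seq (.loop false (.load id)) (.push true fun v => acc v.1)
  have hp : LProg.PolyRun (automatonModel step) (fun _ => true) p := LProg.polyRun _ _ _ rfl
  have : Fintype (AutomatonSym α false) := ‹Fintype α›
  refine LProg.PolyRun.computable (k₀ := false) (k₁ := true) (automatonModel step) (Equiv.refl α)
    (Equiv.refl Bool) hp ((s₀, false), fun _ => []) rfl _ _ fun w => ?_
  let F (d : (σ × Bool) × ∀ k, List (AutomatonSym α k)) (a : α) :=
    (LProg.load id : LProg (AutomatonSym α) (σ × Bool)).den (automatonModel step)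
      ((automatonModel step).read false (some a) d)
  have hf : ∀ (w : List α) (d : (σ × Bool) × ∀ k, List (AutomatonSym α k)),
      (w.foldl F d).1.1 = w.foldl step d.1.1 ∧ (w.foldl F d).2 = d.2 := by
    intro w
    induction w with
    | nil => exact fun d => ⟨rfl, rfl⟩
    | cons a w ih => exact fun d => ih _
  have hp' : ∀ d : (σ × Bool) × ∀ k, List (AutomatonSym α k),
      (automatonModel step).stk (p.den (automatonModel step) d) true =
        acc (List.foldl F d (d.2 false)).1.1 :: (List.foldl F d (d.2 false)).2 true := by
    intro d
    rfl
  have hw : w.map (Equiv.refl α).symm = w := List.map_id w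
  rw [hw, hp', (hf _ _).1, (hf _ _).2]
  rfl

end Automaton

/-! ### Evaluation of the answers -/

section Verifier

/-- The state of the automaton that evaluates the answers: the phase, whether the outcome is
nonempty, the first answer of an incomplete pair, and the verdict. -/
abbrev EvaluatorState : Type := Phase × Bool × Option Bool × Bool

def evaluate (pref : Preference) : EvaluatorState → Letter ⊕ Bool → EvaluatorState
  | (p, n, o, r), .inl a =>
    if a = .semicolon then (p.next, n, o, r) else (p, n || decide (p = .contribution), o, r)
  | (p, n, none, r), .inr b => (p, n, some b, r)
  | (p, n, some a, r), .inr b =>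
    (p, n, none, r || if Writer.mode pref n then !a || b else !a && b)

variable {pref : Preference}

/-- The automaton keeps the first answer of a pair until the second arrives; an incomplete last pair
does not count, just as in `verdict`. -/
theorem foldl_evaluate_bits (p : Phase) (n : Bool) : ∀ (l : List Bool) (r : Bool),
    ((l.map Sum.inr).foldl (evaluate pref) (p, n, none, r)).2.2.2 =
      (r || verdict (Writer.mode pref n) l)
  | [], r => by simp [verdict]
  | [a], r => by simp [verdict, evaluate]
  | a :: b :: l, r => by
    have := foldl_evaluate_bits p n l (r || if Writer.mode pref n then !a || b else !a && b)
    rw [verdict, ← Bool.or_assoc]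
    exact this

theorem foldl_evaluate_letters (p : Phase) : ∀ (w : List Letter), (∀ a ∈ w, a ≠ .semicolon) →
    ∀ (n r : Bool) (o : Option Bool),
    (w.map Sum.inl).foldl (evaluate pref) (p, n, o, r) =
      (p, n || (decide (p = .contribution) && !w.isEmpty), o, r)
  | [], _, n, r, o => by simp
  | a :: w, hw, n, r, o => by
    obtain ⟨ha, hw⟩ := List.forall_mem_cons.1 hw
    rw [List.map_cons, List.foldl_cons, evaluate, if_neg ha, foldl_evaluate_letters p w hw]
    simp only [List.isEmpty_cons, Bool.not_false, Bool.and_true, Bool.or_assoc]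
    cases decide (p = .contribution) <;> simp

theorem isEmpty_encodeFormulas (Γ : List Formula) : (encodeFormulas Γ).isEmpty = Γ.isEmpty := by
  cases Γ with
  | nil => rfl
  | cons A Γ => rw [encodeFormulas_cons]; cases encodeFormula A <;> rfl

/-- A contribution is nonempty exactly if some letter other than a semicolon is read in its phase,
which a finite automaton can observe. -/
theorem foldl_evaluate_input : ∀ (x : REInput) (n : Bool),
    ((encodeInput x).map Sum.inl).foldl (evaluate pref) (.goal, n, none, false) =
      (.goal, n || !x.outcome.isEmpty, none, false)
  | [], n => by simp [encodeInput, REInput.outcome]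
  | p :: x, n => by
    have e : (encodePlayer p).map (Sum.inl (β := Bool)) = (encodeFormula p.goal).map Sum.inl ++
        (.inl .semicolon :: ((encodeFormulas p.endowment).map Sum.inl ++ (.inl .semicolon ::
          ((encodeFormulas p.contribution).map Sum.inl ++ [.inl .semicolon])))) := by
      simp [encodePlayer]
    have hs : ∀ (p : Phase) (n : Bool), evaluate pref (p, n, none, false) (.inl .semicolon) =
      (p.next, n, none, false) := fun _ _ => rfl
    rw [encodeInput_cons, List.map_append, List.foldl_append, e, List.foldl_append,
      foldl_evaluate_letters _ _ (fun a ha => Writer.ne_semicolon_of_mem_encodeFormula ha),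
      List.foldl_cons, hs, List.foldl_append,
      foldl_evaluate_letters _ _ (fun a ha => Writer.ne_semicolon_of_mem_encodeFormulas ha),
      List.foldl_cons, hs, List.foldl_append,
      foldl_evaluate_letters _ _ (fun a ha => Writer.ne_semicolon_of_mem_encodeFormulas ha),
      List.foldl_cons, hs, List.foldl_nil]
    refine (foldl_evaluate_input x _).trans ?_
    rw [isEmpty_encodeFormulas p.contribution, Writer.outcome_cons]
    cases p.contribution <;> simp [Phase.next]

theorem foldl_evaluate_inl (w : List Letter) : ∀ s : EvaluatorState,
    ((w.map Sum.inl).foldl (evaluate pref) s).2.2 = s.2.2 := by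
  induction w with
  | nil => exact fun _ => rfl
  | cons a w ih =>
    intro s
    rw [List.map_cons, List.foldl_cons, ih]
    obtain ⟨p, n, o, r⟩ := s
    rw [evaluate]
    split <;> rfl

variable {LOG : ResourceLogic}

/-- A finite automaton suffices for the evaluation: it finds out the mode and combines the answers
pair by pair. For a word that encodes no legal input there are no queries, and without answers the
verdict stays negative. -/
theorem isParallelQueryAlgorithm (hLOG : LOG.Affine) :
    IsParallelQueryAlgorithm (RationalElimination LOG pref) (SequentValidity LOG)
      (wordQueries LOG pref) := by
  refine ⟨polyTime_wordQueries pref, _, inP_automaton (evaluate pref) (.goal, false, none, false)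
    (fun s => s.2.2.2), fun w => ?_⟩
  by_cases h : ∃ x : REInput, w = encodeInput x ∧ x.Legal LOG
  · obtain ⟨x, rfl, hx⟩ := h
    have h₁ : encodeInput x ∈ RationalElimination LOG pref ↔
        RationallyEliminable LOG pref (REInput.game x) (REInput.profile x) := by
      constructor
      · rintro ⟨y, hy, -, h⟩
        obtain rfl := encodeInput_injective hy
        exact h
      · exact fun h => ⟨x, rfl, hx, h⟩
    have hm : Writer.mode pref (!x.outcome.isEmpty) = removalMode pref x.outcome := by
      cases pref <;> rfl
    rw [h₁, rationallyEliminable_iff_verdict hLOG pref x hx, wordQueries_encodeInput pref hx]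
    change _ ↔ ((pair _ _).foldl (evaluate pref) _).2.2.2 = true
    rw [pair, List.foldl_append, foldl_evaluate_input, foldl_evaluate_bits, Bool.false_or,
      Bool.false_or, hm]
  · rw [wordQueries_of_not_legal pref h]
    refine iff_of_false ?_ ?_
    · rintro ⟨x, hw, hx, -⟩
      exact h ⟨x, hw, hx⟩
    · change ¬ ((pair w []).foldl (evaluate pref) _).2.2.2 = true
      rw [pair, List.map_nil, List.append_nil, foldl_evaluate_inl]
      simp

end Verifier

end RG


/-! ### The theorem -/

theorem mainTheorem8 (LOG : RG.ResourceLogic) (hLOG : LOG.Affine) (pref : RG.Preference) :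
    (RG.InNP (RG.SequentValidity LOG) → RG.InPNPParallel (RG.RationalElimination LOG pref)) ∧
    (RG.InPSPACE (RG.SequentValidity LOG) → RG.InPSPACE (RG.RationalElimination LOG pref)) ∧
    (∀ (n : ℕ) (G : RG.Game n) (P : RG.Profile n), G.IsOver LOG → P ∈ G.ch →
      (RG.RationallyEliminable LOG pref G P ↔ RG.EliminationTest LOG pref G P)) ∧
    (∃ queries : List RG.Letter → List (List RG.Letter),
      RG.IsParallelQueryAlgorithm (RG.RationalElimination LOG pref) (RG.SequentValidity LOG)
        queries ∧
      ∀ x : RG.REInput, x.Legal LOG →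
        ∀ q ∈ queries (RG.encodeInput x), RG.IsEliminationQuery pref x q) := by
  have h := RG.isParallelQueryAlgorithm (pref := pref) hLOG
  -- If validity is in `NP`, it can itself serve as the oracle.
  refine ⟨fun hNP => ⟨RG.Letter, inferInstance, _, _, hNP, h⟩, fun hP => hP.of_parallelQuery h,
    fun n G P hG hP => RG.rationallyEliminable_iff hLOG pref hG hP, _, h, fun x hx q hq => ?_⟩
  rw [RG.wordQueries_encodeInput pref hx] at hq
  exact RG.isEliminationQuery_of_mem pref x q hq
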